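/- Let $\Bbbk$ be a commutative ring and let $0\le k\le n$ be integers. All tensor products are over $\Bbbk$; the tensor product of superalgebras has multiplication $(a_1\otimes b_1)(a_2\otimes b_2)=(-1)^{|b_1||a_2|}a_1a_2\otimes b_1b_2$ on homogeneous elements. For $m\ge 0$ let $\mathrm{OPol}_m=\Bbbk\langle x_1,\dots,x_m\rangle/(x_ix_j+x_jx_i,\ i\ne j)$, with all $x_i$ odd. For $1\le i<m$ let $s_i$ be the algebra automorphism with $s_i(x_j)=-x_{s_i(j)}$, where $s_i(j)$ is the image of $j$ under the transposition $(i\ \,i{+}1)$, and let $\partial_i$ be the linear operator with $\partial_i(1)=0$, $\partial_i(x_j)=1$ for $j\in\{i,i+1\}$, $\partial_i(x_j)=0$ otherwise, and $\partial_i(fg)=\partial_i(f)g+s_i(f)\partial_i(g)$. Let $\mathrm{O}\Lambda_m=\bigcap_{i=1}^{m-1}\ker\partial_i$. It contains, with $\tilde x_i=(-1)^{i-1}x_i$, the elements $$\varepsilon_r=\sum_{1\le i_1<\dots<i_r\le m}\tilde x_{i_1}\cdots\tilde x_{i_r},\qquad h_r=\sum_{1\le i_1\le\dots\le i_r\le m}\tilde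 x_{i_1}\cdots\tilde x_{i_r}\qquad(r\ge 0).$$ Let $A_n$ be the supercommutative superalgebra generated by even elements $\chi_1,\dots,\chi_{\lfloor n/2\rfloor}$ and an odd element $d$, subject to $d^2=0$ and, if $n$ is even, $d\chi_{n/2}=0$, where $\chi_0=1$. Put $\chi_j=0$ for $j>\lfloor n/2\rfloor$, $c_i=\chi_{i/2}$ for $i$ even and $c_i=d\chi_{(i-1)/2}$ for $i$ odd; so $c_0=1$ and $c_i=0$ for $i>n$. In $\mathrm{O}\Lambda_k\otimes A_n$ put $h'_m=\sum_{r=0}^m(-1)^rh_{m-r}\otimes c_r$ for $m\ge 0$, and let $$M_k^n=(\mathrm{O}\Lambda_k\otimes A_n)/\langle h'_m\mid n-k+1\le m\le n\rangle,$$ the quotient by a two-sided ideal, a superalgebra with structure map $A_n\to M_k^n$, $a\mapsto 1\otimes a$. Then there is an isomorphism of $A_n$-superalgebras (an even algebra isomorphism that is compatible with the structure maps from $A_n$) $\gamma_k^n\colon M_k^n\to M_{n-k}^n$ such that $$\gamma_k^n(h'_r)=(-1)^{(k+1)r+\binom r2}\,\varepsilon_r\otimes 1\qquad\text{for all } r\ge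 0,$$ and it is the only isomorphism of $A_n$-superalgebras with this property. -/

import Mathlib

open scoped TensorProduct DirectSum

noncomputable section

namespace OddGr

/-! ### Parity gradings on algebras given by generators -/

section Words

variable (R : Type*) [CommRing R] {A X : Type*} [Ring A] [Algebra R A]

/-- The span of all words in the generators `g x` whose total parity is `i`, where the generator
`g x` has parity `p x`. -/
def wordPart (g : X → A) (p : X → ZMod 2) (i : ZMod 2) : Submodule R A :=
  Submodule.span R {a | ∃ w : List X, (w.map p).sum = i ∧ (w.map g).prod = a}

variable {R}

theorem gen_mem_wordPart (g : X → A) (p : X → ZMod 2) (x : X) :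
    g x ∈ wordPart R g p (p x) :=
  Submodule.subset_span ⟨[x], by simp, by simp⟩

instance wordPart.gradedMonoid (g : X → A) (p : X → ZMod 2) :
    SetLike.GradedMonoid (wordPart R g p) where
  one_mem := Submodule.subset_span ⟨[], by simp, by simp⟩
  mul_mem i j a b ha hb := by
    have h : wordPart R g p i * wordPart R g p j ≤ wordPart R g p (i + j) := by
      rw [wordPart, wordPart, Submodule.span_mul_span]
      refine Submodule.span_le.2 ?_
      rintro _ ⟨_, ⟨w, rfl, rfl⟩, _, ⟨v, rfl, rfl⟩, rfl⟩
      exact Submodule.subset_span ⟨w ++ v, by simp, by simp⟩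
    exact h (Submodule.mul_mem_mul ha hb)

/-- The generator `g x` as an element of the direct sum of the parity parts. -/
def genOf (g : X → A) (p : X → ZMod 2) (x : X) : ⨁ i, wordPart R g p i :=
  DirectSum.of (fun i => wordPart R g p i) (p x) ⟨g x, gen_mem_wordPart g p x⟩

theorem coe_genOf (g : X → A) (p : X → ZMod 2) (x : X) :
    DirectSum.coeAlgHom (wordPart R g p) (genOf g p x) = g x := by
  simp [genOf]

theorem lift_word (g : X → A) (p : X → ZMod 2) (F : A →ₐ[R] ⨁ i, wordPart R g p i)
    (hF : ∀ x, F (g x) = genOf g p x) (i : ZMod 2) (x : wordPart R g p i) :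
    F (x : A) = DirectSum.of (fun i => wordPart R g p i) i x := by
  obtain ⟨x, hx⟩ := x
  dsimp only
  induction hx using Submodule.span_induction with
  | mem a ha =>
    obtain ⟨w, rfl, rfl⟩ := ha
    induction w with
    | nil => simp only [List.map_nil, List.prod_nil, map_one]; rfl
    | cons x w ih =>
      have hw : (w.map g).prod ∈ wordPart R g p (w.map p).sum :=
        Submodule.subset_span ⟨w, rfl, rfl⟩
      change F ((g x) * (w.map g).prod) = _
      rw [map_mul, hF, genOf, ih, DirectSum.of_mul_of]
      exact DirectSum.of_eq_of_gradedMonoid_eq (Sigma.subtype_ext rfl rfl)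
  | zero => rw [map_zero]; exact (map_zero _).symm
  | add a b ha hb iha ihb => rw [map_add, iha, ihb, ← map_add]; rfl
  | smul c a ha iha =>
    rw [map_smul, iha]
    exact (map_smul (DirectSum.lof R _ (fun i => wordPart R g p i) i) c
      (⟨a, ha⟩ : wordPart R g p i)).symm

/-- If the generators extend to an algebra map `F` into the direct sum of the parity parts, and
algebra maps are determined by the generators, then the parity parts form a grading. -/
@[reducible]
def gradedOfLift (g : X → A) (p : X → ZMod 2) (F : A →ₐ[R] ⨁ i, wordPart R g p i)
    (hF : ∀ x, F (g x) = genOf g p x)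
    (hext : ∀ f₁ f₂ : A →ₐ[R] A, (∀ x, f₁ (g x) = f₂ (g x)) → f₁ = f₂) :
    GradedAlgebra (wordPart R g p) :=
  GradedAlgebra.ofAlgHom (wordPart R g p) F
    (hext _ _ fun x => by rw [AlgHom.comp_apply, hF]; exact coe_genOf _ _ _)
    (lift_word g p F hF)

end Words

/-! ### Skew polynomials -/

section OPol

variable (R : Type*) [CommRing R] (k : ℕ)

/-- The relations `x_i x_j + x_j x_i = 0` for `i ≠ j`. -/
inductive OPolRel : FreeAlgebra R (Fin k) → FreeAlgebra R (Fin k) → Prop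
  | anticomm (i j : Fin k) (h : i ≠ j) :
      OPolRel (FreeAlgebra.ι R i * FreeAlgebra.ι R j + FreeAlgebra.ι R j * FreeAlgebra.ι R i) 0

/-- The algebra of skew polynomials in `k` variables. -/
def OPol : Type _ := RingQuot (OPolRel R k)

instance : Ring (OPol R k) := inferInstanceAs (Ring (RingQuot (OPolRel R k)))

instance : Algebra R (OPol R k) := inferInstanceAs (Algebra R (RingQuot (OPolRel R k)))

/-- The quotient map from the free algebra. -/
def OPol.mk : FreeAlgebra R (Fin k) →ₐ[R] OPol R k := RingQuot.mkAlgHom R (OPolRel R k)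

theorem OPol.mk_surjective : Function.Surjective (OPol.mk R k) :=
  RingQuot.mkAlgHom_surjective R (OPolRel R k)

variable {k}

/-- The variable `x_{j+1}` (indices start from `0` here). -/
def X (j : Fin k) : OPol R k := OPol.mk R k (FreeAlgebra.ι R j)

variable {R}

theorem X_anticomm {i j : Fin k} (h : i ≠ j) : X R i * X R j + X R j * X R i = 0 := by
  have := RingQuot.mkAlgHom_rel R (OPolRel.anticomm (R := R) i j h)
  change OPol.mk R k _ = OPol.mk R k _ at this
  rwa [map_add, map_mul, map_mul, map_zero] at this

/-- The universal property of skew polynomials. -/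
def OPol.lift {B : Type*} [Ring B] [Algebra R B] (v : Fin k → B)
    (hv : ∀ i j, i ≠ j → v i * v j + v j * v i = 0) : OPol R k →ₐ[R] B :=
  RingQuot.liftAlgHom R ⟨FreeAlgebra.lift R v, by
    rintro _ _ ⟨i, j, h⟩
    simpa using hv i j h⟩

@[simp]
theorem OPol.lift_X {B : Type*} [Ring B] [Algebra R B] (v : Fin k → B)
    (hv : ∀ i j, i ≠ j → v i * v j + v j * v i = 0) (j : Fin k) :
    OPol.lift v hv (X R j) = v j := by
  exact (RingQuot.liftAlgHom_mkAlgHom_apply R _ _ _).trans (FreeAlgebra.lift_ι_apply v j)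

theorem OPol.hom_ext {B : Type*} [Ring B] [Algebra R B] {f g : OPol R k →ₐ[R] B}
    (h : ∀ j, f (X R j) = g (X R j)) : f = g := by
  apply RingQuot.ringQuot_ext' R f g
  apply FreeAlgebra.hom_ext
  funext j
  exact h j

variable (R k)

/-- The parity grading of the skew polynomials: every variable is odd. -/
def OPol.parity : ZMod 2 → Submodule R (OPol R k) := wordPart R (X R) (fun _ : Fin k => 1)

instance OPol.gradedMonoid : SetLike.GradedMonoid (OPol.parity R k) :=
  wordPart.gradedMonoid _ _

/-- The skew polynomials form a superalgebra. -/
instance OPol.gradedAlgebra : GradedAlgebra (OPol.parity R k) :=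
  gradedOfLift (X R) (fun _ : Fin k => 1)
    (OPol.lift (genOf (R := R) (X R) (fun _ : Fin k => 1)) (by
      intro i j h
      rw [genOf, genOf, DirectSum.of_mul_of, DirectSum.of_mul_of]
      refine (map_add _ _ _).symm.trans ?_
      refine (congrArg _ ?_).trans (map_zero (DirectSum.of _ (1 + 1)))
      exact Subtype.ext (X_anticomm h)))
    (fun x => OPol.lift_X _ _ _) (fun _ _ hf => OPol.hom_ext hf)

end OPol

/-! ### Odd divided differences and odd symmetric polynomials -/

section OLam

variable (R : Type*) [CommRing R] (k : ℕ)

/-- The transposition of the indices `i` and `i + 1`. -/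
def adj (i : ℕ) (hi : i + 1 < k) : Equiv.Perm (Fin k) :=
  Equiv.swap ⟨i, by omega⟩ ⟨i + 1, hi⟩

/-- The value `∂_i(x_j)`: it is `1` if `j` is `i` or `i + 1`, and `0` otherwise. -/
def divX (i : ℕ) (j : Fin k) : OPol R k := if (j : ℕ) = i ∨ (j : ℕ) = i + 1 then 1 else 0

/-- The action of the simple transposition, `s_i(x_j) = - x_{s_i(j)}`. -/
def sAct (i : ℕ) (hi : i + 1 < k) : OPol R k →ₐ[R] OPol R k :=
  OPol.lift (fun j => - X R (adj k i hi j)) (by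
    intro a b h
    have := X_anticomm (R := R) (fun e => h ((adj k i hi).injective e))
    simpa only [neg_mul_neg] using this)

/-- The homomorphism that packs `s_i` and `∂_i` into one upper triangular matrix
`f ↦ !![s_i(f), ∂_i(f); 0, f]`. -/
def divMat (i : ℕ) (hi : i + 1 < k) : OPol R k →ₐ[R] Matrix (Fin 2) (Fin 2) (OPol R k) :=
  OPol.lift (fun j => !![- X R (adj k i hi j), divX R k i j; 0, X R j]) (by
    intro a b h
    have h1 := X_anticomm (R := R) h
    have h2 := X_anticomm (R := R) (fun e => h ((adj k i hi).injective e))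
    have h3 : -(X R (adj k i hi a) * divX R k i b) + divX R k i a * X R b +
        (-(X R (adj k i hi b) * divX R k i a) + divX R k i b * X R a) = 0 := by
      by_cases ha : a = ⟨i, by omega⟩
      · subst ha
        by_cases hb : b = ⟨i + 1, hi⟩
        · subst hb; simp [divX, adj]
        · have hbi : (b : ℕ) ≠ i + 1 := fun e => hb (Fin.ext e)
          have hbi' : (b : ℕ) ≠ i := fun e => h (Fin.ext e.symm)
          simp [divX, adj, Equiv.swap_apply_of_ne_of_ne (Ne.symm h) hb, hbi, hbi']
      · by_cases ha' : a = ⟨i + 1, hi⟩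
        · subst ha'
          by_cases hb : b = ⟨i, by omega⟩
          · subst hb; simp [divX, adj]
          · have hbi : (b : ℕ) ≠ i := fun e => hb (Fin.ext e)
            have hbi' : (b : ℕ) ≠ i + 1 := fun e => h (Fin.ext e.symm)
            simp [divX, adj, Equiv.swap_apply_of_ne_of_ne hb (Ne.symm h), hbi, hbi']
        · have hai : (a : ℕ) ≠ i := fun e => ha (Fin.ext e)
          have hai' : (a : ℕ) ≠ i + 1 := fun e => ha' (Fin.ext e)
          by_cases hb : (b : ℕ) = i ∨ (b : ℕ) = i + 1
          · simp [divX, adj, Equiv.swap_apply_of_ne_of_ne ha ha', hai, hai', hb]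
          · simp [divX, hai, hai', hb]
    ext u v
    fin_cases u <;> fin_cases v
    · simpa [Matrix.mul_apply] using h2
    · simpa [Matrix.mul_apply] using h3
    · simp
    · simpa [Matrix.mul_apply] using h1)

/-- The odd divided difference operator `∂_i`. -/
def div (i : ℕ) (hi : i + 1 < k) : OPol R k →ₗ[R] OPol R k :=
  Matrix.entryLinearMap R (OPol R k) 0 1 ∘ₗ (divMat R k i hi).toLinearMap

variable {R k}

theorem div_apply {i : ℕ} (hi : i + 1 < k) (f : OPol R k) :
    div R k i hi f = divMat R k i hi f 0 1 := rfl

theorem OPol.induction {P : OPol R k → Prop} (hc : ∀ c : R, P (algebraMap R _ c))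
    (hX : ∀ j, P (X R j)) (hadd : ∀ f g, P f → P g → P (f + g))
    (hmul : ∀ f g, P f → P g → P (f * g)) (f : OPol R k) : P f := by
  obtain ⟨f, rfl⟩ := OPol.mk_surjective R k f
  induction f using FreeAlgebra.induction with
  | grade0 c => simpa using hc c
  | grade1 x => exact hX x
  | mul a b ha hb => rw [map_mul]; exact hmul _ _ ha hb
  | add a b ha hb => rw [map_add]; exact hadd _ _ ha hb

theorem divMat_entries {i : ℕ} (hi : i + 1 < k) (f : OPol R k) :
    divMat R k i hi f 0 0 = sAct R k i hi f ∧ divMat R k i hi f 1 0 = 0 ∧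
      divMat R k i hi f 1 1 = f := by
  induction f using OPol.induction with
  | hc c => simp [Matrix.algebraMap_matrix_apply]
  | hX j => simp [divMat, sAct]
  | hadd f g hf hg => simp [hf, hg]
  | hmul f g hf hg => simp [Matrix.mul_apply, hf, hg]

/-- `∂_i(x_j) = 1` if `j = i, i + 1`, and `0` otherwise. -/
theorem div_X {i : ℕ} (hi : i + 1 < k) (j : Fin k) :
    div R k i hi (X R j) = if (j : ℕ) = i ∨ (j : ℕ) = i + 1 then 1 else 0 := by
  simp [div_apply, divMat, divX]

theorem sAct_X {i : ℕ} (hi : i + 1 < k) (j : Fin k) :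
    sAct R k i hi (X R j) = - X R (adj k i hi j) := by
  simp [sAct]

/-- The Leibniz rule `∂_i(fg) = ∂_i(f) g + s_i(f) ∂_i(g)`. -/
theorem div_mul {i : ℕ} (hi : i + 1 < k) (f g : OPol R k) :
    div R k i hi (f * g) = div R k i hi f * g + sAct R k i hi f * div R k i hi g := by
  have hf := divMat_entries hi f
  have hg := divMat_entries hi g
  simp [div_apply, Matrix.mul_apply, hf, hg, add_comm]

theorem div_algebraMap {i : ℕ} (hi : i + 1 < k) (c : R) :
    div R k i hi (algebraMap R _ c) = 0 := by
  simp [div_apply, Matrix.algebraMap_matrix_apply]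

variable (R k)

/-- The ring of odd symmetric polynomials: the common kernel of the `∂_i`. -/
def OLam : Subalgebra R (OPol R k) where
  carrier := {f | ∀ (i : ℕ) (hi : i + 1 < k), div R k i hi f = 0}
  mul_mem' := by
    intro f g hf hg i hi
    rw [div_mul, hf i hi, hg i hi]; simp
  add_mem' := by
    intro f g hf hg i hi
    rw [map_add, hf i hi, hg i hi, add_zero]
  algebraMap_mem' := fun c i hi => div_algebraMap hi c

variable {R k}

theorem mem_OLam {f : OPol R k} :
    f ∈ OLam R k ↔ ∀ (i : ℕ) (hi : i + 1 < k), div R k i hi f = 0 := Iff.rfl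

/-- The simple transpositions act by even maps. -/
theorem sAct_parity {i : ℕ} (hi : i + 1 < k) (a : ZMod 2) (f : OPol R k)
    (hf : f ∈ OPol.parity R k a) : sAct R k i hi f ∈ OPol.parity R k a := by
  induction hf using Submodule.span_induction with
  | mem f hf =>
    obtain ⟨w, rfl, rfl⟩ := hf
    induction w with
    | nil => simpa using (SetLike.GradedOne.one_mem (A := OPol.parity R k))
    | cons x w ih =>
      rw [List.map_cons, List.map_cons, List.prod_cons, List.sum_cons, map_mul, sAct_X]
      exact SetLike.GradedMul.mul_mem (A := OPol.parity R k)
        (Submodule.neg_mem _ (gen_mem_wordPart (R := R) (X R) (fun _ : Fin k => 1) _)) ih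
  | zero => rw [map_zero]; exact Submodule.zero_mem _
  | add a b _ _ iha ihb => rw [map_add]; exact Submodule.add_mem _ iha ihb
  | smul c a _ iha => rw [map_smul]; exact Submodule.smul_mem _ _ iha

/-- The odd divided differences are odd maps. -/
theorem div_parity {i : ℕ} (hi : i + 1 < k) (a : ZMod 2) (f : OPol R k)
    (hf : f ∈ OPol.parity R k a) : div R k i hi f ∈ OPol.parity R k (a + 1) := by
  induction hf using Submodule.span_induction with
  | mem f hf =>
    obtain ⟨w, rfl, rfl⟩ := hf
    induction w with
    | nil =>
      have := div_algebraMap (R := R) hi 1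
      rw [map_one] at this
      simp [this]
    | cons x w ih =>
      rw [List.map_cons, List.map_cons, List.prod_cons, List.sum_cons, div_mul, div_X, sAct_X]
      have hw : (w.map (X R)).prod ∈ OPol.parity R k (w.map fun _ => 1).sum :=
        Submodule.subset_span ⟨w, rfl, rfl⟩
      have h2 : (1 : ZMod 2) + 1 = 0 := by decide
      refine Submodule.add_mem _ ?_ ?_
      · rw [add_comm (1 : ZMod 2), add_assoc, h2, add_zero]
        split_ifs
        · simpa using hw
        · simp
      · rw [add_assoc]
        exact SetLike.GradedMul.mul_mem (A := OPol.parity R k)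
          (Submodule.neg_mem _ (gen_mem_wordPart (R := R) (X R) (fun _ : Fin k => 1) _)) ih
  | zero => rw [map_zero]; exact Submodule.zero_mem _
  | add a b _ _ iha ihb => rw [map_add]; exact Submodule.add_mem _ iha ihb
  | smul c a _ iha => rw [map_smul]; exact Submodule.smul_mem _ _ iha

theorem sum_parts (f : OPol R k) :
    ∑ b : ZMod 2, (DirectSum.decompose (OPol.parity R k) f b : OPol R k) = f := by
  classical
  conv_rhs => rw [← DirectSum.sum_support_decompose (OPol.parity R k) f]
  refine (Finset.sum_subset (Finset.subset_univ _) ?_).symm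
  intro b _ hb
  simpa using hb

/-- The parity components of an odd symmetric polynomial are odd symmetric. -/
theorem OLam_homogeneous (f : OPol R k) (hf : f ∈ OLam R k) (a : ZMod 2) :
    (DirectSum.decompose (OPol.parity R k) f a : OPol R k) ∈ OLam R k := by
  intro i hi
  set F := DirectSum.decompose (OPol.parity R k) f with hF
  have hsum : ∑ b : ZMod 2, ((F b : OPol R k)) = f := by
    exact sum_parts f
  have hd : ∑ b : ZMod 2, div R k i hi (F b : OPol R k) = 0 := by
    rw [← map_sum, hsum, hf i hi]
  have hmem : ∀ b, div R k i hi (F b : OPol R k) ∈ OPol.parity R k (b + 1) :=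
    fun b => div_parity hi b _ (F b).2
  have key := congrArg
    (fun g => (DirectSum.decompose (OPol.parity R k) g (a + 1) : OPol R k)) hd
  simp only [DirectSum.decompose_sum, DirectSum.decompose_zero] at key
  rw [DFinsupp.finsetSum_apply, AddSubmonoidClass.coe_finsetSum,
    Finset.sum_eq_single a] at key
  · rw [DirectSum.decompose_of_mem_same _ (hmem a)] at key
    simpa using key
  · intro b _ hb
    exact DirectSum.decompose_of_mem_ne _ (hmem b) (fun e => hb (add_right_cancel e))
  · simp

variable (R k)

/-- The parity grading of the odd symmetric polynomials, inherited from skew polynomials. -/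
def OLam.parity (a : ZMod 2) : Submodule R (OLam R k) :=
  (OPol.parity R k a).comap (OLam R k).val.toLinearMap

instance OLam.gradedMonoid : SetLike.GradedMonoid (OLam.parity R k) where
  one_mem := SetLike.GradedOne.one_mem (A := OPol.parity R k)
  mul_mem _ _ _ _ ha hb := SetLike.GradedMul.mul_mem (A := OPol.parity R k) ha hb

/-- The odd symmetric polynomials form a superalgebra. -/
instance OLam.gradedAlgebra : GradedAlgebra (OLam.parity R k) where
  toDecomposition := DirectSum.Decomposition.ofAddHom (OLam.parity R k)
    (∑ a : ZMod 2, (DirectSum.of (fun a => OLam.parity R k a) a).comp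
      { toFun := fun f => ⟨⟨(DirectSum.decompose (OPol.parity R k) (f : OPol R k) a : OPol R k),
          OLam_homogeneous _ f.2 a⟩,
          (DirectSum.decompose (OPol.parity R k) (f : OPol R k) a).2⟩
        map_zero' := by ext; simp
        map_add' := fun f g => by ext; simp })
    (by
      ext f
      simp only [AddMonoidHom.comp_apply, AddMonoidHom.finsetSum_apply, map_sum,
        DirectSum.coeAddMonoidHom_of, AddMonoidHom.id_apply]
      rw [AddSubmonoidClass.coe_finsetSum]
      dsimp
      exact sum_parts (f : OPol R k))
    (by
      ext a f : 2
      simp only [AddMonoidHom.comp_apply, AddMonoidHom.finsetSum_apply,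
        DirectSum.coeAddMonoidHom_of, AddMonoidHom.id_apply]
      rw [Finset.sum_eq_single a]
      · congr 1
        ext
        exact DirectSum.decompose_of_mem_same _ f.2
      · intro b _ hb
        refine (congrArg _ ?_).trans (map_zero (DirectSum.of (fun a => OLam.parity R k a) b))
        ext
        exact DirectSum.decompose_of_mem_ne _ f.2 (Ne.symm hb)
      · simp)

end OLam

/-! ### Odd elementary and odd complete symmetric polynomials -/

section Generic

variable {B : Type*} [Ring B]

/-- The sum of the products of all length `r` sublists of `L`. -/
def esymmList (L : List B) (r : ℕ) : B := ((L.sublistsLen r).map List.prod).sum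

/-- The sum of the ordered monomials `v_1^{a_1} ⋯ v_k^{a_k}` of degree `r = a_1 + ⋯ + a_k`. -/
def hsymmTuple {k : ℕ} (v : Fin k → B) (r : ℕ) : B :=
  ∑ a ∈ Finset.Nat.antidiagonalTuple k r, (List.ofFn fun j => v j ^ a j).prod

/-- Recursive form of `hsymmTuple`. -/
def hsymmList : List B → ℕ → B
  | [], r => if r = 0 then 1 else 0
  | a :: L, r => ∑ p ∈ Finset.HasAntidiagonal.antidiagonal r, a ^ p.1 * hsymmList L p.2

theorem esymmList_zero (L : List B) : esymmList L 0 = 1 := by simp [esymmList]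

theorem esymmList_nil (r : ℕ) : esymmList ([] : List B) (r + 1) = 0 := by simp [esymmList]

theorem esymmList_cons (a : B) (L : List B) (r : ℕ) :
    esymmList (a :: L) (r + 1) = esymmList L (r + 1) + a * esymmList L r := by
  simp [esymmList, List.map_map, Function.comp_def, List.sum_map_mul_left]

theorem sum_flatMap {α : Type*} (l : List α) (f : α → List B) :
    (l.flatMap f).sum = (l.map fun x => (f x).sum).sum := by
  induction l with
  | nil => simp
  | cons x l ih => simp [ih]

theorem hsymmTuple_eq : ∀ {k : ℕ} (v : Fin k → B) (r : ℕ),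
    hsymmTuple v r = hsymmList (List.ofFn v) r
  | 0, v, 0 => by simp [hsymmTuple, hsymmList]
  | 0, v, r + 1 => by simp [hsymmTuple, hsymmList]
  | k + 1, v, r => by
    rw [List.ofFn_succ, hsymmList]
    simp_rw [← hsymmTuple_eq]
    change (((List.Nat.antidiagonalTuple (k + 1) r).map fun a =>
      (List.ofFn fun j => v j ^ a j).prod)).sum =
      ((List.Nat.antidiagonal r).map fun p => v 0 ^ p.1 * hsymmTuple (fun j => v j.succ) p.2).sum
    rw [List.Nat.antidiagonalTuple, List.map_flatMap, sum_flatMap]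
    congr 1
    apply List.map_congr_left
    intro p _
    rw [List.map_map]
    change _ = v 0 ^ p.1 * ((List.Nat.antidiagonalTuple k p.2).map fun a =>
      (List.ofFn fun j => v j.succ ^ a j).prod).sum
    rw [← List.sum_map_mul_left]
    simp [Function.comp_def, List.ofFn_succ]

theorem hsymm_pair_rec (a b : B) (r : ℕ) :
    (∑ p ∈ Finset.HasAntidiagonal.antidiagonal (r + 2), a ^ p.1 * b ^ p.2) =
      (∑ p ∈ Finset.HasAntidiagonal.antidiagonal (r + 1), a ^ p.1 * b ^ p.2) * (a + b) -
        (∑ p ∈ Finset.HasAntidiagonal.antidiagonal r, a ^ p.1 * b ^ p.2) * (b * a) := by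
  have key : ∀ s : ℕ, (∑ p ∈ Finset.HasAntidiagonal.antidiagonal (s + 1), a ^ p.1 * b ^ p.2) =
      (∑ p ∈ Finset.HasAntidiagonal.antidiagonal s, a ^ p.1 * b ^ p.2) * b + a ^ (s + 1) := by
    intro s
    rw [Finset.Nat.antidiagonal_succ', Finset.sum_cons, Finset.sum_map, Finset.sum_mul, add_comm]
    simp [pow_succ, mul_assoc]
  rw [key (r + 1), mul_add, key r]
  noncomm_ring

theorem hsymmList_pair (a b : B) (L : List B) (r : ℕ) :
    hsymmList (a :: b :: L) r = ∑ p ∈ Finset.HasAntidiagonal.antidiagonal r,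
      (∑ q ∈ Finset.HasAntidiagonal.antidiagonal p.1, a ^ q.1 * b ^ q.2) * hsymmList L p.2 := by
  simp only [hsymmList, Finset.mul_sum, Finset.sum_mul]
  rw [Finset.sum_sigma', Finset.sum_sigma']
  refine Finset.sum_bij' (fun x _ => ⟨(x.1.1 + x.2.1, x.2.2), (x.1.1, x.2.1)⟩)
    (fun x _ => ⟨(x.2.1, x.2.2 + x.1.2), (x.2.2, x.1.2)⟩) ?_ ?_ ?_ ?_ ?_
  · rintro ⟨⟨_, _⟩, _, _⟩ hx
    simp only [Finset.mem_sigma, Finset.HasAntidiagonal.mem_antidiagonal] at hx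
    obtain ⟨rfl, rfl⟩ := hx
    simp [add_assoc]
  · rintro ⟨⟨_, _⟩, _, _⟩ hx
    simp only [Finset.mem_sigma, Finset.HasAntidiagonal.mem_antidiagonal] at hx
    obtain ⟨rfl, rfl⟩ := hx
    simp [add_assoc]
  · rintro ⟨⟨_, _⟩, _, _⟩ hx
    simp only [Finset.mem_sigma, Finset.HasAntidiagonal.mem_antidiagonal] at hx
    obtain ⟨rfl, rfl⟩ := hx
    rfl
  · rintro ⟨⟨_, _⟩, _, _⟩ hx
    simp only [Finset.mem_sigma, Finset.HasAntidiagonal.mem_antidiagonal] at hx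
    obtain ⟨rfl, rfl⟩ := hx
    rfl
  · rintro ⟨⟨_, _⟩, _, _⟩ hx
    exact (mul_assoc _ _ _).symm

theorem esymmList_mem (S : Subring B) (L : List B) (hL : ∀ c ∈ L, c ∈ S) (r : ℕ) :
    esymmList L r ∈ S := by
  induction L generalizing r with
  | nil => cases r <;> simp [esymmList]
  | cons c L ih =>
    have ih' := ih (fun c hc => hL c (List.mem_cons_of_mem _ hc))
    cases r with
    | zero => rw [esymmList_zero]; exact S.one_mem
    | succ r =>
      rw [esymmList_cons]
      exact S.add_mem (ih' _) (S.mul_mem (hL c List.mem_cons_self) (ih' _))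

theorem esymmList_pair_mem (S : Subring B) (a b : B) (hab : a + b ∈ S) (hm : a * b ∈ S)
    (L : List B) (hL : ∀ c ∈ L, c ∈ S) (r : ℕ) : esymmList (a :: b :: L) r ∈ S := by
  have h := esymmList_mem S L hL
  match r with
  | 0 => rw [esymmList_zero]; exact S.one_mem
  | 1 =>
    rw [esymmList_cons, esymmList_cons, esymmList_zero, esymmList_zero, mul_one, mul_one, add_assoc,
      add_comm b a]
    exact S.add_mem (h _) hab
  | r + 2 =>
    have e : esymmList (a :: b :: L) (r + 2) =
        esymmList L (r + 2) + (a + b) * esymmList L (r + 1) + a * b * esymmList L r := by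
      rw [esymmList_cons, esymmList_cons, esymmList_cons]; noncomm_ring
    rw [e]
    exact S.add_mem (S.add_mem (h _) (S.mul_mem hab (h _))) (S.mul_mem hm (h _))

theorem esymmList_append_mem (S : Subring B) (L L' : List B) (hL : ∀ c ∈ L, c ∈ S)
    (hL' : ∀ r, esymmList L' r ∈ S) (r : ℕ) : esymmList (L ++ L') r ∈ S := by
  induction L generalizing r with
  | nil => exact hL' r
  | cons c L ih =>
    have ih' := ih (fun c hc => hL c (List.mem_cons_of_mem _ hc))
    cases r with
    | zero => rw [esymmList_zero]; exact S.one_mem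
    | succ r =>
      rw [List.cons_append, esymmList_cons]
      exact S.add_mem (ih' _) (S.mul_mem (hL c List.mem_cons_self) (ih' _))

theorem hsymmList_append_mem (S : Subring B) (L L' : List B) (hL : ∀ c ∈ L, c ∈ S)
    (hL' : ∀ r, hsymmList L' r ∈ S) (r : ℕ) : hsymmList (L ++ L') r ∈ S := by
  induction L generalizing r with
  | nil => exact hL' r
  | cons c L ih =>
    rw [List.cons_append, hsymmList]
    exact S.sum_mem fun p _ => S.mul_mem (S.pow_mem (hL c List.mem_cons_self) _)
      (ih (fun c hc => hL c (List.mem_cons_of_mem _ hc)) _)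

theorem hsymmList_mem (S : Subring B) (L : List B) (hL : ∀ c ∈ L, c ∈ S) (r : ℕ) :
    hsymmList L r ∈ S := by
  have := hsymmList_append_mem S L [] hL (fun r => by
    rw [hsymmList]; split_ifs
    · exact S.one_mem
    · exact S.zero_mem) r
  rwa [List.append_nil] at this

theorem hsymmList_pair_mem (S : Subring B) (a b : B) (hab : a + b ∈ S) (hm : b * a ∈ S)
    (L : List B) (hL : ∀ c ∈ L, c ∈ S) (r : ℕ) : hsymmList (a :: b :: L) r ∈ S := by
  have h2 : ∀ s : ℕ, (∑ q ∈ Finset.HasAntidiagonal.antidiagonal s, a ^ q.1 * b ^ q.2) ∈ S := by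
    intro s
    induction s using Nat.strong_induction_on with
    | _ s ih =>
      match s, ih with
      | 0, _ => simp
      | 1, _ => simpa [Finset.Nat.antidiagonal_succ, add_comm] using hab
      | s + 2, ih =>
        rw [hsymm_pair_rec]
        exact S.sub_mem (S.mul_mem (ih _ (by omega)) hab) (S.mul_mem (ih _ (by omega)) hm)
  rw [hsymmList_pair]
  exact S.sum_mem fun p _ => S.mul_mem (h2 _) (hsymmList_mem S L hL _)

theorem map_esymmList {C : Type*} [Ring C] (f : B →+* C) (L : List B) (r : ℕ) :
    f (esymmList L r) = esymmList (L.map f) r := by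
  induction L generalizing r with
  | nil => cases r <;> simp [esymmList]
  | cons c L ih =>
    cases r with
    | zero => simp [esymmList_zero]
    | succ r => simp [esymmList_cons, ih]

theorem map_hsymmList {C : Type*} [Ring C] (f : B →+* C) (L : List B) (r : ℕ) :
    f (hsymmList L r) = hsymmList (L.map f) r := by
  induction L generalizing r with
  | nil => by_cases h : r = 0 <;> simp [hsymmList, h]
  | cons c L ih => simp [hsymmList, ih]

/-- The `2 × 2` matrices with vanishing upper right entry. -/
def lowerTri (B : Type*) [Ring B] : Subring (Matrix (Fin 2) (Fin 2) B) where
  carrier := {M | M 0 1 = 0}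
  mul_mem' := by intro M N hM hN; simp_all [Matrix.mul_apply]
  one_mem' := by simp
  add_mem' := by intro M N hM hN; simp_all
  zero_mem' := by simp
  neg_mem' := by intro M hM; simp_all

theorem mem_lowerTri {M : Matrix (Fin 2) (Fin 2) B} : M ∈ lowerTri B ↔ M 0 1 = 0 := Iff.rfl

end Generic

section EH

variable (R : Type*) [CommRing R] {k : ℕ}

/-- The signed variable `(-1)^{j-1} x_j` (here with indices starting from `0`). -/
def tX (j : Fin k) : OPol R k := (-1) ^ (j : ℕ) * X R j

variable (k)

/-- The odd elementary symmetric polynomial, the sum of all products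
`x̃_{i_1} ⋯ x̃_{i_r}` with `i_1 < ⋯ < i_r`. -/
def epsPol (r : ℕ) : OPol R k := esymmList (List.ofFn (tX R)) r

/-- The odd complete symmetric polynomial, the sum of all products
`x̃_{i_1} ⋯ x̃_{i_r}` with `i_1 ≤ ⋯ ≤ i_r`, that is, of all `x̃_1^{a_1} ⋯ x̃_k^{a_k}` with
`a_1 + ⋯ + a_k = r`. -/
def hPol (r : ℕ) : OPol R k := hsymmTuple (tX R) r

variable {k}

theorem divMat_tX {i : ℕ} (hi : i + 1 < k) (j : Fin k) :
    divMat R k i hi (tX R j) =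
      !![- ((-1) ^ (j : ℕ) * X R (adj k i hi j)), (-1) ^ (j : ℕ) * divX R k i j; 0, tX R j] := by
  have h : ∀ m : ℕ, ((-1) ^ m : Matrix (Fin 2) (Fin 2) (OPol R k)) =
      !![(-1) ^ m, 0; 0, (-1) ^ m] := by
    intro m
    rcases Nat.even_or_odd m with hm | hm
    · rw [hm.neg_one_pow, hm.neg_one_pow, Matrix.one_fin_two]
    · rw [hm.neg_one_pow, hm.neg_one_pow, Matrix.one_fin_two]; simp
  rw [tX, map_mul, map_pow, map_neg, map_one, h]
  ext u v
  fin_cases u <;> fin_cases v <;> simp [divMat, Matrix.mul_apply]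

theorem divMat_tX_mem {i : ℕ} (hi : i + 1 < k) (j : Fin k) (h1 : (j : ℕ) ≠ i)
    (h2 : (j : ℕ) ≠ i + 1) : divMat R k i hi (tX R j) ∈ lowerTri (OPol R k) := by
  rw [mem_lowerTri, divMat_tX]
  simp [divX, h1, h2]

theorem divMat_pair {i : ℕ} (hi : i + 1 < k) :
    divMat R k i hi (tX R ⟨i, by omega⟩) + divMat R k i hi (tX R ⟨i + 1, hi⟩)
        ∈ lowerTri (OPol R k) ∧
      divMat R k i hi (tX R ⟨i, by omega⟩) * divMat R k i hi (tX R ⟨i + 1, hi⟩)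
        ∈ lowerTri (OPol R k) ∧
      divMat R k i hi (tX R ⟨i + 1, hi⟩) * divMat R k i hi (tX R ⟨i, by omega⟩)
        ∈ lowerTri (OPol R k) := by
  simp only [mem_lowerTri, divMat_tX]
  rcases Nat.even_or_odd i with hm | hm <;>
    simp [hm.neg_one_pow, pow_succ, divX, adj, tX, Matrix.mul_apply]

theorem ofFn_split {B : Type*} (v : Fin k → B) {i : ℕ} (hi : i + 1 < k) :
    List.ofFn v = (List.ofFn v).take i ++
      (v ⟨i, by omega⟩ :: v ⟨i + 1, hi⟩ :: (List.ofFn v).drop (i + 2)) := by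
  conv_lhs => rw [← List.take_append_drop i (List.ofFn v)]
  rw [List.drop_eq_getElem_cons (by simp; omega), List.drop_eq_getElem_cons (by simp; omega)]
  simp

theorem divMat_outer {i : ℕ} (hi : i + 1 < k) :
    (∀ c ∈ ((List.ofFn (tX R)).take i).map (divMat R k i hi), c ∈ lowerTri (OPol R k)) ∧
      ∀ c ∈ ((List.ofFn (tX R)).drop (i + 2)).map (divMat R k i hi), c ∈ lowerTri (OPol R k) := by
  constructor
  · intro c hc
    obtain ⟨f, hf, rfl⟩ := List.mem_map.1 hc
    obtain ⟨m, hm, rfl⟩ := List.mem_iff_getElem.1 hf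
    simp only [List.getElem_take, List.getElem_ofFn]
    simp only [List.length_take, List.length_ofFn] at hm
    exact divMat_tX_mem R hi _ (by simp; omega) (by simp; omega)
  · intro c hc
    obtain ⟨f, hf, rfl⟩ := List.mem_map.1 hc
    obtain ⟨m, hm, rfl⟩ := List.mem_iff_getElem.1 hf
    simp only [List.getElem_drop, List.getElem_ofFn]
    exact divMat_tX_mem R hi _ (by simp; omega) (by simp; omega)

theorem epsPol_mem (r : ℕ) : epsPol R k r ∈ OLam R k := by
  intro i hi
  rw [div_apply, epsPol, ofFn_split (tX R) hi]
  have hm := fun L => map_esymmList (divMat R k i hi).toRingHom L r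
  refine mem_lowerTri.1 ?_
  refine (congrArg (fun A => A ∈ lowerTri (OPol R k)) (hm _)).mpr ?_
  change esymmList (List.map (divMat R k i hi) _) r ∈ _
  rw [List.map_append, List.map_cons, List.map_cons]
  exact esymmList_append_mem _ _ _ (divMat_outer R hi).1 (esymmList_pair_mem _ _ _
    (divMat_pair R hi).1 (divMat_pair R hi).2.1 _ (divMat_outer R hi).2) r

theorem hPol_mem (r : ℕ) : hPol R k r ∈ OLam R k := by
  intro i hi
  rw [div_apply, hPol, hsymmTuple_eq, ofFn_split (tX R) hi]
  have hm := fun L => map_hsymmList (divMat R k i hi).toRingHom L r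
  refine mem_lowerTri.1 ?_
  refine (congrArg (fun A => A ∈ lowerTri (OPol R k)) (hm _)).mpr ?_
  change hsymmList (List.map (divMat R k i hi) _) r ∈ _
  rw [List.map_append, List.map_cons, List.map_cons]
  exact hsymmList_append_mem _ _ _ (divMat_outer R hi).1 (hsymmList_pair_mem _ _ _
    (divMat_pair R hi).1 (divMat_pair R hi).2.2 _ (divMat_outer R hi).2) r

variable (k)

/-- The odd elementary symmetric polynomial `ε_r` as an element of the ring of odd symmetric
polynomials. -/
def eps (r : ℕ) : OLam R k := ⟨epsPol R k r, epsPol_mem R r⟩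

/-- The odd complete symmetric polynomial `h_r` as an element of the ring of odd symmetric
polynomials. -/
def h (r : ℕ) : OLam R k := ⟨hPol R k r, hPol_mem R r⟩

end EH

/-! ### The coefficient superalgebra `A_n` -/

section An

variable (R : Type*) [CommRing R] (n : ℕ)

/-- The generators of `A_n`: `d`, and `chi j` for `χ_{j+1}`, where `0 ≤ j < ⌊n/2⌋`. -/
inductive AnGen (n : ℕ) : Type
  | d : AnGen n
  | chi (j : Fin (n / 2)) : AnGen n

variable {n} in
/-- The generator `d` is odd, the `χ_j` are even. -/
def AnGen.par : AnGen n → ZMod 2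
  | .d => 1
  | .chi _ => 0

/-- `χ_j` in the free algebra, with `χ_0 = 1`, and with `χ_j = 0` for `j > ⌊n/2⌋`. -/
def chiFree : ℕ → FreeAlgebra R (AnGen n)
  | 0 => 1
  | j + 1 => if hj : j < n / 2 then FreeAlgebra.ι R (.chi ⟨j, hj⟩) else 0

/-- The defining relations of `A_n`: the even generators commute with all generators (which is
supercommutativity, given the next relation), `d^2 = 0`, and `d χ_{n/2} = 0` if `n` is even. -/
inductive AnRel : FreeAlgebra R (AnGen n) → FreeAlgebra R (AnGen n) → Prop
  | chi_comm (j : Fin (n / 2)) (g : AnGen n) :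
      AnRel (FreeAlgebra.ι R (.chi j) * FreeAlgebra.ι R g)
        (FreeAlgebra.ι R g * FreeAlgebra.ι R (.chi j))
  | d_sq : AnRel (FreeAlgebra.ι R .d * FreeAlgebra.ι R .d) 0
  | d_top (hn : Even n) : AnRel (FreeAlgebra.ι R .d * chiFree R n (n / 2)) 0

/-- The superalgebra `A_n`. -/
def An : Type _ := RingQuot (AnRel R n)

instance : Ring (An R n) := inferInstanceAs (Ring (RingQuot (AnRel R n)))

instance : Algebra R (An R n) := inferInstanceAs (Algebra R (RingQuot (AnRel R n)))

/-- The quotient map from the free algebra. -/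
def An.mk : FreeAlgebra R (AnGen n) →ₐ[R] An R n := RingQuot.mkAlgHom R (AnRel R n)

variable {n}

/-- The generators of `A_n`. -/
def An.gen (g : AnGen n) : An R n := An.mk R n (FreeAlgebra.ι R g)

variable (n)

/-- The element `χ_j` of `A_n`, with `χ_0 = 1`. -/
def An.chi (j : ℕ) : An R n := An.mk R n (chiFree R n j)

/-- The element `c_i` of `A_n`: it is `χ_{i/2}` for even `i`, and `d χ_{(i-1)/2}` for odd `i`.
In particular `c_0 = 1`, and `c_i = 0` for `i > n`. -/
def An.c (i : ℕ) : An R n :=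
  if Even i then An.chi R n (i / 2) else An.gen R .d * An.chi R n ((i - 1) / 2)

variable {R n}

theorem An.rel {a b : FreeAlgebra R (AnGen n)} (hab : AnRel R n a b) :
    An.mk R n a = An.mk R n b := RingQuot.mkAlgHom_rel R hab

theorem An.hom_ext {B : Type*} [Ring B] [Algebra R B] {f g : An R n →ₐ[R] B}
    (hfg : ∀ x, f (An.gen R x) = g (An.gen R x)) : f = g := by
  apply RingQuot.ringQuot_ext' R f g
  apply FreeAlgebra.hom_ext
  funext x
  exact hfg x

theorem An.c_eq_zero {i : ℕ} (hi : n < i) : An.c R n i = 0 := by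
  have hchi : ∀ j, n / 2 < j → An.chi R n j = 0 := by
    intro j hj
    obtain ⟨m, rfl⟩ : ∃ m, j = m + 1 := ⟨j - 1, by omega⟩
    rw [An.chi, chiFree.eq_2, dif_neg (by omega), map_zero]
  rw [An.c]
  split_ifs with he
  · exact hchi _ (by obtain ⟨m, rfl⟩ := he; omega)
  · obtain ⟨m, rfl⟩ := Nat.not_even_iff_odd.1 he
    by_cases hm : n / 2 < (2 * m + 1 - 1) / 2
    · rw [hchi _ hm, mul_zero]
    · have hn : Even n := ⟨m, by omega⟩
      have := An.rel (AnRel.d_top (R := R) hn)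
      rw [map_mul, map_zero] at this
      have e : (2 * m + 1 - 1) / 2 = n / 2 := by omega
      rw [e]
      exact this

variable (R n)

variable {R n} in
theorem An.of_eq_of {i j : ZMod 2} (hij : i = j) {a b : An R n}
    (ha : a ∈ wordPart R (An.gen (n := n) R) AnGen.par i) (hb : b ∈ wordPart R (An.gen (n := n) R) AnGen.par j)
    (hab : a = b) :
    DirectSum.of (fun i => wordPart R (An.gen (n := n) R) AnGen.par i) i ⟨a, ha⟩ =
      DirectSum.of (fun i => wordPart R (An.gen (n := n) R) AnGen.par i) j ⟨b, hb⟩ := by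
  subst hij; subst hab; rfl

theorem An.lift_chiFree (j : ℕ) :
    ∃ hj : An.chi R n j ∈ wordPart R (An.gen (n := n) R) AnGen.par 0,
      FreeAlgebra.lift R (genOf (R := R) (An.gen (n := n) R) AnGen.par) (chiFree R n j) =
        DirectSum.of (fun i => wordPart R (An.gen (n := n) R) AnGen.par i) 0 ⟨An.chi R n j, hj⟩ := by
  cases j with
  | zero =>
    refine ⟨?_, ?_⟩
    · rw [An.chi, chiFree.eq_1, map_one]; exact SetLike.GradedOne.one_mem
    · refine (congrArg (FreeAlgebra.lift R _) (chiFree.eq_1 R n)).trans ?_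
      rw [map_one]
      exact An.of_eq_of rfl _ _ (by rw [An.chi, chiFree.eq_1, map_one])
  | succ j =>
    by_cases hj : j < n / 2
    · have e : An.chi R n (j + 1) = An.gen R (.chi ⟨j, hj⟩) := by
        rw [An.chi, chiFree.eq_2, dif_pos hj]; rfl
      refine ⟨?_, ?_⟩
      · rw [e]; exact gen_mem_wordPart (R := R) (An.gen (n := n) R) AnGen.par (.chi ⟨j, hj⟩)
      · rw [chiFree.eq_2, dif_pos hj, FreeAlgebra.lift_ι_apply]
        exact An.of_eq_of rfl _ _ e.symm
    · have e : An.chi R n (j + 1) = 0 := by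
        rw [An.chi, chiFree.eq_2, dif_neg hj, map_zero]
      refine ⟨by rw [e]; exact Submodule.zero_mem _, ?_⟩
      rw [chiFree.eq_2, dif_neg hj, map_zero]
      refine (map_zero (DirectSum.of (fun i => wordPart R (An.gen (n := n) R) AnGen.par i) 0)).symm.trans ?_
      exact congrArg _ (Subtype.ext e.symm)

/-- The decomposition of `A_n` into its parity parts. -/
def An.decompose : An R n →ₐ[R] ⨁ i, wordPart R (An.gen (n := n) R) AnGen.par i :=
  RingQuot.liftAlgHom R ⟨FreeAlgebra.lift R (genOf (R := R) (An.gen (n := n) R) AnGen.par), by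
    rintro _ _ (⟨j, g⟩ | _ | hn)
    · rw [map_mul, map_mul, FreeAlgebra.lift_ι_apply, FreeAlgebra.lift_ι_apply, genOf, genOf,
        DirectSum.of_mul_of, DirectSum.of_mul_of]
      refine An.of_eq_of (add_comm _ _) _ _ ?_
      have := An.rel (AnRel.chi_comm (R := R) j g)
      rwa [map_mul, map_mul] at this
    · rw [map_mul, map_zero, FreeAlgebra.lift_ι_apply, genOf, DirectSum.of_mul_of]
      refine (congrArg _ ?_).trans (map_zero (DirectSum.of _ (1 + 1)))
      have := An.rel (AnRel.d_sq (R := R) (n := n))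
      rw [map_mul, map_zero] at this
      exact Subtype.ext this
    · obtain ⟨hj, e⟩ := An.lift_chiFree R n (n / 2)
      rw [map_mul, map_zero, e, FreeAlgebra.lift_ι_apply, genOf]
      refine (DirectSum.of_mul_of (A := fun i => wordPart R (An.gen (n := n) R) AnGen.par i) _ _).trans ?_
      refine (congrArg _ ?_).trans (map_zero (DirectSum.of _ (1 + 0)))
      have := An.rel (AnRel.d_top (R := R) hn)
      rw [map_mul, map_zero] at this
      exact Subtype.ext this⟩

theorem An.decompose_gen (g : AnGen n) :
    An.decompose R n (An.gen R g) = genOf (An.gen (n := n) R) AnGen.par g :=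
  (RingQuot.liftAlgHom_mkAlgHom_apply R _ _ _).trans (FreeAlgebra.lift_ι_apply _ g)

/-- The parity grading of `A_n`. -/
def An.parity : ZMod 2 → Submodule R (An R n) := wordPart R (An.gen (n := n) R) AnGen.par

instance An.gradedMonoid : SetLike.GradedMonoid (An.parity R n) :=
  wordPart.gradedMonoid _ _

/-- `A_n` is a superalgebra. -/
instance An.gradedAlgebra : GradedAlgebra (An.parity R n) :=
  gradedOfLift (An.gen (n := n) R) AnGen.par (An.decompose R n) (An.decompose_gen R n)
    (fun _ _ hf => An.hom_ext hf)

end An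

/-! ### The superalgebras `M_k^n` -/

section M

variable (R : Type*) [CommRing R] (n k : ℕ)

/-- The super tensor product `OΛ_k ⊗ A_n`, with multiplication
`(a₁ ⊗ b₁)(a₂ ⊗ b₂) = (-1)^{|b₁||a₂|} a₁a₂ ⊗ b₁b₂`. -/
abbrev OLamAn : Type _ := OLam.parity R k ᵍ⊗[R] An.parity R n

/-- The part of parity `i` of `OΛ_k ⊗ A_n`. -/
def OLamAn.parity (i : ZMod 2) : Submodule R (OLamAn R n k) :=
  Submodule.span R {z | ∃ (a b : ZMod 2) (f : OLam R k) (y : An R n),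
    a + b = i ∧ f ∈ OLam.parity R k a ∧ y ∈ An.parity R n b ∧
      z = GradedTensorProduct.tmul R f y}

/-- The element `h'_m = ∑_{r=0}^m (-1)^r h_{m-r} ⊗ c_r` of `OΛ_k ⊗ A_n`. -/
def hPrime (m : ℕ) : OLamAn R n k :=
  ∑ r ∈ Finset.range (m + 1),
    (-1) ^ r * GradedTensorProduct.tmul R (h R k (m - r)) (An.c R n r)

/-- The relations `h'_m = 0` for `n - k + 1 ≤ m ≤ n`. -/
inductive MRel : OLamAn R n k → OLamAn R n k → Prop
  | hPrime (m : ℕ) (h1 : n - k + 1 ≤ m) (h2 : m ≤ n) : MRel (hPrime R n k m) 0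

/-- `M_k^n`, the quotient of `OΛ_k ⊗ A_n` by the two-sided ideal generated by the `h'_m` with
`n - k + 1 ≤ m ≤ n`. -/
def M : Type _ := RingQuot (MRel R n k)

instance : Ring (M R n k) := inferInstanceAs (Ring (RingQuot (MRel R n k)))

instance : Algebra R (M R n k) := inferInstanceAs (Algebra R (RingQuot (MRel R n k)))

/-- The quotient map `OΛ_k ⊗ A_n → M_k^n`. -/
def M.mk : OLamAn R n k →ₐ[R] M R n k := RingQuot.mkAlgHom R (MRel R n k)

/-- The structure map `A_n → M_k^n`, `a ↦ 1 ⊗ a`, of the `A_n`-superalgebra `M_k^n`. -/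
def M.ofAn : An R n →ₐ[R] M R n k :=
  (M.mk R n k).comp (GradedTensorProduct.includeRight (OLam.parity R k) (An.parity R n))

/-- The part of parity `i` of `M_k^n`. -/
def M.parity (i : ZMod 2) : Submodule R (M R n k) :=
  (OLamAn.parity R n k i).map (M.mk R n k).toLinearMap

end M

end OddGr

end

/-! The relations are statements about generating series in a central variable `t`. Put `E = ∑
(-1)^(r(r+1)/2) ε_r t^r`, `H = ∑ h_r t^r`, `S = ∑ (-1)^r c_r t^r` and `H' = ∑ h'_r t^r`. With these
signs `E H = 1`, hence `H' = H S` and `E H' = S`. Since `c_{2j} = χ_j` and `c_{2j+1} = d χ_j`, the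
series `S` equals `(1 - d t) V` with `V = ∑ χ_j t^(2j)`, an even series that commutes with `H` and
with `d`. In `M_k^n` the series `E` has degree at most `k` and `S` has degree at most `n`, so the
`k` relations force `H'` to have degree at most `n - k` (`M.mk_hPrime_top`). Thus `M_k^n` describes
factorizations `S = E H'` with factors of degrees `k` and `n - k`, and `γ` exchanges the two
factors, up to the substitution `t ↦ s t` with `s = (-1)^k` and a correction by `1 - d t`, which
does not commute with the other series.

Maps out of `M_k^n` require a presentation of `OΛ_k`: it is generated by the `ε_r` subject to the
relations `OddSeq`, `ε_0 = 1` and `ε_r = 0` for `r < 0` or `r > k` (`Pres.toOLam_bijective`). The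
relations straighten every word into increasing words. A lexicographic leading term argument shows
that the words span `OΛ_k` and that the increasing ones are linearly independent. Consequently
(`M.exists_lift`) an `A_n`-algebra map from `M_k^n` amounts to a factorization `W P = S` with `deg W
≤ k`, `deg P ≤ n - k`, and `W` satisfying `OddSeq` and the right commutation rules with `A_n`.

For `γ` take `W = S(t) H(s t)` and `P = E(s t)` over `M_{n-k}^n`. For its inverse take `W = H'(s t)`
and `P = (1 + s d t) E(s t) (1 - d t)` over `M_k^n`. The relations `OddSeq` hold because they
survive multiplication by `1 + z t` with `z` odd and supercommuting (`OddSeq.add_mul_shift`), by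
even central series (`OddSeq.sum_even_shift`), and suitable sign twists. The degree bounds hold
because the sign `s = (-1)^k` makes the terms with `d` cancel in degree `k + 1`. The two maps are
inverse to each other on the `ε_r` in one order and on the `h'_r` in the other. The latter suffices
since `E` is determined by `S` and the invertible series `H'` (`M.hom_ext_hPrime`), which also gives
uniqueness. -/

open scoped TensorProduct DirectSum

noncomputable section

namespace OddGr

/-! ### Sequences satisfying the relations of odd symmetric functions -/

section OddSeq

variable {B : Type*} [Ring B]

/-- The defining relations between the odd elementary symmetric functions. -/
structure OddSeq (u : ℤ → B) : Prop where
  comm : ∀ a b, Even (a + b) → u a * u b = u b * u a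
  even : ∀ a b, Even a → Even b →
    u a * u (b + 1) + u (b + 1) * u a = u b * u (a + 1) + u (a + 1) * u b
  odd : ∀ a b, Odd a → Odd b →
    u a * u (b + 1) - u (b + 1) * u a = u b * u (a + 1) - u (a + 1) * u b

/-- The element `z` supercommutes with the members of `u`, where `z` is odd and `u r` has the
parity of `r`. -/
def OddCommute (z : B) (u : ℤ → B) : Prop :=
  ∀ r, z * u r = (Int.negOnePow r : ℤ) • (u r * z)

theorem OddCommute.even {z : B} {u : ℤ → B} (hz : OddCommute z u) {r : ℤ} (hr : Even r) :
    z * u r = u r * z := by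
  simpa [Int.negOnePow_even r hr] using hz r

theorem OddCommute.odd {z : B} {u : ℤ → B} (hz : OddCommute z u) {r : ℤ} (hr : Odd r) :
    z * u r = -(u r * z) := by
  simpa [Int.negOnePow_odd r hr] using hz r

/-- In terms of series this is multiplication by `1 + z t`. After all `z` are moved to the left, the
parts of degree 0 and 2 in `z` are relations for `(a, b)` and `(a - 1, b - 1)`. In the linear part
the types are exchanged: a commutation relation needs a mixed relation for `(a - 1, b - 1)`, and a
mixed relation needs commutations for `(a - 1, b + 1)` and `(b - 1, a + 1)`. -/
theorem OddSeq.add_mul_shift {u : ℤ → B} (hu : OddSeq u) {z : B} (hz : OddCommute z u) :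
    OddSeq fun r => u r + z * u (r - 1) := by
  have me : ∀ {r : ℤ}, Even r → ∀ x, u r * (z * x) = z * (u r * x) := fun hr x => by
    rw [← mul_assoc, ← mul_assoc, hz.even hr]
  have mo : ∀ {r : ℤ}, Odd r → ∀ x, u r * (z * x) = -(z * (u r * x)) := fun hr x => by
    rw [← mul_assoc, ← mul_assoc, hz.odd hr, neg_mul, neg_neg]
  constructor
  · intro a b hab
    rcases Int.even_or_odd a with ha | ha
    · have hb : Even b := by
        rw [Int.even_add] at hab; exact hab.1 ha
      have ha' : Odd (a - 1) := ha.sub_odd odd_one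
      have hb' : Odd (b - 1) := hb.sub_odd odd_one
      have h1 := hu.odd (a - 1) (b - 1) ha' hb'
      rw [sub_add_cancel, sub_add_cancel] at h1
      simp only [mul_add, add_mul, mul_assoc, me ha, me hb, mo ha', mo hb']
      linear_combination (norm := noncomm_ring) z * h1 + hu.comm a b hab
        - z * z * hu.comm (a - 1) (b - 1) (ha'.add_odd hb')
    · have hb : Odd b := by
        rw [Int.even_add'] at hab; exact hab.1 ha
      have ha' : Even (a - 1) := ha.sub_odd odd_one
      have hb' : Even (b - 1) := hb.sub_odd odd_one
      have h1 := hu.even (a - 1) (b - 1) ha' hb'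
      rw [sub_add_cancel, sub_add_cancel] at h1
      simp only [mul_add, add_mul, mul_assoc, mo ha, mo hb, me ha', me hb']
      linear_combination (norm := noncomm_ring) z * h1 + hu.comm a b hab
        + z * z * hu.comm (a - 1) (b - 1) (ha'.add hb')
  · intro a b ha hb
    have ha' : Odd (a - 1) := ha.sub_odd odd_one
    have hb' : Odd (b - 1) := hb.sub_odd odd_one
    have h1 := hu.odd (a - 1) (b - 1) ha' hb'
    have h2 := hu.comm (a - 1) (b + 1) (ha'.add_odd hb.add_one)
    have h3 := hu.comm (b - 1) (a + 1) (hb'.add_odd ha.add_one)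
    rw [sub_add_cancel, sub_add_cancel] at h1
    simp only [mul_add, add_mul, mul_assoc, me ha, me hb, mo ha', mo hb', mo ha.add_one,
      mo hb.add_one, add_sub_cancel_right]
    linear_combination (norm := noncomm_ring) hu.even a b ha hb - z * z * h1 + z * h2 - z * h3
  · intro a b ha hb
    have ha' : Even (a - 1) := ha.sub_odd odd_one
    have hb' : Even (b - 1) := hb.sub_odd odd_one
    have h1 := hu.even (a - 1) (b - 1) ha' hb'
    have h2 := hu.comm (a - 1) (b + 1) (ha'.add hb.add_one)
    have h3 := hu.comm (b - 1) (a + 1) (hb'.add ha.add_one)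
    rw [sub_add_cancel, sub_add_cancel] at h1
    simp only [mul_add, add_mul, mul_assoc, mo ha, mo hb, me ha', me hb', me ha.add_one,
      me hb.add_one, add_sub_cancel_right]
    linear_combination (norm := noncomm_ring) hu.odd a b ha hb + z * z * h1 + z * h2 - z * h3

/-- Twisting by signs. -/
theorem OddSeq.smul {u : ℤ → B} (hu : OddSeq u) (t : ℤ → ℤ)
    (ht : ∀ a b, Even (a + b) → u a = 0 ∨ u b = 0 ∨ t a * t (b + 1) = t b * t (a + 1)) :
    OddSeq fun r => t r • u r := by
  have e : ∀ a b, (t a • u a) * (t b • u b) = (t a * t b) • (u a * u b) := fun a b => by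
    rw [smul_mul_smul_comm]
  constructor
  · intro a b hab
    rw [e, e, hu.comm a b hab, mul_comm]
  · intro a b ha hb
    have h := hu.even a b ha hb
    rw [e, e, e, e, mul_comm (t (b + 1)), mul_comm (t (a + 1)), ← smul_add, ← smul_add]
    -- If `u a` or `u b` vanishes, one side of the relation is zero, hence so is the other, and the
    -- scalars are irrelevant.
    rcases ht a b (ha.add hb) with h0 | h0 | h0
    · rw [← h, h0]; simp
    · rw [h, h0]; simp
    · rw [h, h0]
  · intro a b ha hb
    have h := hu.odd a b ha hb
    rw [e, e, e, e, mul_comm (t (b + 1)), mul_comm (t (a + 1)), ← smul_sub, ← smul_sub]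
    rcases ht a b (ha.add_odd hb) with h0 | h0 | h0
    · rw [← h, h0]; simp
    · rw [h, h0]; simp
    · rw [h, h0]

/-- Multiplication of the generating series by a central even series. -/
theorem OddSeq.sum_even_shift {u : ℤ → B} (hu : OddSeq u) (N : ℕ) (c : ℕ → B)
    (hc : ∀ i j, Commute (c i) (c j)) (hcu : ∀ i r, Commute (c i) (u r)) :
    OddSeq fun r => ∑ j ∈ Finset.range N, c j * u (r - 2 * j) := by
  have e : ∀ a b : ℤ, (∑ j ∈ Finset.range N, c j * u (a - 2 * j)) *
      (∑ j ∈ Finset.range N, c j * u (b - 2 * j)) =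
      ∑ i ∈ Finset.range N, ∑ j ∈ Finset.range N,
        c i * c j * (u (a - 2 * i) * u (b - 2 * j)) := by
    intro a b
    rw [Finset.sum_mul_sum]
    refine Finset.sum_congr rfl fun i _ => Finset.sum_congr rfl fun j _ => ?_
    rw [mul_assoc, ← mul_assoc (u _), ← (hcu j _).eq]
    simp only [mul_assoc]
  -- The same double sum with `i` and `j` exchanged. Using `e` for one product and `e'` for the
  -- other makes each relation hold term by term.
  have e' : ∀ a b : ℤ, (∑ j ∈ Finset.range N, c j * u (a - 2 * j)) *
      (∑ j ∈ Finset.range N, c j * u (b - 2 * j)) =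
      ∑ i ∈ Finset.range N, ∑ j ∈ Finset.range N,
        c i * c j * (u (a - 2 * j) * u (b - 2 * i)) := by
    intro a b
    rw [e, Finset.sum_comm]
    refine Finset.sum_congr rfl fun i _ => Finset.sum_congr rfl fun j _ => ?_
    rw [(hc j i).eq]
  have pe : ∀ {a : ℤ} (i : ℕ), Even a → Even (a - 2 * i) := fun i ha =>
    ha.sub (even_two_mul _)
  have po : ∀ {a : ℤ} (i : ℕ), Odd a → Odd (a - 2 * i) := fun i ha =>
    ha.sub_even (even_two_mul _)
  constructor
  · intro a b hab
    rw [e, e']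
    refine Finset.sum_congr rfl fun i _ => Finset.sum_congr rfl fun j _ => ?_
    rw [hu.comm]
    have : a - 2 * i + (b - 2 * j) = a + b - 2 * (i + j : ℕ) := by push_cast; ring
    rw [this]
    exact pe _ hab
  · intro a b ha hb
    rw [e, e' (b + 1), e' b, e (a + 1), ← Finset.sum_add_distrib, ← Finset.sum_add_distrib]
    refine Finset.sum_congr rfl fun i _ => ?_
    rw [← Finset.sum_add_distrib, ← Finset.sum_add_distrib]
    refine Finset.sum_congr rfl fun j _ => ?_
    have := hu.even _ _ (pe i ha) (pe j hb)
    rw [← mul_add, ← mul_add, add_sub_right_comm, add_sub_right_comm, this]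
  · intro a b ha hb
    rw [e, e' (b + 1), e' b, e (a + 1), ← Finset.sum_sub_distrib, ← Finset.sum_sub_distrib]
    refine Finset.sum_congr rfl fun i _ => ?_
    rw [← Finset.sum_sub_distrib, ← Finset.sum_sub_distrib]
    refine Finset.sum_congr rfl fun j _ => ?_
    have := hu.odd _ _ (po i ha) (po j hb)
    rw [← mul_sub, ← mul_sub, add_sub_right_comm, add_sub_right_comm, this]

theorem OddSeq.map {C : Type*} [Ring C] {u : ℤ → B} (hu : OddSeq u) (f : B →+* C) :
    OddSeq fun r => f (u r) where
  comm a b hab := by simpa using congrArg f (hu.comm a b hab)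
  even a b ha hb := by simpa using congrArg f (hu.even a b ha hb)
  odd a b ha hb := by simpa using congrArg f (hu.odd a b ha hb)

/-- Extension of a sequence by zero to negative indices. -/
def zext (u : ℕ → B) (r : ℤ) : B := if 0 ≤ r then u r.toNat else 0

@[simp]

theorem zext_natCast (u : ℕ → B) (r : ℕ) : zext u r = u r := by simp [zext]

theorem zext_of_neg (u : ℕ → B) {r : ℤ} (hr : r < 0) : zext u r = 0 := if_neg (by omega)

theorem zext_ext {u : ℕ → B} {v : ℤ → B} (h : ∀ r : ℕ, u r = v r) (h' : ∀ r < 0, v r = 0) :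
    zext u = v := by
  funext r
  rcases lt_or_ge r 0 with hr | hr
  · rw [zext_of_neg u hr, h' r hr]
  · lift r to ℕ using hr
    rw [zext_natCast, h]

theorem zext_map {C : Type*} [Ring C] (f : B →+* C) (u : ℕ → B) :
    zext (fun r => f (u r)) = fun r => f (zext u r) :=
  zext_ext (by simp) fun r hr => by rw [zext_of_neg u hr, map_zero]

theorem zext_add_mul_shift {u u' : ℕ → B} {z : B} (h0 : u' 0 = u 0)
    (hs : ∀ r, u' (r + 1) = u (r + 1) + z * u r) :
    zext u' = fun r => zext u r + z * zext u (r - 1) := by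
  refine zext_ext ?_ fun r hr => by
    rw [zext_of_neg u hr, zext_of_neg u (by omega), mul_zero, add_zero]
  rintro (_ | r)
  · have h1 := zext_natCast u 0
    have h2 := zext_of_neg u (show (0 : ℤ) - 1 < 0 by omega)
    rw [Nat.cast_zero] at *
    rw [h0, h1, h2, mul_zero, add_zero]
  · simp only [hs]
    push_cast
    rw [add_sub_cancel_right, zext_natCast, ← Nat.cast_succ, zext_natCast]

theorem OddCommute.zext {z : B} {u : ℕ → B} (h : ∀ r : ℕ, z * u r = (-1) ^ r * (u r * z)) :
    OddCommute z (zext u) := by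
  intro r
  rcases lt_or_ge r 0 with hr | hr
  · simp [zext_of_neg u hr]
  · lift r to ℕ using hr
    rw [zext_natCast, h]
    rcases Nat.even_or_odd r with hr | hr <;> simp [hr.neg_one_pow]

/-- The constant series `1`, which belongs to the empty list of variables: its coefficients are
central, and an index `b + 1` with `b` even is never `0`. -/
theorem OddSeq.single : OddSeq (zext fun r => if r = 0 then (1 : B) else 0) := by
  have : ∀ r, ∀ x : B, Commute (zext (fun r => if r = 0 then (1 : B) else 0) r) x := by
    intro r x
    rw [zext]
    split_ifs <;> simp
  have h0 : ∀ r : ℤ, r ≠ 0 → zext (fun r => if r = 0 then (1 : B) else 0) r = 0 := by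
    intro r hr
    rcases lt_or_ge r 0 with hr' | hr'
    · exact zext_of_neg _ hr'
    · lift r to ℕ using hr'
      rw [zext_natCast, if_neg (by simpa using hr)]
  have z1 : ∀ r : ℤ, Even r → zext (fun r => if r = 0 then (1 : B) else 0) (r + 1) = 0 :=
    fun r hr => h0 _ (by obtain ⟨m, rfl⟩ := hr; omega)
  exact ⟨fun a b _ => (this _ _).eq, fun a b ha hb => by rw [z1 a ha, z1 b hb]; simp,
    fun a b _ _ => by rw [(this _ _).eq, sub_self, (this _ _).eq, sub_self]⟩

/-- The sign `(-1)^{r(r+1)/2}`. -/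
def sgn (r : ℕ) : ℤ := (-1) ^ (r + 1).choose 2

theorem sgn_succ (r : ℕ) : sgn (r + 1) = (-1) ^ (r + 1) * sgn r := by
  rw [sgn, sgn, ← pow_add, Nat.choose_succ_succ' (r + 1) 1, Nat.choose_one_right]

theorem sgn_mul_self (r : ℕ) : sgn r * sgn r = 1 := by
  rw [sgn, ← mul_pow]; simp

@[simp] theorem sgn_zero : sgn 0 = 1 := by simp [sgn]

/-- The condition on `t` says that the two sides of a mixed relation scale by the same factor. At
negative indices, where `toNat` gives a wrong scalar, the sequence is zero. -/
theorem OddSeq.zext_smul {u : ℕ → B} (hu : OddSeq (zext u)) (t : ℕ → ℤ)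
    (ht : ∀ a b, Even (a + b) → t a * t (b + 1) = t b * t (a + 1)) :
    OddSeq (zext fun r => t r • u r) := by
  have e : zext (fun r => t r • u r) = fun r => t r.toNat • zext u r :=
    zext_ext (fun r => by simp) fun r hr => by rw [zext_of_neg u hr, smul_zero]
  rw [e]
  refine hu.smul _ fun a b hab => ?_
  rcases lt_or_ge a 0 with ha | ha
  · exact Or.inl (zext_of_neg u ha)
  rcases lt_or_ge b 0 with hb | hb
  · exact Or.inr (Or.inl (zext_of_neg u hb))
  lift a to ℕ using ha
  lift b to ℕ using hb
  exact Or.inr (Or.inr (ht a b (by exact_mod_cast hab)))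

theorem neg_one_pow_eq_of_even_add {a b : ℕ} (hab : Even (a + b)) :
    (-1 : ℤ) ^ a = (-1) ^ b := by
  rw [Nat.even_add] at hab
  rcases Nat.even_or_odd a with ha | ha
  · rw [ha.neg_one_pow, (hab.1 ha).neg_one_pow]
  · have hb : Odd b := by
      rw [← Nat.not_even_iff_odd] at *
      exact fun h => ha (hab.2 h)
    rw [ha.neg_one_pow, hb.neg_one_pow]

/-- By `sgn_succ` the scaling condition reduces to `(-1)^a = (-1)^b`. -/
theorem OddSeq.zext_sgn_smul {u : ℕ → B} (hu : OddSeq (zext u)) :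
    OddSeq (zext fun r => sgn r • u r) :=
  hu.zext_smul sgn fun a b hab => by
    rw [sgn_succ, sgn_succ, pow_succ, pow_succ, neg_one_pow_eq_of_even_add hab]; ring

theorem OddSeq.zext_pow_smul {u : ℕ → B} (hu : OddSeq (zext u)) (s : ℤ) :
    OddSeq (zext fun r => s ^ r • u r) :=
  hu.zext_smul _ fun a b _ => by ring

/-- Adding a new variable `z` on the left. -/
theorem OddSeq.zext_cons {u u' : ℕ → B} (hu : OddSeq (zext u)) {z : B}
    (hz : ∀ r : ℕ, z * u r = (-1) ^ r * (u r * z)) (h0 : u' 0 = u 0)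
    (hs : ∀ r, u' (r + 1) = u (r + 1) + z * u r) : OddSeq (zext u') := by
  rw [zext_add_mul_shift h0 hs]
  exact hu.add_mul_shift (OddCommute.zext hz)

/-- The variant of `OddSeq.zext_cons` with an alternating sign. -/
theorem OddSeq.zext_cons' {u u' : ℕ → B} (hu : OddSeq (zext u)) {z : B}
    (hz : ∀ r : ℕ, z * u r = (-1) ^ r * (u r * z)) (h0 : u' 0 = u 0)
    (hs : ∀ r, u' (r + 1) = u (r + 1) + (-1) ^ (r + 1) * (z * u r)) : OddSeq (zext u') := by
  -- As `(-1)^(r+1) sgn (r+1) = sgn r`, twisting by `sgn` removes the alternating sign and leads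
  -- back to `OddSeq.zext_cons`. A second twist undoes the first.
  have key : OddSeq (zext fun r => sgn r • u' r) := by
    refine (hu.zext_sgn_smul).zext_cons (z := z) (fun r => ?_) ?_ fun r => ?_
    · rw [mul_smul_comm, hz, smul_mul_assoc, mul_smul_comm]
    · rw [h0]
    · rw [hs, smul_add, mul_smul_comm, sgn_succ]
      have : ((-1 : B) ^ (r + 1)) * (z * u r) = ((-1 : ℤ) ^ (r + 1)) • (z * u r) := by
        rw [zsmul_eq_mul]; push_cast; rfl
      rw [this, smul_smul, mul_right_comm, ← mul_pow]
      simp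
  have := key.zext_sgn_smul
  simpa only [smul_smul, sgn_mul_self, one_smul] using this

end OddSeq

/-! ### Elementary and complete polynomials in anticommuting variables -/

section Lists

variable {B : Type*} [Ring B]

/-- The list consists of pairwise anticommuting elements. -/
def Anti (L : List B) : Prop := L.Pairwise fun a b => a * b = -(b * a)

theorem mul_esymmList {a : B} {L : List B} (h : ∀ b ∈ L, a * b = -(b * a)) (r : ℕ) :
    a * esymmList L r = (-1) ^ r * (esymmList L r * a) := by
  induction L generalizing r with
  | nil => cases r <;> simp [esymmList]
  | cons b L ih =>
    have ih' := ih fun c hc => h c (List.mem_cons_of_mem _ hc)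
    cases r with
    | zero => simp [esymmList_zero]
    | succ r =>
      rw [esymmList_cons, mul_add, ih', ← mul_assoc a b, h b List.mem_cons_self, neg_mul,
        mul_assoc b a, ih', add_mul, mul_add, pow_succ]
      rcases Nat.even_or_odd r with hr | hr <;> simp [hr.neg_one_pow, mul_assoc]

theorem hsymmList_zero (L : List B) : hsymmList L 0 = 1 := by
  induction L with
  | nil => simp [hsymmList]
  | cons a L ih => simp [hsymmList, ih]

theorem hsymmList_cons_succ (a : B) (L : List B) (r : ℕ) :
    hsymmList (a :: L) (r + 1) = hsymmList L (r + 1) + a * hsymmList (a :: L) r := by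
  rw [hsymmList, hsymmList, Finset.Nat.antidiagonal_succ, Finset.sum_cons, Finset.sum_map,
    Finset.mul_sum]
  simp [pow_succ', mul_assoc]

theorem mul_hsymmList {a : B} {L : List B} (h : ∀ b ∈ L, a * b = -(b * a)) (r : ℕ) :
    a * hsymmList L r = (-1) ^ r * (hsymmList L r * a) := by
  induction L generalizing r with
  | nil => by_cases hr : r = 0 <;> simp [hsymmList, hr]
  | cons b L ih =>
    have ih' := ih fun c hc => h c (List.mem_cons_of_mem _ hc)
    induction r with
    | zero => simp [hsymmList_zero]
    | succ r ihr =>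
      rw [hsymmList_cons_succ, mul_add, ih', ← mul_assoc a b, h b List.mem_cons_self, neg_mul,
        mul_assoc b a, ihr, add_mul, mul_add, pow_succ]
      rcases Nat.even_or_odd r with hr | hr <;> simp [hr.neg_one_pow, mul_assoc]

theorem oddSeq_esymmList {L : List B} (hL : Anti L) : OddSeq (zext (esymmList L)) := by
  induction L with
  | nil =>
    have : esymmList ([] : List B) = fun r => if r = 0 then 1 else 0 := by
      funext r; cases r <;> simp [esymmList]
    rw [this]
    exact OddSeq.single
  | cons a L ih =>
    rw [Anti, List.pairwise_cons] at hL
    exact (ih hL.2).zext_cons (mul_esymmList hL.1) (by simp [esymmList_zero]) (esymmList_cons a L)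

/-- The sequence `u' r = ∑_j z^{2j} (u (r - 2j) + z u (r - 2j - 1))`, given by its recursion. -/
theorem OddSeq.zext_geom {u u' : ℕ → B} (hu : OddSeq (zext u)) {z : B}
    (hz : ∀ r : ℕ, z * u r = (-1) ^ r * (u r * z)) (h0 : u' 0 = u 0)
    (hs : ∀ r, u' (r + 1) = u (r + 1) + z * u' r) : OddSeq (zext u') := by
  -- The recursion says that the series is multiplied by `(1 - z t)⁻¹ = (∑ z^(2j) t^(2j)) (1 + z
  -- t)`. The factor `1 + z t` produces `v`, and the other factor is even with coefficients that
  -- commute with `v`.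
  have hv := hu.add_mul_shift (OddCommute.zext hz)
  set v : ℤ → B := fun r => zext u r + z * zext u (r - 1) with hvdef
  have hz1 : ∀ r, z * z * zext u r = zext u r * (z * z) := fun r => by
    have := OddCommute.zext hz r
    rw [mul_assoc, this, mul_smul_comm, ← mul_assoc, this, smul_mul_assoc, smul_smul, mul_assoc]
    rcases Int.even_or_odd r with hr | hr <;>
      simp [Int.negOnePow_even, Int.negOnePow_odd, hr]
  have hzv : ∀ r, Commute (z * z) (v r) := fun r => by
    rw [hvdef]
    exact Commute.add_right (hz1 r) ((((Commute.refl z).mul_right (Commute.refl z)).symm).mul_right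
      (hz1 _))
  have hv2 : ∀ r : ℤ, zext u' r = v r + z * z * zext u' (r - 2) := by
    have h1 : ∀ r : ℤ, zext u' r = zext u r + z * zext u' (r - 1) := by
      intro r
      rcases lt_or_ge r 0 with hr | hr
      · rw [zext_of_neg _ hr, zext_of_neg _ hr, zext_of_neg _ (by omega)]; simp
      · lift r to ℕ using hr
        rcases r with _ | r
        · rw [zext_natCast, h0, zext_natCast, zext_of_neg _ (by simp)]; simp
        · rw [zext_natCast, hs]; push_cast
          rw [add_sub_cancel_right, ← Nat.cast_succ, zext_natCast, zext_natCast]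
    intro r
    rw [hvdef, h1 r, h1 (r - 1), mul_add, mul_assoc, ← add_assoc]
    congr 4
    ring_nf
  -- Below degree `2 N` the geometric series may be cut off after `N` terms. A single relation
  -- involves only finitely many indices, so finite sums suffice.
  have hN : ∀ (N : ℕ) (r : ℤ), r < 2 * N →
      ∑ j ∈ Finset.range N, (z * z) ^ j * v (r - 2 * j) = zext u' r := by
    intro N
    induction N with
    | zero => intro r hr; rw [zext_of_neg _ (by simpa using hr)]; simp
    | succ N ih =>
      intro r hr
      rw [hv2, ← ih (r - 2) (by push_cast at hr; omega), Finset.sum_range_succ', Finset.mul_sum,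
        add_comm]
      congr 1
      · simp
      · refine Finset.sum_congr rfl fun j _ => ?_
        rw [pow_succ', mul_assoc]
        congr 3
        push_cast
        ring
  have key := fun N => hv.sum_even_shift N (fun j => (z * z) ^ j)
    (fun i j => Commute.pow_pow_self _ _ _) (fun i r => (hzv r).pow_left _)
  constructor
  · intro a b hab
    have := (key (a.natAbs + b.natAbs + 2)).comm a b hab

    rwa [hN _ _ (by omega), hN _ _ (by omega)] at this
  · intro a b ha hb
    have := (key (a.natAbs + b.natAbs + 2)).even a b ha hb

    rwa [hN _ _ (by omega), hN _ _ (by omega),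
      hN _ _ (by omega), hN _ _ (by omega)] at this
  · intro a b ha hb
    have := (key (a.natAbs + b.natAbs + 2)).odd a b ha hb

    rwa [hN _ _ (by omega), hN _ _ (by omega),
      hN _ _ (by omega), hN _ _ (by omega)] at this

theorem oddSeq_hsymmList {L : List B} (hL : Anti L) : OddSeq (zext (hsymmList L)) := by
  induction L with
  | nil => exact OddSeq.single
  | cons a L ih =>
    rw [Anti, List.pairwise_cons] at hL
    exact (ih hL.2).zext_geom (mul_hsymmList hL.1) (by simp [hsymmList_zero])
      (hsymmList_cons_succ a L)

open PowerSeries in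
/-- The signed generating series of the elementary symmetric polynomials is inverse to that of the
complete ones. -/
theorem esymmList_mul_hsymmList {L : List B} (hL : Anti L) :
    (mk fun r => sgn r • esymmList L r) * mk (hsymmList L) = 1 := by
  induction L with
  | nil =>
    have h1 : (mk fun r => sgn r • esymmList ([] : List B) r) = 1 := by
      ext r; cases r <;> simp [esymmList, coeff_one]
    have h2 : mk (hsymmList ([] : List B)) = 1 := by
      ext r; simp [hsymmList, coeff_one]
    rw [h1, h2, one_mul]
  | cons a L ih =>
    rw [Anti, List.pairwise_cons] at hL
    -- The new variable `a` multiplies `e_r` from the left, and `a e_r = (-1)^r e_r a` with the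
    -- signs `sgn` moves it to the right. So `1 - a t` stands between the two series and cancels
    -- against its inverse in the series of the `h_r`.
    have h1 : (mk fun r => sgn r • esymmList (a :: L) r) =
        (mk fun r => sgn r • esymmList L r) * (1 - C a * PowerSeries.X) := by
      ext r
      rw [mul_sub, mul_one, ← mul_assoc, map_sub]
      rcases r with _ | r
      · simp [esymmList_zero]
      · rw [coeff_succ_mul_X, coeff_mul_C, coeff_mk, coeff_mk, coeff_mk, esymmList_cons, smul_add,
          mul_esymmList hL.1, sgn_succ, sub_eq_add_neg, smul_mul_assoc, mul_smul, mul_smul]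
        rcases Nat.even_or_odd r with hr | hr <;> simp [pow_succ, hr.neg_one_pow]
    have h2 : (1 - C a * PowerSeries.X) * mk (hsymmList (a :: L)) = mk (hsymmList L) := by
      ext r
      rw [sub_mul, one_mul, mul_assoc, map_sub, coeff_C_mul]
      rcases r with _ | r
      · simp [hsymmList_zero]
      · rw [coeff_succ_X_mul, coeff_mk, coeff_mk, coeff_mk, hsymmList_cons_succ,
          add_sub_cancel_right]
    rw [h1, mul_assoc, h2, ih hL.2]

end Lists

/-! ### The monomial basis of skew polynomials -/

section Monomials

/-- Only the powers `v j ^ a j` with `j < i` are passed by `v i`, and each contributes `a j` signs.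
-/
theorem anti_mul_prod_pow {B : Type*} [Ring B] : ∀ {k : ℕ} (v : Fin k → B)
    (_ : ∀ i j, i ≠ j → v i * v j = -(v j * v i)) (i : Fin k) (a : Fin k → ℕ),
    v i * (List.ofFn fun j => v j ^ a j).prod =
      (-1) ^ (∑ j, if j < i then a j else 0) *
        (List.ofFn fun j => v j ^ (a + Pi.single i 1 : Fin _ → ℕ) j).prod
  | 0, _, _, i, _ => i.elim0
  | k + 1, v, hv, i, a => by
    rw [List.ofFn_succ, List.ofFn_succ, List.prod_cons, List.prod_cons, Fin.sum_univ_succ]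
    induction i using Fin.cases with
    | zero =>
      simp [pow_succ', mul_assoc]
    | succ i =>
      have ih := anti_mul_prod_pow (fun j => v j.succ)
        (fun i j h => hv _ _ fun e => h (Fin.succ_injective _ e)) i (fun j => a j.succ)
      have h1 : ∀ m : ℕ, v i.succ * v 0 ^ m = (-1) ^ m * (v 0 ^ m * v i.succ) := by
        intro m
        induction m with
        | zero => simp
        | succ m ihm =>
          rw [pow_succ', ← mul_assoc, hv _ _ (Fin.succ_ne_zero i), neg_mul, mul_assoc, ihm,
            pow_succ]
          rcases Nat.even_or_odd m with hm | hm <;> simp [hm.neg_one_pow, mul_assoc]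
      have h2 : (Pi.single i.succ 1 : Fin (k + 1) → ℕ) 0 = 0 :=
        Pi.single_eq_of_ne (Fin.succ_ne_zero i).symm 1
      have h3 : ∀ j : Fin k, (Pi.single i.succ 1 : Fin (k + 1) → ℕ) j.succ =
          (Pi.single i 1 : Fin k → ℕ) j := fun j => by
        simp [Pi.single_apply]
      rw [← mul_assoc, h1, mul_assoc, mul_assoc, ih, pow_add]
      simp only [Pi.add_apply, h2, h3, Fin.succ_lt_succ_iff, Fin.succ_pos, if_true, add_zero]
      generalize (∑ j : Fin k, if j < i then a j.succ else 0) = e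
      rcases Nat.even_or_odd e with he | he <;> simp [he.neg_one_pow]

variable (R : Type*) [CommRing R] {k : ℕ}

theorem X_anti {i j : Fin k} (h : i ≠ j) : X R i * X R j = -(X R j * X R i) :=
  eq_neg_of_add_eq_zero_left (X_anticomm h)

/-- The ordered monomial `x_1^{a_1} ⋯ x_k^{a_k}`. -/
def mono (a : Fin k → ℕ) : OPol R k := (List.ofFn fun j => X R j ^ a j).prod

/-- The exponent of the sign obtained when moving `x_i` into its place. -/
def signExp (i : Fin k) (a : Fin k → ℕ) : ℕ := ∑ j, if j < i then a j else 0

theorem X_mul_mono (i : Fin k) (a : Fin k → ℕ) :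
    X R i * mono R a = (-1 : R) ^ signExp i a • mono R (a + Pi.single i 1) := by
  have h := anti_mul_prod_pow (fun j => X R j) (fun i j h => X_anti R h) i a
  rw [Algebra.smul_def, map_pow, map_neg, map_one]
  exact h

@[simp]

theorem mono_zero : mono R (0 : Fin k → ℕ) = 1 := by
  simp [mono]

/-- The operator of multiplication by `x_i` in terms of exponents. -/
def mulOp (i : Fin k) : Module.End R ((Fin k → ℕ) →₀ R) :=
  Finsupp.linearCombination R fun a =>
    (-1 : R) ^ signExp i a • Finsupp.single (a + Pi.single i 1) 1

theorem mulOp_single (i : Fin k) (a : Fin k → ℕ) :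
    mulOp R i (Finsupp.single a 1) =
      (-1 : R) ^ signExp i a • Finsupp.single (a + Pi.single i 1) 1 := by
  rw [mulOp, Finsupp.linearCombination_single, one_smul]

theorem signExp_add_single (i j : Fin k) (a : Fin k → ℕ) :
    signExp i (a + Pi.single j 1) = signExp i a + if j < i then 1 else 0 := by
  have : ∀ l : Fin k, (if l < i then (a + Pi.single j 1 : Fin k → ℕ) l else 0) =
      (if l < i then a l else 0) + if l = j then (if j < i then 1 else 0) else 0 := by
    intro l
    rw [Pi.add_apply, Pi.single_apply]
    by_cases hl : l = j
    · subst hl; split_ifs <;> simp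
    · simp [hl]
  rw [signExp, Finset.sum_congr rfl fun l _ => this l, Finset.sum_add_distrib, ← signExp]
  simp

/-- In exactly one of the two orders the smaller variable is already present when the larger one is
inserted, which costs one extra sign. -/
theorem mulOp_anticomm {i j : Fin k} (h : i ≠ j) :
    mulOp R i * mulOp R j + mulOp R j * mulOp R i = 0 := by
  refine Finsupp.lhom_ext' fun a => LinearMap.ext_ring ?_
  simp only [LinearMap.comp_apply, Finsupp.lsingle_apply, LinearMap.add_apply, Module.End.mul_apply,
    LinearMap.zero_apply, mulOp_single, map_smul, smul_smul, ← pow_add, signExp_add_single]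
  rw [add_right_comm a, ← add_smul]
  rcases lt_or_gt_of_ne h with h | h
  · rw [if_pos h, if_neg h.not_gt, add_zero, ← add_assoc, pow_succ, add_comm (signExp i a)]; simp
  · rw [if_pos h, if_neg h.not_gt, add_zero, ← add_assoc, pow_succ, add_comm (signExp i a)]; simp

/-- The representation of skew polynomials on exponents. -/
def expRep : OPol R k →ₐ[R] Module.End R ((Fin k → ℕ) →₀ R) :=
  OPol.lift (mulOp R) fun _ _ h => mulOp_anticomm R h

theorem sum_sub_single_lt {a : Fin k → ℕ} {i : Fin k} (hi : a i ≠ 0) :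
    ∃ a' : Fin k → ℕ, a = a' + Pi.single i 1 ∧ ∑ j, a' j < ∑ j, a j := by
  have h : a = (a - Pi.single i 1) + Pi.single i 1 := by
    funext j
    by_cases hj : j = i
    · subst hj; simp; omega
    · simp [Pi.single_eq_of_ne hj]
  refine ⟨_, h, ?_⟩
  conv_rhs => rw [h]
  simp [Finset.sum_add_distrib]

/-- Every nonconstant monomial is, up to sign, a variable times a smaller monomial. -/
theorem mono_induction {P : (Fin k → ℕ) → Prop} (h0 : P 0)
    (hs : ∀ i a, P a → P (a + Pi.single i 1)) (a : Fin k → ℕ) : P a := by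
  induction hn : ∑ j, a j using Nat.strong_induction_on generalizing a with
  | _ n ih =>
    by_cases ha : a = 0
    · rwa [ha]
    · obtain ⟨i, hi⟩ := Function.ne_iff.1 ha
      obtain ⟨a', rfl, hlt⟩ := sum_sub_single_lt hi
      exact hs i a' (ih _ (hn ▸ hlt) a' rfl)

theorem mono_add_single (i : Fin k) (a : Fin k → ℕ) :
    mono R (a + Pi.single i 1) = (-1 : R) ^ signExp i a • (X R i * mono R a) := by
  rw [X_mul_mono, smul_smul, ← mul_pow]; simp

theorem expRep_mono (a : Fin k → ℕ) :
    expRep R (mono R a) (Finsupp.single 0 1) = Finsupp.single a 1 := by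
  induction a using mono_induction with
  | h0 => simp
  | hs i a ih =>
    rw [mono_add_single, map_smul, map_mul, LinearMap.smul_apply, Module.End.mul_apply, ih, expRep,
      OPol.lift_X, mulOp_single, smul_smul, ← mul_pow]
    simp

/-- With `expRep_mono` this shows that acting on the basis vector of exponent `0`, and sending
exponents to ordered monomials, are inverse to each other. Hence the ordered monomials form a basis
over any commutative ring. -/
theorem linearCombination_expRep (f : OPol R k) (v : (Fin k → ℕ) →₀ R) :
    Finsupp.linearCombination R (mono R) (expRep R f v) =
      f * Finsupp.linearCombination R (mono R) v := by
  induction f using OPol.induction generalizing v with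
  | hc c => simp [Module.algebraMap_end_apply, Algebra.smul_def]
  | hX i =>
    induction v using Finsupp.induction_linear with
    | zero => simp
    | add u v hu hv => simp [mul_add, hu, hv]
    | single a c =>
      rw [← mul_one c, ← smul_eq_mul, ← Finsupp.smul_single, map_smul, map_smul, map_smul, expRep,
        OPol.lift_X, mulOp_single]
      simp [X_mul_mono]
  | hadd f g hf hg => simp [add_mul, hf, hg]
  | hmul f g hf hg => rw [map_mul, Module.End.mul_apply, hf, hg, mul_assoc]

/-- The basis of ordered monomials. -/
def monoBasis : Module.Basis (Fin k → ℕ) R (OPol R k) :=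
  .ofRepr <| LinearEquiv.ofLinearMap
    ((LinearMap.applyₗ (Finsupp.single 0 1)).comp (expRep R).toLinearMap)
    (Finsupp.linearCombination R (mono R))
    (by
      refine Finsupp.lhom_ext' fun a => LinearMap.ext_ring ?_
      simp [expRep_mono])
    (by
      ext f
      simp [linearCombination_expRep])

@[simp]

theorem monoBasis_apply (a : Fin k → ℕ) : monoBasis R a = mono R a := by
  rw [monoBasis, Module.Basis.coe_ofRepr]
  simp

theorem monoBasis_repr_mono (a : Fin k → ℕ) :
    (monoBasis R).repr (mono R a) = Finsupp.single a 1 := by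
  rw [← monoBasis_apply, Module.Basis.repr_self]

theorem mono_mul_mono (a b : Fin k → ℕ) :
    ∃ N : ℕ, mono R a * mono R b = (-1 : R) ^ N • mono R (a + b) := by
  induction a using mono_induction with
  | h0 => exact ⟨0, by simp⟩
  | hs i a ih =>
    obtain ⟨N, hN⟩ := ih
    refine ⟨signExp i a + N + signExp i (a + b), ?_⟩
    rw [mono_add_single, smul_mul_assoc, mul_assoc, hN, mul_smul_comm, X_mul_mono, smul_smul,
      smul_smul, ← pow_add, ← pow_add, add_right_comm a]

end Monomials

/-! ### Leading terms for the lexicographic order -/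

section Lead

variable (R : Type*) [CommRing R] {k : ℕ}

/-- The span of the monomials below `a`. -/
def low (a : Fin k → ℕ) : Submodule R (OPol R k) :=
  Submodule.span R (mono R '' {b | toLex b < toLex a})

/-- The span of the monomials up to `a`. -/
def upTo (a : Fin k → ℕ) : Submodule R (OPol R k) :=
  Submodule.span R (mono R '' {b | toLex b ≤ toLex a})

variable {R}

theorem mem_low {a : Fin k → ℕ} {f : OPol R k} :
    f ∈ low R a ↔ ∀ b, (monoBasis R).repr f b ≠ 0 → toLex b < toLex a := by
  have : mono R '' {b | toLex b < toLex a} = monoBasis R '' {b | toLex b < toLex a} :=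
    Set.image_congr fun b _ => (monoBasis_apply R b).symm
  rw [low, this, Module.Basis.mem_span_image]
  simp [Set.subset_def]

theorem mem_upTo {a : Fin k → ℕ} {f : OPol R k} :
    f ∈ upTo R a ↔ ∀ b, (monoBasis R).repr f b ≠ 0 → toLex b ≤ toLex a := by
  have : mono R '' {b | toLex b ≤ toLex a} = monoBasis R '' {b | toLex b ≤ toLex a} :=
    Set.image_congr fun b _ => (monoBasis_apply R b).symm
  rw [upTo, this, Module.Basis.mem_span_image]
  simp [Set.subset_def]

theorem low_le_upTo (a : Fin k → ℕ) : low R a ≤ upTo R a := fun _ hf =>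
  mem_upTo.2 fun b hb => (mem_low.1 hf b hb).le

theorem upTo_le_low {a b : Fin k → ℕ} (h : toLex a < toLex b) : upTo R a ≤ low R b := fun _ hf =>
  mem_low.2 fun c hc => (mem_upTo.1 hf c hc).trans_lt h

theorem mono_mem_upTo (a : Fin k → ℕ) : mono R a ∈ upTo R a :=
  Submodule.subset_span ⟨a, le_refl (toLex a), rfl⟩

theorem low_mul_upTo {a b : Fin k → ℕ} {f g : OPol R k} (hf : f ∈ low R a) (hg : g ∈ upTo R b) :
    f * g ∈ low R (a + b) := by
  have h : low R a * upTo R b ≤ low R (a + b) := by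
    rw [low, upTo, Submodule.span_mul_span]
    refine Submodule.span_le.2 ?_
    rintro _ ⟨_, ⟨c, hc, rfl⟩, _, ⟨d, hd, rfl⟩, rfl⟩
    obtain ⟨N, hN⟩ := mono_mul_mono R c d
    simp only [hN]
    exact Submodule.smul_mem _ _ (Submodule.subset_span ⟨c + d,
      (add_lt_add_of_lt_of_le hc hd : toLex c + toLex d < toLex a + toLex b), rfl⟩)
  exact h (Submodule.mul_mem_mul hf hg)

theorem upTo_mul_low {a b : Fin k → ℕ} {f g : OPol R k} (hf : f ∈ upTo R a) (hg : g ∈ low R b) :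
    f * g ∈ low R (a + b) := by
  have h : upTo R a * low R b ≤ low R (a + b) := by
    rw [low, upTo, Submodule.span_mul_span]
    refine Submodule.span_le.2 ?_
    rintro _ ⟨_, ⟨c, hc, rfl⟩, _, ⟨d, hd, rfl⟩, rfl⟩
    obtain ⟨N, hN⟩ := mono_mul_mono R c d
    simp only [hN]
    exact Submodule.smul_mem _ _ (Submodule.subset_span ⟨c + d,
      (add_lt_add_of_le_of_lt hc hd : toLex c + toLex d < toLex a + toLex b), rfl⟩)
  exact h (Submodule.mul_mem_mul hf hg)

/-- The polynomial `f` is `c x^a` plus lower terms. -/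
def Lead (f : OPol R k) (a : Fin k → ℕ) (c : R) : Prop := f - c • mono R a ∈ low R a

theorem Lead.mem_upTo {f : OPol R k} {a : Fin k → ℕ} {c : R} (h : Lead f a c) : f ∈ upTo R a := by
  have := Submodule.add_mem _ (low_le_upTo a h) (Submodule.smul_mem _ c (mono_mem_upTo (R := R) a))
  rwa [sub_add_cancel] at this

theorem Lead.repr {f : OPol R k} {a : Fin k → ℕ} {c : R} (h : Lead f a c) :
    (monoBasis R).repr f a = c := by
  by_contra hne
  refine lt_irrefl _ (mem_low.1 h a ?_)
  rw [map_sub, map_smul, monoBasis_repr_mono]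
  simpa [sub_eq_zero] using hne

theorem lead_mono (a : Fin k → ℕ) : Lead (mono R a) a 1 := by
  rw [Lead, one_smul, sub_self]; exact Submodule.zero_mem _

theorem lead_one : Lead (1 : OPol R k) 0 1 := by
  rw [← mono_zero]; exact lead_mono 0

theorem Lead.add_low {f g : OPol R k} {a : Fin k → ℕ} {c : R} (h : Lead f a c) (hg : g ∈ low R a) :
    Lead (f + g) a c := by
  rw [Lead, add_sub_right_comm]
  exact Submodule.add_mem _ h hg

theorem Lead.smul {f : OPol R k} {a : Fin k → ℕ} {c : R} (h : Lead f a c) (d : R) :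
    Lead (d • f) a (d * c) := by
  rw [Lead, mul_smul, ← smul_sub]
  exact Submodule.smul_mem _ _ h

/-- Monomials multiply up to sign and the lexicographic order respects addition. Since `Lead`
permits the coefficient zero, zero divisors in `R` do no harm. -/
theorem Lead.mul {f g : OPol R k} {a b : Fin k → ℕ} {c d : R} (hf : Lead f a c) (hg : Lead g b d) :
    ∃ N : ℕ, Lead (f * g) (a + b) ((-1) ^ N * (c * d)) := by
  obtain ⟨N, hN⟩ := mono_mul_mono R a b
  refine ⟨N, ?_⟩
  have e : f * g - ((-1) ^ N * (c * d)) • mono R (a + b) =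
      (f - c • mono R a) * g + c • (mono R a * (g - d • mono R b)) := by
    rw [mul_comm ((-1) ^ N), mul_smul, ← hN]
    simp only [sub_mul, mul_sub, smul_mul_assoc, mul_smul_comm, smul_sub, smul_smul]
    abel
  rw [Lead, e]
  exact Submodule.add_mem _ (low_mul_upTo hf hg.mem_upTo)
    (Submodule.smul_mem _ _ (upTo_mul_low (mono_mem_upTo a) hg))

theorem exists_lead (f : OPol R k) (hf : f ≠ 0) :
    ∃ a c, c ≠ 0 ∧ Lead f a c := by
  have hne : ((monoBasis R).repr f).support.Nonempty := by
    rw [Finsupp.support_nonempty_iff]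
    simpa using hf
  obtain ⟨a, ha, hmax⟩ := Finset.exists_max_image _ (fun b => toLex b) hne
  refine ⟨a, (monoBasis R).repr f a, by simpa using ha, ?_⟩
  rw [Lead, mem_low]
  intro b hb
  rw [map_sub, map_smul, monoBasis_repr_mono] at hb
  have hba : b ≠ a := by
    rintro rfl
    simp at hb
  have hb' : (monoBasis R).repr f b ≠ 0 := by
    simpa [Finsupp.single_apply, hba.symm] using hb
  exact lt_of_le_of_ne (hmax b (by simpa using hb')) fun e => hba (toLex.injective e)

theorem lead_X (i : Fin k) : Lead (X R i) (Pi.single i 1) 1 := by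
  have h := X_mul_mono R i 0
  rw [mono_zero, mul_one, zero_add] at h
  have : signExp i (0 : Fin k → ℕ) = 0 := by simp [signExp]
  rw [h, this, pow_zero, one_smul]
  exact lead_mono _

theorem lead_tX (i : Fin k) : Lead (tX R i) (Pi.single i 1) ((-1) ^ (i : ℕ)) := by
  have := (lead_X (R := R) i).smul ((-1) ^ (i : ℕ))
  rwa [mul_one, Algebra.smul_def, map_pow, map_neg, map_one] at this

theorem esymmList_eq_zero {B : Type*} [Ring B] {L : List B} {r : ℕ} (h : L.length < r) :
    esymmList L r = 0 := by
  rw [esymmList, List.sublistsLen_of_length_lt h]; rfl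

/-- The lexicographically largest product of `r` of the variables with index at least `i` uses the
first `r` of them. The tail of the list is treated so that the variables can be split off one at a
time. -/
theorem lead_esymmList (i r : ℕ) (hir : i + r ≤ k) :
    ∃ N : ℕ, Lead (esymmList ((List.ofFn (tX R (k := k))).drop i) r)
      (fun j => if i ≤ (j : ℕ) ∧ (j : ℕ) < i + r then 1 else 0) ((-1) ^ N) := by
  induction hn : k - i generalizing i r with
  | zero =>
    obtain rfl : r = 0 := by omega
    refine ⟨0, ?_⟩
    have : (fun j : Fin k => if i ≤ (j : ℕ) ∧ (j : ℕ) < i + 0 then 1 else 0) = 0 := by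
      funext j; simp
    rw [this, esymmList_zero, pow_zero]
    exact lead_one
  | succ n ih =>
    rcases r with _ | r
    · refine ⟨0, ?_⟩
      have : (fun j : Fin k => if i ≤ (j : ℕ) ∧ (j : ℕ) < i + 0 then 1 else 0) = 0 := by
        funext j; simp
      rw [this, esymmList_zero, pow_zero]
      exact lead_one
    · have hi : i < k := by omega
      rw [List.drop_eq_getElem_cons (by simpa using hi), esymmList_cons, List.getElem_ofFn]
      obtain ⟨N, hN⟩ := ih (i + 1) r (by omega) (by omega)
      obtain ⟨N', hN'⟩ := (lead_tX (R := R) ⟨i, hi⟩).mul hN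
      have e : (Pi.single ⟨i, hi⟩ 1 : Fin k → ℕ) +
          (fun j : Fin k => if i + 1 ≤ (j : ℕ) ∧ (j : ℕ) < i + 1 + r then 1 else 0) =
          fun j : Fin k => if i ≤ (j : ℕ) ∧ (j : ℕ) < i + (r + 1) then 1 else 0 := by
        funext j
        simp only [Pi.add_apply, Pi.single_apply, Fin.ext_iff]
        split_ifs <;> omega
      rw [e] at hN'
      refine ⟨N' + (i + N), ?_⟩
      rw [pow_add, pow_add, add_comm]
      refine hN'.add_low ?_
      -- The products that avoid the variable with index `i` are lower, and there are none if too
      -- few variables remain.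
      by_cases h : i + 1 + (r + 1) ≤ k
      · obtain ⟨N'', h''⟩ := ih (i + 1) (r + 1) h (by omega)
        refine upTo_le_low ?_ h''.mem_upTo
        refine ⟨⟨i, hi⟩, fun j hj => ?_, ?_⟩
        · have hj' : (j : ℕ) < i := hj
          simp only [Pi.toLex_apply]
          rw [if_neg (by omega), if_neg (by omega)]
        · simp
      · rw [esymmList_eq_zero (by simp; omega)]
        exact Submodule.zero_mem _

/-- The exponent of the leading monomial of a word in the elementary symmetric polynomials. -/
def wordExp (k : ℕ) (l : List ℕ) : Fin k → ℕ := fun i => l.countP fun r => (i : ℕ) < r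

/-- Each letter `r` contributes exponent one to the first `r` variables, so the exponent of a word
is the partition conjugate to its letters. The leading coefficient is a sign, hence invertible over
any `R`. -/
theorem lead_epsWord (l : List ℕ) (hl : ∀ r ∈ l, r ≤ k) :
    ∃ N : ℕ, Lead ((l.map (epsPol R k)).prod) (wordExp k l) ((-1) ^ N) := by
  induction l with
  | nil =>
    refine ⟨0, ?_⟩
    rw [pow_zero]
    exact lead_one
  | cons r l ih =>
    obtain ⟨N, hN⟩ := ih fun r hr => hl r (List.mem_cons_of_mem _ hr)
    obtain ⟨N', hN'⟩ := lead_esymmList (R := R) (k := k) 0 r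
      (by simpa using hl r List.mem_cons_self)
    obtain ⟨N'', h⟩ := hN'.mul hN
    refine ⟨N'' + (N' + N), ?_⟩
    rw [pow_add, pow_add]
    convert h using 1
    · rw [List.map_cons, List.prod_cons]; rfl
    · funext j
      simp [wordExp, List.countP_cons, add_comm]

end Lead

/-! ### Straightening of words -/

section Straighten

variable {B : Type*} [Ring B]

/-- A mixed relation expresses `u_q u_{p+1}` by `u_p u_{q+1}`, `u_{p+1} u_q` and `u_{q+1} u_p`. The
first two have the required form and the last is covered by induction on the lower index. If the
indices have the same parity, the factors just commute. -/
theorem OddSeq.straighten_pair {u : ℤ → B} (hu : OddSeq u) (h0 : u 0 = 1) (p q : ℕ) :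
    u q * u p ∈ Submodule.span ℤ {x | ∃ i j : ℕ, i ≤ p ∧ i + j = p + q ∧ x = u i * u j} := by
  induction p generalizing q with
  | zero =>
    refine Submodule.subset_span ⟨0, q, le_rfl, by omega, ?_⟩
    simp [h0]
  | succ p ih =>
    have hself : u (p + 1 : ℕ) * u q ∈
        Submodule.span ℤ {x | ∃ i j : ℕ, i ≤ p + 1 ∧ i + j = p + 1 + q ∧ x = u i * u j} :=
      Submodule.subset_span ⟨p + 1, q, le_rfl, rfl, rfl⟩
    have hnext : u p * u (q + 1 : ℕ) ∈
        Submodule.span ℤ {x | ∃ i j : ℕ, i ≤ p + 1 ∧ i + j = p + 1 + q ∧ x = u i * u j} :=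
      Submodule.subset_span ⟨p, q + 1, by omega, by omega, rfl⟩
    have hih : u (q + 1 : ℕ) * u p ∈
        Submodule.span ℤ {x | ∃ i j : ℕ, i ≤ p + 1 ∧ i + j = p + 1 + q ∧ x = u i * u j} := by
      refine Submodule.span_mono ?_ (ih (q + 1))
      rintro _ ⟨i, j, hi, hj, rfl⟩
      exact ⟨i, j, by omega, by omega, rfl⟩
    push_cast at hself hnext hih ⊢
    rcases Nat.even_or_odd (p + q) with hpq | hpq
    · rcases Int.even_or_odd (p : ℤ) with hp | hp
      · have hq : Even (q : ℤ) := by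
          rw [Nat.even_add] at hpq
          exact_mod_cast hpq.1 (by exact_mod_cast hp)
        have e : u q * u (p + 1) = u p * u (q + 1) + u (q + 1) * u p - u (p + 1) * u q := by
          rw [hu.even _ _ hp hq]; abel
        rw [e]
        exact Submodule.sub_mem _ (Submodule.add_mem _ hnext hih) hself
      · have hq : Odd (q : ℤ) := by
          rw [Nat.even_add'] at hpq
          exact_mod_cast hpq.1 (by exact_mod_cast hp)
        have e : u q * u (p + 1) = u p * u (q + 1) - u (q + 1) * u p + u (p + 1) * u q := by
          rw [hu.odd _ _ hp hq]; abel
        rw [e]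
        exact Submodule.add_mem _ (Submodule.sub_mem _ hnext hih) hself
    · rw [hu.comm]
      · exact hself
      · have : Even (q + (p + 1)) := by rw [← add_assoc, add_comm q]; exact hpq.add_one
        exact_mod_cast this

/-- The weight of a word, which drops when larger letters move to the right. -/
def wordWeight : List ℕ → ℕ
  | [] => 0
  | a :: l => (l.length + 1) * a + wordWeight l

theorem wordWeight_lt (w : List ℕ) {p q i j : ℕ} (v : List ℕ) (hi : i < q) (hij : i + j = p + q) :
    wordWeight (w ++ i :: j :: v) < wordWeight (w ++ q :: p :: v) := by
  induction w with
  | nil =>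
    simp only [List.nil_append, wordWeight, List.length_cons]
    have : (v.length + 1) * i + (v.length + 1) * j = (v.length + 1) * p + (v.length + 1) * q := by
      rw [← mul_add, hij, mul_add]
    linarith
  | cons a w ih => simpa [wordWeight] using ih

theorem sorted_or_descent (l : List ℕ) :
    l.Pairwise (· ≤ ·) ∨ ∃ w q p v, l = w ++ q :: p :: v ∧ p < q := by
  induction l with
  | nil => exact Or.inl List.Pairwise.nil
  | cons a l ih =>
    rcases ih with ih | ⟨w, q, p, v, rfl, h⟩
    · cases l with
      | nil => exact Or.inl (List.pairwise_singleton _ _)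
      | cons b v =>
        rcases lt_or_ge b a with hab | hab
        · exact Or.inr ⟨[], a, b, v, rfl, hab⟩
        · refine Or.inl (List.pairwise_cons.2 ⟨fun c hc => ?_, ih⟩)
          rcases List.mem_cons.1 hc with rfl | hc
          · exact hab
          · exact hab.trans ((List.pairwise_cons.1 ih).1 c hc)
    · exact Or.inr ⟨a :: w, q, p, v, rfl, h⟩

/-- The product of the elements of a sequence along a word. -/
def wordProd (u : ℤ → B) (l : List ℕ) : B := (l.map fun r : ℕ => u r).prod

theorem wordProd_append (u : ℤ → B) (l l' : List ℕ) :
    wordProd u (l ++ l') = wordProd u l * wordProd u l' := by simp [wordProd]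

/-- The increasing words with letters between `1` and `k`. -/
def IncWord (k : ℕ) : Type := {l : List ℕ // l.Pairwise (· ≤ ·) ∧ ∀ r ∈ l, 1 ≤ r ∧ r ≤ k}

/-- At a descent `q > p` the pair is replaced by pairs with the same sum whose first letter is at
most `p`, hence less than `q`. The new words may have more descents, but their weight is smaller. -/
theorem OddSeq.wordProd_mem_sorted {u : ℤ → B} (hu : OddSeq u) (h0 : u 0 = 1) (l : List ℕ) :
    wordProd u l ∈ Submodule.span ℤ (wordProd u '' {l | l.Pairwise (· ≤ ·)}) := by
  induction hn : wordWeight l using Nat.strong_induction_on generalizing l with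
  | _ n ih =>
    subst hn
    rcases sorted_or_descent l with hl | ⟨w, q, p, v, rfl, h⟩
    · exact Submodule.subset_span ⟨l, hl, rfl⟩
    · have e : ∀ i j : ℕ, wordProd u (w ++ i :: j :: v) =
          (LinearMap.mulLeft ℤ (wordProd u w) ∘ₗ LinearMap.mulRight ℤ (wordProd u v)) (u i * u j) :=
        fun i j => by simp [wordProd, mul_assoc]
      rw [e]
      have := Submodule.mem_map_of_mem (f := LinearMap.mulLeft ℤ (wordProd u w) ∘ₗ
        LinearMap.mulRight ℤ (wordProd u v)) (hu.straighten_pair h0 p q)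
      refine (Submodule.map_span_le _ _ _).2 ?_ this
      rintro _ ⟨i, j, hi, hij, rfl⟩
      rw [← e]
      exact ih _ (wordWeight_lt w v (by omega) hij) _ rfl

/-- Straightening can create letters `0` and letters above `k`. The former are dropped because `u 0
= 1`, and the latter annihilate the word. -/
theorem OddSeq.wordProd_mem_incWord {u : ℤ → B} (hu : OddSeq u) (h0 : u 0 = 1) {k : ℕ}
    (hk : ∀ r : ℕ, k < r → u r = 0) (l : List ℕ) :
    wordProd u l ∈ Submodule.span ℤ (Set.range fun l : IncWord k => wordProd u l.1) := by
  refine Submodule.span_le.2 ?_ (hu.wordProd_mem_sorted h0 l)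
  rintro _ ⟨l, hl, rfl⟩
  by_cases hlk : ∀ r ∈ l, r ≤ k
  · have e : wordProd u l = wordProd u (l.filter (0 < ·)) := by
      clear hl hlk
      induction l with
      | nil => rfl
      | cons a l ih =>
        rcases Nat.eq_zero_or_pos a with rfl | ha
        · rw [List.filter_cons_of_neg (by simp), ← ih]; simp [wordProd, h0]
        · rw [List.filter_cons_of_pos (by simpa using ha)]
          simp only [wordProd, List.map_cons, List.prod_cons] at ih ⊢
          rw [ih]
    rw [e]
    refine Submodule.subset_span ⟨⟨l.filter (0 < ·), hl.filter _, fun r hr => ?_⟩, rfl⟩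
    rw [List.mem_filter] at hr
    exact ⟨by simpa [Nat.succ_le_iff] using hr.2, hlk r hr.1⟩
  · push Not at hlk
    obtain ⟨r, hr, hkr⟩ := hlk
    have : wordProd u l = 0 := by
      obtain ⟨s, t, rfl⟩ := List.append_of_mem hr
      simp [wordProd, hk r hkr]
    simp only [this]
    exact Submodule.zero_mem _

end Straighten

/-! ### Leading terms of odd symmetric polynomials -/

section Generation

variable {R : Type*} [CommRing R] {k : ℕ}

/-- Two anticommutation signs cancel. In `mul_div` this lets `x_i^2 - x_{i+1}^2` pass through
`s_i(f)`. -/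
theorem X_sq_commute (i : Fin k) (f : OPol R k) : Commute (X R i * X R i) f := by
  induction f using OPol.induction with
  | hc c => exact (Algebra.commutes c _).symm
  | hX j =>
    by_cases h : i = j
    · subst h; exact (Commute.refl _).mul_left (Commute.refl _)
    · rw [Commute, SemiconjBy, mul_assoc, X_anti R h, mul_neg, ← mul_assoc, X_anti R h, neg_mul,
        neg_neg, mul_assoc]
  | hadd f g hf hg => exact hf.add_right hg
  | hmul f g hf hg => exact hf.mul_right hg

/-- The odd divided difference as a twisted difference quotient. -/
theorem mul_div {i : ℕ} (hi : i + 1 < k) (f : OPol R k) :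
    (X R ⟨i, by omega⟩ * X R ⟨i, by omega⟩ - X R ⟨i + 1, hi⟩ * X R ⟨i + 1, hi⟩) * div R k i hi f =
      (X R ⟨i, by omega⟩ - X R ⟨i + 1, hi⟩) * f -
        sAct R k i hi f * (X R ⟨i, by omega⟩ - X R ⟨i + 1, hi⟩) := by
  induction f using OPol.induction with
  | hc c =>
    rw [div_algebraMap, AlgHom.commutes, Algebra.commutes]; simp
  | hX j =>
    rw [div_X, sAct_X]
    by_cases h1 : j = ⟨i, by omega⟩
    · subst h1
      simp only [adj, Equiv.swap_apply_left]
      simp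
      noncomm_ring
    · by_cases h2 : j = ⟨i + 1, hi⟩
      · subst h2
        simp only [adj, Equiv.swap_apply_right]
        simp
        noncomm_ring
      · rw [adj, Equiv.swap_apply_of_ne_of_ne h1 h2, if_neg, mul_zero, sub_mul, neg_mul, mul_sub,
          X_anti R h1, X_anti R h2]
        · abel
        · rintro (h | h)
          · exact h1 (Fin.ext h)
          · exact h2 (Fin.ext h)
  | hadd f g hf hg =>
    rw [map_add, map_add, mul_add, hf, hg]
    noncomm_ring
  | hmul f g hf hg =>
    have hc := ((X_sq_commute ⟨i, by omega⟩ (sAct R k i hi f)).sub_left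
      (X_sq_commute ⟨i + 1, hi⟩ (sAct R k i hi f))).eq
    rw [div_mul, mul_add, ← mul_assoc, hf, ← mul_assoc, hc, mul_assoc (sAct R k i hi f), hg,
      map_mul]
    noncomm_ring

theorem sAct_mono {i : ℕ} (hi : i + 1 < k) (a : Fin k → ℕ) :
    ∃ N : ℕ, sAct R k i hi (mono R a) = (-1 : R) ^ N • mono R (a ∘ adj k i hi) := by
  induction a using mono_induction with
  | h0 => exact ⟨0, by simp [show ((0 : Fin k → ℕ) ∘ adj k i hi) = 0 from rfl]⟩
  | hs j a ih =>
    obtain ⟨N, hN⟩ := ih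
    have e : (a + Pi.single j 1 : Fin k → ℕ) ∘ adj k i hi =
        a ∘ adj k i hi + Pi.single (adj k i hi j) 1 := by
      funext l
      have : (adj k i hi l = j) ↔ (l = adj k i hi j) := by
        rw [adj, Equiv.swap_apply_eq_iff]
      simp [Pi.single_apply, this]
    refine ⟨signExp j a + (1 + (N + signExp (adj k i hi j) (a ∘ adj k i hi))), ?_⟩
    rw [mono_add_single, map_smul, map_mul, hN, sAct_X, mul_smul_comm, neg_mul, X_mul_mono, e,
      pow_add, pow_add, pow_add]
    simp only [smul_neg, smul_smul, pow_one, neg_mul, one_mul, mul_neg, neg_smul]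

/-- `s_i` permutes the monomials up to signs, and the sign depends on the monomial only. -/
theorem sAct_repr {i : ℕ} (hi : i + 1 < k) (a : Fin k → ℕ) :
    ∃ N : ℕ, ∀ f : OPol R k, (monoBasis R).repr (sAct R k i hi f) (a ∘ adj k i hi) =
      (-1) ^ N * (monoBasis R).repr f a := by
  obtain ⟨N, hN⟩ := sAct_mono (R := R) hi a
  refine ⟨N, fun f => ?_⟩
  have : (Finsupp.lapply (a ∘ adj k i hi) ∘ₗ (monoBasis R).repr.toLinearMap ∘ₗ
      (sAct R k i hi).toLinearMap : OPol R k →ₗ[R] R) =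
      (-1 : R) ^ N • (Finsupp.lapply a ∘ₗ (monoBasis R).repr.toLinearMap) := by
    refine (monoBasis R).ext fun b => ?_
    by_cases hb : b = a
    · subst hb
      simp [hN, monoBasis_repr_mono]
    · obtain ⟨N', hN'⟩ := sAct_mono (R := R) hi b
      have hne : b ∘ adj k i hi ≠ a ∘ adj k i hi := fun e =>
        hb ((adj k i hi).surjective.injective_comp_right e)
      simp [hN', monoBasis_repr_mono, hb, hne]
  exact LinearMap.congr_fun this f

theorem lt_comp_adj {i : ℕ} (hi : i + 1 < k) {a : Fin k → ℕ}
    (h : a ⟨i, by omega⟩ < a ⟨i + 1, hi⟩) : toLex a < toLex (a ∘ adj k i hi) := by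
  refine ⟨⟨i, by omega⟩, fun j hj => ?_, ?_⟩
  · simp only [Pi.toLex_apply, Function.comp_apply, adj]
    rw [Equiv.swap_apply_of_ne_of_ne hj.ne (ne_of_lt (hj.trans (by simp)))]
  · simpa [adj] using h

theorem lead_le {f : OPol R k} {a b : Fin k → ℕ} {c : R} (h : Lead f a c)
    (hb : (monoBasis R).repr f b ≠ 0) : toLex b ≤ toLex a := mem_upTo.1 h.mem_upTo b hb

/-- If `∂_i f = 0`, then `mul_div` gives `(x_i - x_{i+1}) f = s_i(f) (x_i - x_{i+1})`. As `x_i -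
x_{i+1}` has leading coefficient one, the leading exponent of `s_i(f)` is at most that of `f`. But
`s_i(f)` contains the exponent `a` with two entries swapped, which would be larger than `a` at an
ascent. -/
theorem lead_antitone {f : OPol R k} (hf : f ∈ OLam R k) {a : Fin k → ℕ} {c : R} (hc : c ≠ 0)
    (h : Lead f a c) {i : ℕ} (hi : i + 1 < k) : a ⟨i + 1, hi⟩ ≤ a ⟨i, by omega⟩ := by
  by_contra hlt
  rw [not_le] at hlt
  have hdiv := mul_div hi f
  rw [hf i hi, mul_zero] at hdiv
  have hX : Lead (X R ⟨i, by omega⟩ - X R ⟨i + 1, hi⟩ : OPol R k)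
      (Pi.single ⟨i, by omega⟩ 1) 1 := by
    rw [sub_eq_add_neg]
    refine (lead_X _).add_low (Submodule.neg_mem _ (upTo_le_low ?_ (lead_X _).mem_upTo))
    refine ⟨⟨i, by omega⟩, fun j hj => ?_, ?_⟩
    · have hj' : (j : ℕ) < i := hj
      simp only [Pi.toLex_apply]
      rw [Pi.single_eq_of_ne, Pi.single_eq_of_ne hj.ne]
      rw [Ne, Fin.ext_iff]; simp; omega
    · simp
  obtain ⟨N, hN⟩ := sAct_repr (R := R) hi a
  have hg : (monoBasis R).repr (sAct R k i hi f) (a ∘ adj k i hi) ≠ 0 := by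
    rw [hN, h.repr]
    rcases Nat.even_or_odd N with hN | hN <;> simpa [hN.neg_one_pow] using hc
  have hg0 : sAct R k i hi f ≠ 0 := by
    intro e; rw [e] at hg; simp at hg
  obtain ⟨m, d, hd, hm⟩ := exists_lead _ hg0
  obtain ⟨N1, h1⟩ := hm.mul hX
  obtain ⟨N2, h2⟩ := hX.mul h
  rw [sub_eq_zero.1 hdiv.symm] at h2
  have h3 : (monoBasis R).repr (sAct R k i hi f * (X R ⟨i, by omega⟩ - X R ⟨i + 1, hi⟩))
      (m + Pi.single ⟨i, by omega⟩ 1) ≠ 0 := by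
    rw [h1.repr]
    rcases Nat.even_or_odd N1 with hN | hN <;> simpa [hN.neg_one_pow] using hd
  have h4 := lead_le h2 h3
  rw [add_comm (Pi.single _ _) a] at h4
  have h5 : toLex m ≤ toLex a :=
    le_of_add_le_add_right (a := toLex (Pi.single ⟨i, by omega⟩ 1 : Fin k → ℕ)) h4
  exact absurd ((lead_le hm hg).trans h5) (not_le.2 (lt_comp_adj hi hlt))

/-- Every partition is the exponent of the leading monomial of a word. -/
theorem exists_wordExp {a : Fin k → ℕ}
    (ha : ∀ (i : ℕ) (hi : i + 1 < k), a ⟨i + 1, hi⟩ ≤ a ⟨i, by omega⟩) :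
    ∃ l : List ℕ, (∀ r ∈ l, r ≤ k) ∧ wordExp k l = a := by
  let a' : ℕ → ℕ := fun i => if h : i < k then a ⟨i, h⟩ else 0
  have hs : ∀ i, a' (i + 1) ≤ a' i := fun i => by
    by_cases h : i + 1 < k
    · simpa [a', h, show i < k by omega] using ha i h
    · simp [a', h]
  have hanti : Antitone a' := antitone_nat_of_succ_le hs
  -- With letters up to `N`, all counts fall short by `a' N`. Adding `a' N - a' (N + 1)` copies of
  -- the letter `N + 1` lowers the defect to `a' (N + 1)`, and `a' k = 0`.
  have key : ∀ N : ℕ, ∃ l : List ℕ, (∀ r ∈ l, r ≤ N) ∧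
      ∀ i < N, l.countP (fun r => i < r) + a' N = a' i := by
    intro N
    induction N with
    | zero => exact ⟨[], by simp, by simp⟩
    | succ N ih =>
      obtain ⟨l, hl, hc⟩ := ih
      refine ⟨l ++ List.replicate (a' N - a' (N + 1)) (N + 1), ?_, ?_⟩
      · intro r hr
        rcases List.mem_append.1 hr with hr | hr
        · exact (hl r hr).trans (Nat.le_succ N)
        · rw [List.eq_of_mem_replicate hr]
      · intro i hi
        have h1 := hs N
        rw [List.countP_append, List.countP_replicate, if_pos (by simpa using hi)]
        rcases Nat.lt_succ_iff_lt_or_eq.1 hi with hi | rfl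
        · have := hc i hi; omega
        · have : l.countP (fun r => i < r) = 0 := by
            rw [List.countP_eq_zero]
            intro r hr
            simpa using hl r hr
          omega
  obtain ⟨l, hl, hc⟩ := key k
  refine ⟨l, hl, funext fun i => ?_⟩
  have := hc i i.2
  simpa [a', wordExp] using this

theorem lead_neg_one_pow_smul {f : OPol R k} {a : Fin k → ℕ} {N : ℕ} (h : Lead f a ((-1) ^ N)) :
    Lead ((-1 : R) ^ N • f) a 1 := by
  have := h.smul ((-1) ^ N)
  rwa [← mul_pow, neg_one_mul, neg_neg, one_pow] at this

/-- The odd symmetric polynomials are spanned by the words in the elementary ones. -/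
theorem OLam_le_span_epsWord {f : OPol R k} (hf : f ∈ OLam R k) :
    f ∈ Submodule.span R (Set.range fun l : List ℕ => (l.map (epsPol R k)).prod) := by
  by_cases h0 : f = 0
  · rw [h0]; exact Submodule.zero_mem _
  obtain ⟨a, c, hc, hl⟩ := exists_lead f h0
  induction hA : toLex a using WellFoundedLT.induction generalizing f a c with
  | _ A ih =>
    subst hA
    -- The leading exponent is a partition, so some word has the same one with coefficient `±1`.
    -- Subtracting a multiple of that word leaves an odd symmetric polynomial with a smaller
    -- exponent, and the lexicographic order on exponents is well-founded.
    obtain ⟨l, hlk, rfl⟩ := exists_wordExp fun i hi => lead_antitone hf hc hl hi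
    obtain ⟨N, hN⟩ := lead_epsWord (R := R) l hlk
    have h1 := (lead_neg_one_pow_smul hN).smul c
    rw [mul_one] at h1
    set w := (l.map (epsPol R k)).prod with hw
    have hwS : w ∈ Submodule.span R (Set.range fun l : List ℕ => (l.map (epsPol R k)).prod) :=
      Submodule.subset_span ⟨l, rfl⟩
    have hwL : w ∈ OLam R k := Subalgebra.list_prod_mem _ fun x hx => by
      obtain ⟨r, _, rfl⟩ := List.mem_map.1 hx
      exact epsPol_mem R r
    have hlow : f - c • (-1 : R) ^ N • w ∈ low R (wordExp k l) := by
      have := Submodule.sub_mem _ hl h1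
      rwa [sub_sub_sub_cancel_right] at this
    have hsub : f - c • (-1 : R) ^ N • w ∈
        Submodule.span R (Set.range fun l : List ℕ => (l.map (epsPol R k)).prod) := by
      by_cases h0' : f - c • (-1 : R) ^ N • w = 0
      · rw [h0']; exact Submodule.zero_mem _
      obtain ⟨a', c', hc', hl'⟩ := exists_lead _ h0'
      refine ih (toLex a') (mem_low.1 hlow a' (by rw [hl'.repr]; exact hc')) ?_ h0' a' c' hc'
        hl' rfl
      exact Subalgebra.sub_mem _ hf
        (Subalgebra.smul_mem _ (Subalgebra.smul_mem _ hwL _) _)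
    have := Submodule.add_mem _ hsub
      (Submodule.smul_mem _ c (Submodule.smul_mem _ ((-1 : R) ^ N) hwS))
    rwa [sub_add_cancel] at this

/-- The multiplicity of the letter `v + 1` is the difference of two consecutive counts, and a sorted
word is determined by its multiplicities. -/
theorem wordExp_injective {l l' : List ℕ} (hl : l.Pairwise (· ≤ ·) ∧ ∀ r ∈ l, 1 ≤ r ∧ r ≤ k)
    (hl' : l'.Pairwise (· ≤ ·) ∧ ∀ r ∈ l', 1 ≤ r ∧ r ≤ k) (h : wordExp k l = wordExp k l') :
    l = l' := by
  have h1 : ∀ i : ℕ, l.countP (fun r => i < r) = l'.countP (fun r => i < r) := by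
    intro i
    by_cases hi : i < k
    · exact congrFun h ⟨i, hi⟩
    · rw [List.countP_eq_zero.2, List.countP_eq_zero.2]
      · intro r hr; have := (hl'.2 r hr).2; simp; omega
      · intro r hr; have := (hl.2 r hr).2; simp; omega
  have h2 : ∀ (m : List ℕ) (v : ℕ), m.countP (fun r => v < r) =
      m.count (v + 1) + m.countP (fun r => v + 1 < r) := by
    intro m v
    induction m with
    | nil => simp
    | cons a m ih =>
      rw [List.countP_cons, List.countP_cons, List.count_cons, ih]
      rcases lt_trichotomy (v + 1) a with h | h | h
      · simp [h, show v < a by omega, show a ≠ v + 1 by omega]; omega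
      · simp [← h]; omega
      · simp [show ¬ v + 1 < a by omega, show ¬ v < a by omega, show a ≠ v + 1 by omega]
  refine List.Perm.eq_of_pairwise' hl.1 hl'.1 (List.perm_iff_count.2 fun v => ?_)
  rcases v with _ | v
  · rw [List.count_eq_zero_of_not_mem, List.count_eq_zero_of_not_mem]
    · intro h; have := (hl'.2 0 h).1; omega
    · intro h; have := (hl.2 0 h).1; omega
  · have := h1 v
    rw [h2 l v, h2 l' v, h1 (v + 1)] at this
    omega

/-- Different increasing words have different leading exponents with coefficients `±1`, so the
largest exponent in a combination cannot cancel. -/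
theorem linearIndependent_epsWord :
    LinearIndependent R fun l : IncWord k => (l.1.map (epsPol R k)).prod := by
  rw [linearIndependent_iff]
  intro c hc
  by_contra hne
  obtain ⟨l, hl, hmax⟩ := Finset.exists_max_image c.support (fun l => toLex (wordExp k l.1))
    (Finsupp.support_nonempty_iff.2 hne)
  have h1 := congrArg (fun f => (monoBasis R).repr f (wordExp k l.1)) hc
  simp only [Finsupp.linearCombination_apply, Finsupp.sum, map_sum, map_smul, map_zero,
    Finsupp.coe_finsetSum, Finset.sum_apply, Finsupp.smul_apply, Finsupp.zero_apply] at h1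
  rw [Finset.sum_eq_single l] at h1
  · obtain ⟨N, hN⟩ := lead_epsWord (R := R) l.1 fun r hr => (l.2.2 r hr).2
    rw [hN.repr, smul_eq_mul] at h1
    refine Finsupp.mem_support_iff.1 hl ?_
    rcases Nat.even_or_odd N with hN | hN <;> simpa [hN.neg_one_pow] using h1
  · intro l' hl' hne'
    obtain ⟨N, hN⟩ := lead_epsWord (R := R) l'.1 fun r hr => (l'.2.2 r hr).2
    by_contra h2
    have h3 := lead_le hN (right_ne_zero_of_smul h2)
    exact hne' (Subtype.ext (wordExp_injective l'.2 l.2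
      (toLex.injective (le_antisymm (hmax l' hl') h3))))
  · intro h; exact absurd hl h

end Generation

/-! ### The presentation of odd symmetric polynomials -/

section Presentation

variable (R : Type*) [CommRing R] (k : ℕ)

/-- The relations between the odd elementary symmetric polynomials in `k` variables. -/
inductive PresRel : FreeAlgebra R ℤ → FreeAlgebra R ℤ → Prop
  | zero : PresRel (FreeAlgebra.ι R 0) 1
  | neg (r : ℤ) (hr : r < 0) : PresRel (FreeAlgebra.ι R r) 0
  | top (r : ℤ) (hr : k < r) : PresRel (FreeAlgebra.ι R r) 0
  | comm (a b : ℤ) (hab : Even (a + b)) :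
      PresRel (FreeAlgebra.ι R a * FreeAlgebra.ι R b) (FreeAlgebra.ι R b * FreeAlgebra.ι R a)
  | even (a b : ℤ) (ha : Even a) (hb : Even b) :
      PresRel (FreeAlgebra.ι R a * FreeAlgebra.ι R (b + 1) +
        FreeAlgebra.ι R (b + 1) * FreeAlgebra.ι R a)
        (FreeAlgebra.ι R b * FreeAlgebra.ι R (a + 1) + FreeAlgebra.ι R (a + 1) * FreeAlgebra.ι R b)
  | odd (a b : ℤ) (ha : Odd a) (hb : Odd b) :
      PresRel (FreeAlgebra.ι R a * FreeAlgebra.ι R (b + 1) -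
        FreeAlgebra.ι R (b + 1) * FreeAlgebra.ι R a)
        (FreeAlgebra.ι R b * FreeAlgebra.ι R (a + 1) - FreeAlgebra.ι R (a + 1) * FreeAlgebra.ι R b)

/-- The algebra presented by the relations between odd elementary symmetric polynomials. -/
abbrev Pres : Type _ := RingQuot (PresRel R k)

/-- The generators of the presented algebra. -/
def Pres.gen (r : ℤ) : Pres R k := RingQuot.mkAlgHom R (PresRel R k) (FreeAlgebra.ι R r)

variable {R k}

theorem Pres.rel {a b : FreeAlgebra R ℤ} (h : PresRel R k a b) :
    RingQuot.mkAlgHom R (PresRel R k) a = RingQuot.mkAlgHom R (PresRel R k) b :=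
  RingQuot.mkAlgHom_rel R h

theorem Pres.gen_oddSeq : OddSeq (Pres.gen R k) where
  comm a b hab := by
    simpa only [Pres.gen, map_mul] using Pres.rel (PresRel.comm (R := R) (k := k) a b hab)
  even a b ha hb := by
    simpa only [Pres.gen, map_mul, map_add] using
      Pres.rel (PresRel.even (R := R) (k := k) a b ha hb)
  odd a b ha hb := by
    simpa only [Pres.gen, map_mul, map_sub] using
      Pres.rel (PresRel.odd (R := R) (k := k) a b ha hb)

theorem Pres.gen_zero : Pres.gen R k 0 = 1 := by
  simpa only [Pres.gen, map_one] using Pres.rel (PresRel.zero (R := R) (k := k))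

theorem Pres.gen_neg {r : ℤ} (hr : r < 0) : Pres.gen R k r = 0 := by
  simpa only [Pres.gen, map_zero] using Pres.rel (PresRel.neg (R := R) (k := k) r hr)

theorem Pres.gen_top {r : ℤ} (hr : k < r) : Pres.gen R k r = 0 := by
  simpa only [Pres.gen, map_zero] using Pres.rel (PresRel.top (R := R) (k := k) r hr)

/-- The universal property of the presented algebra. -/
def Pres.lift {B : Type*} [Ring B] [Algebra R B] (w : ℕ → B) (hw : OddSeq (zext w)) (h0 : w 0 = 1)
    (hk : ∀ r, k < r → w r = 0) : Pres R k →ₐ[R] B :=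
  RingQuot.liftAlgHom R ⟨FreeAlgebra.lift R (zext w), by
    rintro _ _ (_ | ⟨r, hr⟩ | ⟨r, hr⟩ | ⟨a, b, hab⟩ | ⟨a, b, ha, hb⟩ | ⟨a, b, ha, hb⟩)
    · rw [FreeAlgebra.lift_ι_apply, map_one, ← h0, ← zext_natCast w 0, Nat.cast_zero]
    · rw [FreeAlgebra.lift_ι_apply, map_zero, zext_of_neg w hr]
    · lift r to ℕ using by omega
      rw [FreeAlgebra.lift_ι_apply, map_zero, zext_natCast, hk r (by omega)]
    · simpa using hw.comm a b hab
    · simpa using hw.even a b ha hb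
    · simpa using hw.odd a b ha hb⟩

theorem Pres.lift_gen {B : Type*} [Ring B] [Algebra R B] (w : ℕ → B) (hw : OddSeq (zext w))
    (h0 : w 0 = 1) (hk : ∀ r, k < r → w r = 0) (r : ℕ) :
    Pres.lift w hw h0 hk (Pres.gen R k r) = w r := by
  rw [Pres.gen, Pres.lift, RingQuot.liftAlgHom_mkAlgHom_apply, FreeAlgebra.lift_ι_apply,
    zext_natCast]

theorem Pres.mem_span_wordProd (x : Pres R k) :
    x ∈ Submodule.span R (Set.range (wordProd (Pres.gen R k))) := by
  obtain ⟨x, rfl⟩ := RingQuot.mkAlgHom_surjective R (PresRel R k) x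
  induction x using FreeAlgebra.induction with
  | grade0 c =>
    rw [AlgHom.commutes, Algebra.algebraMap_eq_smul_one]
    exact Submodule.smul_mem _ _ (Submodule.subset_span ⟨[], rfl⟩)
  | grade1 r =>
    change Pres.gen R k r ∈ _
    rcases lt_or_ge r 0 with hr | hr
    · rw [Pres.gen_neg hr]; exact Submodule.zero_mem _
    · lift r to ℕ using hr
      exact Submodule.subset_span ⟨[r], by simp [wordProd]⟩
  | mul a b ha hb =>
    rw [map_mul]
    have := Submodule.mul_mem_mul ha hb
    rw [Submodule.span_mul_span] at this
    refine Submodule.span_mono ?_ this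
    rintro _ ⟨_, ⟨l, rfl⟩, _, ⟨l', rfl⟩, rfl⟩
    exact ⟨l ++ l', wordProd_append _ _ _⟩
  | add a b ha hb => rw [map_add]; exact Submodule.add_mem _ ha hb

theorem Pres.mem_span_incWord (x : Pres R k) :
    x ∈ Submodule.span R (Set.range fun l : IncWord k => wordProd (Pres.gen R k) l.1) := by
  refine Submodule.span_le.2 ?_ (Pres.mem_span_wordProd x)
  rintro _ ⟨l, rfl⟩
  exact Submodule.span_le_restrictScalars ℤ R _ (Pres.gen_oddSeq.wordProd_mem_incWord Pres.gen_zero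
    (fun r hr => Pres.gen_top (by exact_mod_cast hr)) l)

variable (R k)

theorem anti_tX : Anti (List.ofFn (tX R (k := k))) := by
  rw [Anti, List.pairwise_ofFn]
  intro i j hij
  have h : ∀ (m : ℕ) (f g : OPol R k), (-1) ^ m * f * g = (-1) ^ m * (f * g) ∧
      f * ((-1) ^ m * g) = (-1) ^ m * (f * g) := fun m f g => by
    rcases Nat.even_or_odd m with hm | hm <;> simp [hm.neg_one_pow]
  rw [tX, tX, (h _ _ _).1, (h _ _ _).2, (h _ _ _).1, (h _ _ _).2, X_anti R hij.ne]
  rcases Nat.even_or_odd (i : ℕ) with hm | hm <;> rcases Nat.even_or_odd (j : ℕ) with hm' | hm' <;>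
    simp [hm.neg_one_pow, hm'.neg_one_pow]

theorem oddSeq_epsPol : OddSeq (zext (epsPol R k)) := oddSeq_esymmList (anti_tX R k)

theorem hPol_eq (r : ℕ) : hPol R k r = hsymmList (List.ofFn (tX R)) r := hsymmTuple_eq _ _

theorem oddSeq_hPol : OddSeq (zext (hPol R k)) := by
  rw [funext (hPol_eq R k)]
  exact oddSeq_hsymmList (anti_tX R k)

theorem epsPol_zero : epsPol R k 0 = 1 := esymmList_zero _

theorem epsPol_top {r : ℕ} (hr : k < r) : epsPol R k r = 0 := esymmList_eq_zero (by simpa using hr)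

theorem OddSeq.of_injective {B C : Type*} [Ring B] [Ring C] {f : B →+* C}
    (hf : Function.Injective f) {u : ℕ → B} (hu : OddSeq (zext fun r => f (u r))) :
    OddSeq (zext u) := by
  rw [zext_map] at hu
  constructor
  · intro a b hab
    apply hf; simpa using hu.comm a b hab
  · intro a b ha hb
    apply hf; simpa using hu.even a b ha hb
  · intro a b ha hb
    apply hf; simpa using hu.odd a b ha hb

theorem oddSeq_eps : OddSeq (zext (eps R k)) :=
  OddSeq.of_injective (f := (OLam R k).val.toRingHom) Subtype.val_injective (oddSeq_epsPol R k)

theorem oddSeq_h : OddSeq (zext (h R k)) :=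
  OddSeq.of_injective (f := (OLam R k).val.toRingHom) Subtype.val_injective (oddSeq_hPol R k)

theorem eps_zero : eps R k 0 = 1 := Subtype.ext (epsPol_zero R k)

theorem eps_top {r : ℕ} (hr : k < r) : eps R k r = 0 := Subtype.ext (epsPol_top R k hr)

theorem h_zero : h R k 0 = 1 := Subtype.ext ((hPol_eq R k 0).trans (hsymmList_zero _))

open PowerSeries in
theorem eps_mul_h : (mk fun r => sgn r • eps R k r) * mk (h R k) = 1 := by
  have h1 := esymmList_mul_hsymmList (anti_tX R k)
  ext r
  have h2 := congrArg (coeff r) h1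
  rw [coeff_mul] at h2 ⊢
  simp only [coeff_mk, ← hPol_eq] at h2 ⊢
  rw [AddSubmonoidClass.coe_finsetSum]
  refine h2.trans ?_
  rw [coeff_one, coeff_one]
  split_ifs <;> rfl

/-- The map from the presented algebra to the odd symmetric polynomials. -/
def Pres.toOLam : Pres R k →ₐ[R] OLam R k :=
  Pres.lift (eps R k) (oddSeq_eps R k) (eps_zero R k) fun _ hr => eps_top R k hr

theorem Pres.toOLam_gen (r : ℕ) : Pres.toOLam R k (Pres.gen R k r) = eps R k r :=
  Pres.lift_gen _ _ _ _ r

theorem Pres.toOLam_wordProd (l : List ℕ) :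
    (Pres.toOLam R k (wordProd (Pres.gen R k) l) : OPol R k) = (l.map (epsPol R k)).prod := by
  rw [wordProd, map_list_prod, List.map_map, ← Subalgebra.coe_val, map_list_prod, List.map_map]
  congr 1
  refine List.map_congr_left fun r _ => ?_
  simp [Pres.toOLam_gen, eps]

/-- Increasing words span the presented algebra and have linearly independent images, which gives
injectivity. Surjectivity holds because words in the `ε_r` span the odd symmetric polynomials. -/
theorem Pres.toOLam_bijective : Function.Bijective (Pres.toOLam R k) := by
  constructor
  · rw [injective_iff_map_eq_zero]
    intro x hx
    obtain ⟨c, rfl⟩ := (Finsupp.mem_span_range_iff_exists_finsupp).1 (Pres.mem_span_incWord x)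
    have h1 : Finsupp.linearCombination R
        (fun l : IncWord k => (l.1.map (epsPol R k)).prod) c = 0 := by
      have := congrArg (OLam R k).val hx
      rw [map_zero] at this
      rw [← this, Finsupp.linearCombination_apply, Finsupp.sum, Finsupp.sum, map_sum, map_sum]
      refine Finset.sum_congr rfl fun l _ => ?_
      rw [map_smul, map_smul, Subalgebra.coe_val, Pres.toOLam_wordProd]
    rw [linearIndependent_iff.1 linearIndependent_epsWord c h1]
    simp
  · rintro ⟨f, hf⟩
    obtain ⟨c, hc⟩ := (Finsupp.mem_span_range_iff_exists_finsupp).1 (OLam_le_span_epsWord hf)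
    refine ⟨c.sum fun l r => r • wordProd (Pres.gen R k) l, Subtype.ext (Eq.trans ?_ hc)⟩
    rw [← Subalgebra.coe_val, Finsupp.sum, Finsupp.sum, map_sum, map_sum]
    refine Finset.sum_congr rfl fun l _ => ?_
    rw [map_smul, map_smul, Subalgebra.coe_val, Pres.toOLam_wordProd]

/-- The presentation of the algebra of odd symmetric polynomials. -/
def presEquiv : Pres R k ≃ₐ[R] OLam R k := AlgEquiv.ofBijective _ (Pres.toOLam_bijective R k)

variable {R k}

/-- The universal property of the algebra of odd symmetric polynomials. -/
def OLam.lift {B : Type*} [Ring B] [Algebra R B] (w : ℕ → B) (hw : OddSeq (zext w)) (h0 : w 0 = 1)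
    (hk : ∀ r, k < r → w r = 0) : OLam R k →ₐ[R] B :=
  (Pres.lift w hw h0 hk).comp (presEquiv R k).symm.toAlgHom

@[simp]

theorem OLam.lift_eps {B : Type*} [Ring B] [Algebra R B] (w : ℕ → B) (hw : OddSeq (zext w))
    (h0 : w 0 = 1) (hk : ∀ r, k < r → w r = 0) (r : ℕ) :
    OLam.lift (R := R) w hw h0 hk (eps R k r) = w r := by
  have : (presEquiv R k).symm (eps R k r) = Pres.gen R k r :=
    (AlgEquiv.symm_apply_eq _).2 (Pres.toOLam_gen R k r).symm
  rw [OLam.lift, AlgHom.comp_apply]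
  exact (congrArg _ this).trans (Pres.lift_gen w hw h0 hk r)

theorem OLam.span_eps (f : OLam R k) :
    f ∈ Submodule.span R (Set.range fun l : List ℕ => (l.map (eps R k)).prod) := by
  obtain ⟨x, rfl⟩ := (Pres.toOLam_bijective R k).2 f
  have := Submodule.mem_map_of_mem (f := (Pres.toOLam R k).toLinearMap) (Pres.mem_span_wordProd x)
  refine (Submodule.map_span_le _ _ _).2 ?_ this
  rintro _ ⟨l, rfl⟩
  refine Submodule.subset_span ⟨l, ?_⟩
  simp only [AlgHom.toLinearMap_apply, wordProd, map_list_prod, List.map_map]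
  congr 1
  exact List.map_congr_left fun r _ => (Pres.toOLam_gen R k r).symm

theorem OLam.hom_ext {B : Type*} [Ring B] [Algebra R B] {f g : OLam R k →ₐ[R] B}
    (hfg : ∀ r, f (eps R k r) = g (eps R k r)) : f = g := by
  ext x
  induction OLam.span_eps x using Submodule.span_induction with
  | mem x hx =>
    obtain ⟨l, rfl⟩ := hx
    simp only [map_list_prod, List.map_map]
    congr 1
    exact List.map_congr_left fun r _ => hfg r
  | zero => rw [map_zero, map_zero]
  | add a b _ _ ha hb => rw [map_add, map_add, ha, hb]
  | smul c a _ ha => rw [map_smul, map_smul, ha]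

/-! ### Parities -/

theorem tX_mem (j : Fin k) : tX R j ∈ OPol.parity R k 1 := by
  have : X R j ∈ OPol.parity R k 1 := gen_mem_wordPart (R := R) (X R) (fun _ : Fin k => 1) j
  rw [tX]
  rcases Nat.even_or_odd (j : ℕ) with hj | hj
  · simpa [hj.neg_one_pow] using this
  · simpa [hj.neg_one_pow] using Submodule.neg_mem _ this

theorem esymmList_parity {L : List (OPol R k)} (hL : ∀ f ∈ L, f ∈ OPol.parity R k 1) (r : ℕ) :
    esymmList L r ∈ OPol.parity R k r := by
  induction L generalizing r with
  | nil =>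
    cases r with
    | zero => simpa [esymmList] using SetLike.GradedOne.one_mem (A := OPol.parity R k)
    | succ r => rw [esymmList_nil]; exact Submodule.zero_mem _
  | cons a L ih =>
    have ih' := ih fun f hf => hL f (List.mem_cons_of_mem _ hf)
    cases r with
    | zero => simpa [esymmList_zero] using SetLike.GradedOne.one_mem (A := OPol.parity R k)
    | succ r =>
      rw [esymmList_cons]
      refine Submodule.add_mem _ (ih' _) ?_
      rw [Nat.cast_succ, add_comm]
      exact SetLike.GradedMul.mul_mem (hL a List.mem_cons_self) (ih' r)

theorem hsymmList_parity {L : List (OPol R k)} (hL : ∀ f ∈ L, f ∈ OPol.parity R k 1) (r : ℕ) :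
    hsymmList L r ∈ OPol.parity R k r := by
  induction L generalizing r with
  | nil =>
    cases r with
    | zero => simpa [hsymmList] using SetLike.GradedOne.one_mem (A := OPol.parity R k)
    | succ r => rw [hsymmList, if_neg (by omega)]; exact Submodule.zero_mem _
  | cons a L ih =>
    have ih' := ih fun f hf => hL f (List.mem_cons_of_mem _ hf)
    induction r with
    | zero => simpa [hsymmList_zero] using SetLike.GradedOne.one_mem (A := OPol.parity R k)
    | succ r ihr =>
      rw [hsymmList_cons_succ]
      refine Submodule.add_mem _ (ih' _) ?_
      rw [Nat.cast_succ, add_comm]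
      exact SetLike.GradedMul.mul_mem (hL a List.mem_cons_self) ihr

theorem forall_mem_ofFn_tX : ∀ f ∈ List.ofFn (tX R (k := k)), f ∈ OPol.parity R k 1 := by
  intro f hf
  obtain ⟨j, rfl⟩ := List.mem_ofFn.1 hf
  exact tX_mem j

theorem eps_parity (r : ℕ) : eps R k r ∈ OLam.parity R k r :=
  esymmList_parity forall_mem_ofFn_tX r

theorem h_parity (r : ℕ) : h R k r ∈ OLam.parity R k r := by
  change hPol R k r ∈ OPol.parity R k r
  rw [hPol_eq]
  exact hsymmList_parity forall_mem_ofFn_tX r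

/-- An odd symmetric polynomial of a given parity is a combination of words of that parity. -/
theorem OLam.parity_eq (i : ZMod 2) :
    OLam.parity R k i = wordPart R (eps R k) (fun r => (r : ZMod 2)) i := by
  have hle : ∀ i, wordPart R (eps R k) (fun r => (r : ZMod 2)) i ≤ OLam.parity R k i := by
    intro i
    refine Submodule.span_le.2 ?_
    rintro _ ⟨l, rfl, rfl⟩
    induction l with
    | nil => exact SetLike.GradedOne.one_mem (A := OLam.parity R k)
    | cons r l ih =>
      simp only [List.map_cons, List.prod_cons, List.sum_cons]
      exact SetLike.GradedMul.mul_mem (eps_parity r) ih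
  refine le_antisymm (fun f hf => ?_) (hle i)
  -- Sort a spanning expression by the parity of its words. For `f` of parity `i`, uniqueness of the
  -- decomposition identifies `f` with the part `u i`.
  have htop : ∃ u : ZMod 2 → OLam R k,
      (∀ i, u i ∈ wordPart R (eps R k) (fun r => (r : ZMod 2)) i) ∧ ∑ i, u i = f := by
    clear hf
    induction OLam.span_eps f using Submodule.span_induction with
    | mem x hx =>
      obtain ⟨l, rfl⟩ := hx
      refine ⟨Pi.single (l.map fun r : ℕ => (r : ZMod 2)).sum (l.map (eps R k)).prod, fun i => ?_,
        by rw [Finset.sum_pi_single']; simp⟩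
      by_cases hi : i = (l.map fun r : ℕ => (r : ZMod 2)).sum
      · subst hi
        rw [Pi.single_eq_same]
        exact Submodule.subset_span ⟨l, rfl, rfl⟩
      · rw [Pi.single_eq_of_ne hi]; exact Submodule.zero_mem _
    | zero => exact ⟨0, fun i => Submodule.zero_mem _, by simp⟩
    | add a b _ _ ha hb =>
      obtain ⟨u, hu, rfl⟩ := ha
      obtain ⟨v, hv, rfl⟩ := hb
      exact ⟨u + v, fun i => Submodule.add_mem _ (hu i) (hv i), by simp [Finset.sum_add_distrib]⟩
    | smul c a _ ha =>
      obtain ⟨u, hu, rfl⟩ := ha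
      exact ⟨c • u, fun i => Submodule.smul_mem _ c (hu i), by simp [Finset.smul_sum]⟩
  obtain ⟨u, hu, rfl⟩ := htop
  have h1 := DirectSum.decompose_of_mem_same (OLam.parity R k) hf
  rw [DirectSum.decompose_sum, DFinsupp.finsetSum_apply, AddSubmonoidClass.coe_finsetSum,
    Finset.sum_eq_single i] at h1
  · rw [DirectSum.decompose_of_mem_same _ (hle i (hu i))] at h1
    rw [← h1]
    exact hu i
  · intro j _ hj
    exact DirectSum.decompose_of_mem_ne _ (hle j (hu j)) hj
  · simp

end Presentation

/-! ### Generating series -/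

section Series

open PowerSeries (mk coeff C)

variable {N : Type*} [Ring N]

/-- The substitution `t ↦ s t` of power series. -/
def alt (s : ℤ) : PowerSeries N →+* PowerSeries N where
  toFun φ := mk fun r => s ^ r • coeff r φ
  map_zero' := by ext; simp
  map_one' := by
    ext r
    rw [PowerSeries.coeff_mk, PowerSeries.coeff_one]
    split_ifs with h
    · simp [h]
    · simp
  map_add' φ ψ := by ext; simp
  map_mul' φ ψ := by
    ext r
    rw [PowerSeries.coeff_mk, PowerSeries.coeff_mul, PowerSeries.coeff_mul, Finset.smul_sum]
    refine Finset.sum_congr rfl fun x hx => ?_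
    rw [PowerSeries.coeff_mk, PowerSeries.coeff_mk, smul_mul_smul_comm, ← pow_add,
      Finset.HasAntidiagonal.mem_antidiagonal.1 hx]

@[simp]

theorem coeff_alt (s : ℤ) (φ : PowerSeries N) (r : ℕ) : coeff r (alt s φ) = s ^ r • coeff r φ := by
  simp [alt]

theorem alt_C (s : ℤ) (a : N) : alt s (C a) = C a := by
  ext r
  rw [coeff_alt, PowerSeries.coeff_C]
  split_ifs with h
  · simp [h]
  · simp

theorem alt_X (s : ℤ) : alt s (PowerSeries.X : PowerSeries N) = s • PowerSeries.X := by
  ext r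
  rw [coeff_alt, map_zsmul, PowerSeries.coeff_X]
  split_ifs with h
  · simp [h]
  · simp

theorem alt_comm (s t : ℤ) (φ : PowerSeries N) : alt s (alt t φ) = alt t (alt s φ) := by
  ext r
  simp only [coeff_alt]
  rw [smul_comm]

/-- The element `D` supercommutes with the coefficients of a series. -/
def SuperComm (D : N) (φ : PowerSeries N) : Prop := C D * φ = alt (-1) φ * C D

theorem superComm_iff {D : N} {φ : PowerSeries N} :
    SuperComm D φ ↔ ∀ r, D * coeff r φ = (-1) ^ r * (coeff r φ * D) := by
  rw [SuperComm, PowerSeries.ext_iff]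
  refine forall_congr' fun r => ?_
  rw [PowerSeries.coeff_C_mul, PowerSeries.coeff_mul_C, coeff_alt, smul_mul_assoc, zsmul_eq_mul]
  push_cast
  rfl

theorem SuperComm.mul {D : N} {φ ψ : PowerSeries N} (hφ : SuperComm D φ) (hψ : SuperComm D ψ) :
    SuperComm D (φ * ψ) := by
  rw [SuperComm, ← mul_assoc, hφ, mul_assoc, hψ, map_mul, mul_assoc]

theorem SuperComm.alt {D : N} {φ : PowerSeries N} (hφ : SuperComm D φ) (s : ℤ) :
    SuperComm D (alt s φ) := by
  have := congrArg (OddGr.alt s) hφ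
  rwa [map_mul, map_mul, alt_C, alt_comm] at this

theorem superComm_one_sub {D : N} (hD : D * D = 0) :
    SuperComm D (1 - C D * PowerSeries.X) := by
  have h : C D * C D = 0 := by rw [← map_mul, hD, map_zero]
  rw [SuperComm, map_sub, map_one, map_mul, alt_C, alt_X, mul_sub, ← mul_assoc, h, sub_mul,
    mul_assoc, smul_mul_assoc, (PowerSeries.commute_X (C D)).symm.eq, mul_smul_comm, ← mul_assoc, h]
  simp

/-- A power series with constant coefficient `1` is invertible. -/
theorem isUnit_of_coeff_zero {φ : PowerSeries N} (h : coeff 0 φ = 1) : IsUnit φ := by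
  rw [PowerSeries.isUnit_iff_constantCoeff, ← PowerSeries.coeff_zero_eq_constantCoeff_apply, h]
  exact isUnit_one

/-- If `E P` vanishes above degree `n`, where `E` has degree at most `k`, and `P` vanishes in the
degrees from `n - k + 1` to `n`, then it vanishes in all degrees above `n - k`. -/
theorem coeff_eq_zero_of_mul {E P : PowerSeries N} {n k : ℕ} (hk : k ≤ n) (h0 : coeff 0 E = 1)
    (hE : ∀ r, k < r → coeff r E = 0) (hEP : ∀ m, n < m → coeff m (E * P) = 0)
    (hP : ∀ m, n - k < m → m ≤ n → coeff m P = 0) (m : ℕ) (hm : n - k < m) : coeff m P = 0 := by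
  induction m using Nat.strong_induction_on with
  | _ m ih =>
    rcases le_or_gt m n with hmn | hmn
    · exact hP m hm hmn
    · have h := hEP m hmn
      -- Only `E_0 P_m` survives: for `0 < i ≤ k` the index `m - i` still exceeds `n - k`, because
      -- `m > n`, so `P_{m-i} = 0` by induction.
      rw [PowerSeries.coeff_mul, Finset.sum_eq_single (0, m)] at h
      · simpa [h0] using h
      · rintro ⟨i, j⟩ hij hne
        rw [Finset.HasAntidiagonal.mem_antidiagonal] at hij
        simp only at hij ⊢
        rcases lt_or_ge k i with hi | hi
        · rw [hE i hi, zero_mul]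
        · have hi0 : i ≠ 0 := by
            rintro rfl
            exact hne (by simp at hij; simp [hij])
          rw [ih j (by omega) (by omega), mul_zero]
      · simp

/-- The even power series with coefficients `c j` in degree `2 j`. -/
def evenSeries (n : ℕ) (c : ℕ → N) : PowerSeries N :=
  ∑ j ∈ Finset.range n, C (c j) * PowerSeries.X ^ (2 * j)

theorem coeff_evenSeries {n : ℕ} {c : ℕ → N} (hc : ∀ j, n ≤ j → c j = 0) (m : ℕ) :
    coeff m (evenSeries n c) = if Even m then c (m / 2) else 0 := by
  rw [evenSeries, map_sum]
  simp only [PowerSeries.coeff_C_mul, PowerSeries.coeff_X_pow, mul_ite, mul_one, mul_zero]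
  split_ifs with h
  · obtain ⟨j, rfl⟩ := h
    have e : (j + j) / 2 = j := by omega
    rw [e]
    by_cases hj : j < n
    · rw [Finset.sum_eq_single j]
      · rw [if_pos (by omega)]
      · intro i _ hi; rw [if_neg (by omega)]
      · intro hj'; exact absurd (Finset.mem_range.2 hj) hj'
    · rw [hc j (by omega)]
      refine Finset.sum_eq_zero fun i hi => ?_
      rw [Finset.mem_range] at hi
      rw [if_neg (by omega)]
  · refine Finset.sum_eq_zero fun i _ => ?_
    rw [if_neg]
    rintro rfl
    exact h (even_two_mul i)

theorem alt_evenSeries {s : ℤ} (hs : s * s = 1) (n : ℕ) (c : ℕ → N) :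
    alt s (evenSeries n c) = evenSeries n c := by
  rw [evenSeries, map_sum]
  refine Finset.sum_congr rfl fun j _ => ?_
  rw [map_mul, map_pow, alt_C, alt_X, smul_pow, pow_mul, pow_two, hs, one_pow, one_smul]

theorem commute_evenSeries {n : ℕ} {c : ℕ → N} {φ : PowerSeries N}
    (h : ∀ j, Commute (C (c j)) φ) : Commute (evenSeries n c) φ :=
  Finset.sum_induction _ (fun x => Commute x φ) (fun _ _ ha hb => ha.add_left hb)
    (Commute.zero_left _) fun j _ => (h j).mul_left ((PowerSeries.commute_X φ).symm.pow_left _)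

theorem commute_C_iff {a : N} {φ : PowerSeries N} :
    Commute (C a) φ ↔ ∀ r, Commute a (coeff r φ) := by
  rw [Commute, SemiconjBy, PowerSeries.ext_iff]
  simp only [PowerSeries.coeff_C_mul, PowerSeries.coeff_mul_C]
  rfl

theorem oddSeq_evenSeries_mul (n : ℕ) {c : ℕ → N} {φ : PowerSeries N}
    (hφ : OddSeq (zext fun r => coeff r φ)) (hc : ∀ i j, Commute (c i) (c j))
    (hcφ : ∀ j, Commute (C (c j)) φ) : OddSeq (zext fun r => coeff r (evenSeries n c * φ)) := by
  have h := hφ.sum_even_shift n c hc fun i r => by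
    rcases lt_or_ge r 0 with hr | hr
    · rw [zext_of_neg _ hr]; exact Commute.zero_right _
    · lift r to ℕ using hr
      rw [zext_natCast]
      exact commute_C_iff.1 (hcφ i) r
  have e : (zext fun r => coeff r (evenSeries n c * φ)) =
      fun r => ∑ j ∈ Finset.range n, c j * zext (fun r => coeff r φ) (r - 2 * j) := by
    refine zext_ext (fun r => ?_) fun r hr => Finset.sum_eq_zero fun j _ => by
      rw [zext_of_neg _ (by omega), mul_zero]
    rw [evenSeries, Finset.sum_mul, map_sum]
    refine Finset.sum_congr rfl fun j _ => ?_
    rw [mul_assoc, PowerSeries.coeff_C_mul, PowerSeries.coeff_X_pow_mul']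
    congr 1
    split_ifs with hj
    · have : (r : ℤ) - 2 * j = (r - 2 * j : ℕ) := by omega
      rw [this, zext_natCast]
    · rw [zext_of_neg _ (by omega)]
  rw [e]
  exact h

/-- The situation in the algebras `M_k^n`: the series `E` and `H` are inverse to each other, and the
coefficients supercommute with `D` and commute with the coefficients `c j` of the even series. -/
structure SeriesData (N : Type*) [Ring N] where
  D : N
  n : ℕ
  c : ℕ → N
  E : PowerSeries N
  H : PowerSeries N
  sq : D * D = 0
  EH : E * H = 1
  HE : H * E = 1
  commD : ∀ j, Commute (c j) D
  commc : ∀ i j, Commute (c i) (c j)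
  commH : ∀ j, Commute (C (c j)) H
  superE : SuperComm D E
  superH : SuperComm D H
  oddH : OddSeq (zext fun r => coeff r H)

/-! ### Factorizations of `S` and their degrees -/

namespace SeriesData

variable (d : SeriesData N)

/-- The even part of the series of the coefficients. -/
def V : PowerSeries N := evenSeries d.n d.c

/-- The linear factor `1 - D t`. -/
def L : PowerSeries N := 1 - C d.D * PowerSeries.X

/-- The series `∑ (-1)^r c_r t^r`. -/
def S : PowerSeries N := d.L * d.V

theorem sq' : C d.D * C d.D = 0 := by rw [← map_mul, d.sq, map_zero]

theorem commute_V_C : Commute d.V (C d.D) :=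
  commute_evenSeries fun j => by
    rw [commute_C_iff]
    intro r
    rw [PowerSeries.coeff_C]
    split_ifs
    exacts [d.commD j, Commute.zero_right _]

theorem commute_V_H : Commute d.V d.H := commute_evenSeries d.commH

theorem alt_V {s : ℤ} (hs : s * s = 1) : alt s d.V = d.V := alt_evenSeries hs _ _

theorem commute_V_L : Commute d.V d.L :=
  (Commute.one_right _).sub_right (d.commute_V_C.mul_right (PowerSeries.commute_X _))

theorem alt_L (s : ℤ) : alt s d.L = 1 - s • (C d.D * PowerSeries.X) := by
  rw [L, map_sub, map_one, map_mul, alt_C, alt_X, mul_smul_comm]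

theorem sq_CX : C d.D * PowerSeries.X * (C d.D * PowerSeries.X) = 0 := by
  rw [mul_assoc, ← mul_assoc PowerSeries.X, ← (PowerSeries.commute_X (C d.D)).eq, mul_assoc,
    ← mul_assoc, d.sq', zero_mul]

theorem alt_L_mul (s : ℤ) : alt s d.L * (1 + s • (C d.D * PowerSeries.X)) = 1 := by
  rw [alt_L, mul_add, mul_one, sub_mul, one_mul, smul_mul_smul_comm, d.sq_CX]
  simp

theorem superComm_V : SuperComm d.D d.V := by
  rw [SuperComm, d.alt_V (by norm_num), d.commute_V_C.eq]

theorem superComm_L : SuperComm d.D d.L := superComm_one_sub d.sq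

theorem coeff_L_mul_zero (φ : PowerSeries N) : coeff 0 (d.L * φ) = coeff 0 φ := by
  simp [L]

theorem coeff_L_mul_succ (φ : PowerSeries N) (r : ℕ) :
    coeff (r + 1) (d.L * φ) = coeff (r + 1) φ - d.D * coeff r φ := by
  rw [L, sub_mul, one_mul, map_sub, mul_assoc, PowerSeries.coeff_C_mul, PowerSeries.coeff_succ_X_mul]

theorem coeff_mul_L_zero (φ : PowerSeries N) : coeff 0 (φ * d.L) = coeff 0 φ := by
  simp [L]

theorem coeff_mul_L_succ (φ : PowerSeries N) (r : ℕ) :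
    coeff (r + 1) (φ * d.L) = coeff (r + 1) φ - coeff r φ * d.D := by
  rw [L, mul_sub, mul_one, map_sub, ← mul_assoc, PowerSeries.coeff_succ_mul_X,
    PowerSeries.coeff_mul_C]

/-- The even factor `V` moves freely, so only the linear factor on the right carries the
noncommutativity. -/
theorem H_mul_S : d.H * d.S = d.V * d.H * d.L := by
  rw [S, ← d.commute_V_L.eq, ← mul_assoc, d.commute_V_H.eq]

theorem superComm_VH : SuperComm d.D (d.V * d.H) := d.superComm_V.mul d.superH

theorem oddSeq_VH : OddSeq (zext fun r => coeff r (d.V * d.H)) :=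
  oddSeq_evenSeries_mul _ d.oddH d.commc d.commH

/-- The series `H S` has odd symmetric coefficients. -/
theorem oddSeq_H_mul_S : OddSeq (zext fun r => coeff r (d.H * d.S)) := by
  rw [H_mul_S]
  -- With `a` the coefficients of `V H`, the next coefficient is `a_{r+1} - a_r D = a_{r+1} +
  -- (-1)^(r+1) D a_r`.
  refine d.oddSeq_VH.zext_cons' (superComm_iff.1 d.superComm_VH) (d.coeff_mul_L_zero _) fun r => ?_
  rw [coeff_mul_L_succ, superComm_iff.1 d.superComm_VH, ← mul_assoc, ← pow_add, sub_eq_add_neg]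
  have : r + 1 + r = 2 * r + 1 := by ring
  rw [this, pow_succ, pow_mul]
  simp

theorem S_mul_alt_H {s : ℤ} (hs : s * s = 1) : d.S * alt s d.H = d.L * alt s (d.V * d.H) := by
  rw [S, map_mul, d.alt_V hs, mul_assoc]

/-- The series `S(t) H(s t)` has odd symmetric coefficients. -/
theorem oddSeq_S_mul_alt_H {s : ℤ} (hs : s * s = 1) :
    OddSeq (zext fun r => coeff r (d.S * alt s d.H)) := by
  rw [S_mul_alt_H d hs]
  have h := d.oddSeq_VH.zext_pow_smul s
  have h' : OddSeq (zext fun r => coeff r (alt s (d.V * d.H))) := by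
    simpa only [coeff_alt] using h
  have hsc := superComm_iff.1 (d.superComm_VH.alt s)
  refine h'.zext_cons (z := -d.D) (fun r => ?_) (d.coeff_L_mul_zero _) fun r => ?_
  · rw [neg_mul, hsc, mul_neg, mul_neg]
  · rw [coeff_L_mul_succ, neg_mul, sub_eq_add_neg]

theorem neg_one_pow_smul_eq (r : ℕ) (x : N) : ((-1 : ℤ) ^ r) • x = (-1) ^ r * x := by
  rw [zsmul_eq_mul]; push_cast; rfl

/-- If `H(t) S(t)` has degree at most `k`, so has `S(t) H((-1)^k t)`. -/
theorem coeff_S_mul_alt_H {k : ℕ} (h : ∀ m, k < m → coeff m (d.H * d.S) = 0) (m : ℕ) (hm : k < m) :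
    coeff m (d.S * alt ((-1) ^ k) d.H) = 0 := by
  have hs : ((-1 : ℤ) ^ k) * (-1) ^ k = 1 := by rw [← mul_pow]; simp
  rw [S_mul_alt_H d hs]
  rw [H_mul_S] at h
  obtain ⟨r, rfl⟩ : ∃ r, m = r + 1 := ⟨m - 1, by omega⟩
  set a : ℕ → N := fun r => coeff r (d.V * d.H) with ha
  have h1 : ∀ r, k < r + 1 → a (r + 1) = a r * d.D := fun r hr => by
    have := h (r + 1) hr
    rwa [coeff_mul_L_succ, sub_eq_zero] at this
  have hD' : d.D * a r = (-1) ^ r * (a r * d.D) := superComm_iff.1 d.superComm_VH r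
  rw [coeff_L_mul_succ, coeff_alt, coeff_alt]
  change _ • a (r + 1) - d.D * (_ • a r) = 0
  rw [h1 r hm, mul_smul_comm, hD', ← neg_one_pow_smul_eq, smul_smul, ← pow_mul, ← pow_mul, ← pow_add]
  -- The coefficient is `(s^(r+1) - s^r (-1)^r) a_r D` with `s = (-1)^k`. For `r = k` the scalar
  -- vanishes. For `r > k` one has `a_r D = a_{r-1} D D = 0`.
  rcases Nat.lt_succ_iff_lt_or_eq.1 hm with hkr | rfl
  · obtain ⟨q, rfl⟩ : ∃ q, r = q + 1 := ⟨r - 1, by omega⟩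
    rw [h1 q hkr, mul_assoc, d.sq]
    simp
  · rw [mul_add, mul_one, sub_self]

/-- Since `(H S)(s t) = V H(s t) (1 - s D t)`, the factor `1 + s D t` cancels `1 - s D t`, then `E(s
t)` cancels `H(s t)`, and `V (1 - D t) = S` remains. This is the factorization behind the inverse
map. -/
theorem alt_H_mul {s : ℤ} (hs : s * s = 1) :
    alt s (d.H * d.S) * ((1 + s • (C d.D * PowerSeries.X)) * alt s d.E * d.L) = d.S := by
  rw [H_mul_S, ← d.commute_V_H.symm.eq, mul_assoc, ← mul_assoc, map_mul, map_mul, d.alt_V hs]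
  simp only [← mul_assoc]
  rw [mul_assoc (_ * _) (alt s d.L), alt_L_mul, mul_one]
  rw [← d.alt_V hs, ← map_mul, d.commute_V_H.eq.symm, map_mul, d.alt_V hs, mul_assoc d.V, ← map_mul,
    d.HE, map_one, mul_one, S, d.commute_V_L.eq]

/-- The series `(1 + s D t) E(s t) (1 - D t)` with `s = (-1)^k` has degree at most `k` if `E` has. -/
theorem coeff_conj {k : ℕ} (hE : ∀ r, k < r → coeff r d.E = 0) (m : ℕ) (hm : k < m) :
    coeff m ((1 + (-1 : ℤ) ^ k • (C d.D * PowerSeries.X)) * alt ((-1) ^ k) d.E * d.L) = 0 := by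
  set s : ℤ := (-1) ^ k with hsdef
  obtain ⟨r, rfl⟩ : ∃ r, m = r + 1 := ⟨m - 1, by omega⟩
  set F := alt s d.E with hF
  have hF0 : ∀ r, k < r → coeff r F = 0 := fun r hr => by rw [coeff_alt, hE r hr, smul_zero]
  have hsc : SuperComm d.D F := d.superE.alt s
  have hDFD : C d.D * F * C d.D = 0 := by rw [hsc, mul_assoc, d.sq', mul_zero]
  have e : (1 + s • (C d.D * PowerSeries.X)) * F * d.L =
      F * d.L + s • (PowerSeries.X * (C d.D * F)) := by
    have : C d.D * PowerSeries.X * F * d.L = PowerSeries.X * (C d.D * F) := by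
      rw [(PowerSeries.commute_X (C d.D)).eq, mul_assoc PowerSeries.X, mul_assoc PowerSeries.X, L,
        mul_sub, mul_one, ← mul_assoc (C d.D * F), hDFD, zero_mul, sub_zero]
    rw [add_mul, add_mul, one_mul, smul_mul_assoc, smul_mul_assoc, this]
  rw [e, map_add, coeff_mul_L_succ, hF0 _ hm, map_zsmul, PowerSeries.coeff_succ_X_mul,
    PowerSeries.coeff_C_mul]
  -- In degree `k + 1` the two remaining terms `-F_k D` and `s D F_k` cancel, because `D F_k =
  -- (-1)^k F_k D` and `s = (-1)^k`.
  rcases Nat.lt_succ_iff_lt_or_eq.1 hm with hkr | rfl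
  · rw [hF0 r hkr]; simp
  · rw [superComm_iff.1 hsc, ← neg_one_pow_smul_eq, smul_smul, hsdef, ← mul_pow]
    simp

end SeriesData

end Series

/-! ### Maps out of `M_k^n` -/

section Supercommute

variable {R : Type*} [CommRing R] {A A' B X Y : Type*} [Ring A] [Algebra R A] [Ring A']
  [Algebra R A'] [Ring B] [Algebra R B]

theorem word_supercomm {u : X → B} {v : Y → B} {p : X → ZMod 2} {q : Y → ZMod 2}
    (h : ∀ x y, u x * v y = (-1 : ℤˣ) ^ (q y * p x) • (v y * u x)) (l : List X) (l' : List Y) :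
    (l.map u).prod * (l'.map v).prod =
      (-1 : ℤˣ) ^ ((l'.map q).sum * (l.map p).sum) • ((l'.map v).prod * (l.map u).prod) := by
  have h1 : ∀ x, u x * (l'.map v).prod =
      (-1 : ℤˣ) ^ ((l'.map q).sum * p x) • ((l'.map v).prod * u x) := by
    intro x
    induction l' with
    | nil => simp
    | cons y l' ih =>
      simp only [List.map_cons, List.prod_cons, List.sum_cons]
      rw [← mul_assoc, h, smul_mul_assoc, mul_assoc, ih, mul_smul_comm, smul_smul, add_mul,
        uzpow_add, mul_assoc]
  induction l with
  | nil => simp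
  | cons x l ih =>
    simp only [List.map_cons, List.prod_cons, List.sum_cons]
    rw [mul_assoc, ih, mul_smul_comm, ← mul_assoc, h1, smul_mul_assoc, smul_smul, mul_add,
      uzpow_add, mul_assoc, mul_comm ((-1 : ℤˣ) ^ _)]

/-- The signs are multiplicative along words, so supercommutation of two images, as needed for maps
out of a graded tensor product, may be checked on generators. -/
theorem wordPart_supercomm {g : X → A} {g' : Y → A'} {p : X → ZMod 2} {q : Y → ZMod 2}
    (F : A →ₐ[R] B) (f : A' →ₐ[R] B)
    (h : ∀ x y, F (g x) * f (g' y) = (-1 : ℤˣ) ^ (q y * p x) • (f (g' y) * F (g x)))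
    {i j : ZMod 2} {a : A} {b : A'} (ha : a ∈ wordPart R g p i) (hb : b ∈ wordPart R g' q j) :
    F a * f b = (-1 : ℤˣ) ^ (j * i) • (f b * F a) := by
  induction ha using Submodule.span_induction with
  | mem a ha =>
    obtain ⟨l, rfl, rfl⟩ := ha
    induction hb using Submodule.span_induction with
    | mem b hb =>
      obtain ⟨l', rfl, rfl⟩ := hb
      have := word_supercomm (u := F ∘ g) (v := f ∘ g') h l l'
      simpa only [map_list_prod, List.map_map] using this
    | zero => simp
    | add b b' _ _ ihb ihb' => rw [map_add, mul_add, add_mul, smul_add, ihb, ihb']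
    | smul c b _ ihb =>
      rw [map_smul, mul_smul_comm, smul_mul_assoc, ihb, smul_comm]
  | zero => simp
  | add a a' _ _ iha iha' => rw [map_add, mul_add, add_mul, smul_add, iha, iha']
  | smul c a _ iha => rw [map_smul, mul_smul_comm, smul_mul_assoc, iha, smul_comm]

end Supercommute

/-! ### The structure of `M_k^n` and its universal property -/

section Structure

variable {R : Type*} [CommRing R] {n k : ℕ}

theorem An.chi_parity (j : ℕ) : An.chi R n j ∈ An.parity R n 0 := (An.lift_chiFree R n j).1

theorem An.d_parity : An.gen R .d ∈ An.parity R n 1 :=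
  gen_mem_wordPart (R := R) (An.gen (n := n) R) AnGen.par .d

theorem An.c_parity (i : ℕ) : An.c R n i ∈ An.parity R n i := by
  rw [An.c]
  split_ifs with h
  · have : (i : ZMod 2) = 0 := (ZMod.natCast_eq_zero_iff_even).2 h
    rw [this]
    exact An.chi_parity _
  · have : (i : ZMod 2) = 1 + 0 := by
      rw [add_zero]; exact (ZMod.natCast_eq_one_iff_odd).2 (Nat.not_even_iff_odd.1 h)
    rw [this]
    exact SetLike.GradedMul.mul_mem (An.d_parity) (An.chi_parity _)

theorem An.chi_zero : An.chi R n 0 = 1 := by rw [An.chi, chiFree.eq_1, map_one]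

theorem An.chi_eq_zero {j : ℕ} (hj : n / 2 < j) : An.chi R n j = 0 := by
  obtain ⟨m, rfl⟩ : ∃ m, j = m + 1 := ⟨j - 1, by omega⟩
  rw [An.chi, chiFree.eq_2, dif_neg (by omega), map_zero]

theorem An.gen_chi_commute (j : Fin (n / 2)) (g : AnGen n) :
    Commute (An.gen R (.chi j)) (An.gen R g) := by
  have := An.rel (AnRel.chi_comm (R := R) j g)
  rwa [map_mul, map_mul] at this

theorem An.chi_commute_gen (j : ℕ) (g : AnGen n) : Commute (An.chi R n j) (An.gen R g) := by
  rcases j with _ | j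
  · rw [An.chi_zero]; exact Commute.one_left _
  · by_cases hj : j < n / 2
    · have e : An.chi R n (j + 1) = An.gen R (.chi ⟨j, hj⟩) := by
        rw [An.chi, chiFree.eq_2, dif_pos hj]; rfl
      rw [e]
      exact An.gen_chi_commute _ _
    · rw [An.chi_eq_zero (show n / 2 < j + 1 by omega)]; exact Commute.zero_left _

theorem An.chi_commute_chi (i j : ℕ) : Commute (An.chi R n i) (An.chi R n j) := by
  rcases j with _ | j
  · rw [An.chi_zero]; exact Commute.one_right _
  · by_cases hj : j < n / 2
    · have e : An.chi R n (j + 1) = An.gen R (.chi ⟨j, hj⟩) := by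
        rw [An.chi, chiFree.eq_2, dif_pos hj]; rfl
      rw [e]
      exact An.chi_commute_gen _ _
    · rw [An.chi_eq_zero (show n / 2 < j + 1 by omega)]; exact Commute.zero_right _

theorem An.d_sq : An.gen (n := n) R .d * An.gen R .d = 0 := by
  have := An.rel (AnRel.d_sq (R := R) (n := n))
  rwa [map_mul, map_zero] at this

variable (R n k)

/-- The map `OΛ_k → M_k^n`, `f ↦ f ⊗ 1`. -/
def M.ofOLam : OLam R k →ₐ[R] M R n k :=
  (M.mk R n k).comp (GradedTensorProduct.includeLeft (OLam.parity R k) (An.parity R n))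

variable {R n k}

theorem M.mk_tmul (f : OLam R k) (y : An R n) :
    M.mk R n k (GradedTensorProduct.tmul R f y) = M.ofOLam R n k f * M.ofAn R n k y := by
  rw [M.ofOLam, M.ofAn, AlgHom.comp_apply, AlgHom.comp_apply, ← map_mul]
  exact congrArg _ (GradedTensorProduct.tmul_one_mul_one_tmul (OLam.parity R k) (An.parity R n)
    f y).symm

theorem M.mk_surjective : Function.Surjective (M.mk R n k) := RingQuot.mkAlgHom_surjective R _

theorem M.ofAn_mul_ofOLam {i j : ZMod 2} {f : OLam R k} {y : An R n} (hf : f ∈ OLam.parity R k i)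
    (hy : y ∈ An.parity R n j) :
    M.ofAn R n k y * M.ofOLam R n k f =
      (-1 : ℤˣ) ^ (j * i) • (M.ofOLam R n k f * M.ofAn R n k y) := by
  rw [← M.mk_tmul, M.ofOLam, M.ofAn, AlgHom.comp_apply, AlgHom.comp_apply, ← map_mul]
  have h := GradedTensorProduct.tmul_coe_mul_coe_tmul (R := R) (OLam.parity R k) (An.parity R n)
    1 ⟨y, hy⟩ ⟨f, hf⟩ 1
  rw [one_mul, mul_one] at h
  refine (congrArg _ h).trans ?_
  rw [Units.smul_def, map_zsmul, Units.smul_def]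

theorem M.mk_hPrime (m : ℕ) :
    M.mk R n k (hPrime R n k m) = ∑ r ∈ Finset.range (m + 1),
      (-1) ^ r * (M.ofOLam R n k (h R k (m - r)) * M.ofAn R n k (An.c R n r)) := by
  rw [hPrime, map_sum]
  refine Finset.sum_congr rfl fun r _ => ?_
  rw [map_mul, map_pow, map_neg, map_one, M.mk_tmul]

theorem M.mk_hPrime_eq_zero {m : ℕ} (h1 : n - k + 1 ≤ m) (h2 : m ≤ n) :
    M.mk R n k (hPrime R n k m) = 0 :=
  (RingQuot.mkAlgHom_rel R (MRel.hPrime (R := R) m h1 h2)).trans (map_zero _)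

theorem M.hom_ext {B : Type*} [Ring B] [Algebra R B] {F G : M R n k →ₐ[R] B}
    (hA : ∀ y, F (M.ofAn R n k y) = G (M.ofAn R n k y))
    (hE : ∀ r, F (M.ofOLam R n k (eps R k r)) = G (M.ofOLam R n k (eps R k r))) : F = G := by
  have h : F.comp (M.mk R n k) = G.comp (M.mk R n k) := by
    refine GradedTensorProduct.algHom_ext _ _ ?_ ?_
    · exact OLam.hom_ext hE
    · exact AlgHom.ext hA
  ext x
  obtain ⟨x, rfl⟩ := M.mk_surjective x
  exact DFunLike.congr_fun h x

open PowerSeries (coeff C)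

variable (R n k) in
/-- The generating series of the `c_r` with alternating signs. -/
def M.cSeries : PowerSeries (M R n k) := .mk fun r => (-1) ^ r * M.ofAn R n k (An.c R n r)

variable (R n k) in
/-- The generating series of the `h'_r`. -/
def M.hSeries : PowerSeries (M R n k) := .mk fun r => M.mk R n k (hPrime R n k r)

theorem M.coeff_hSeries (r : ℕ) : coeff r (M.hSeries R n k) = M.mk R n k (hPrime R n k r) :=
  PowerSeries.coeff_mk _ _

theorem map_h_mul_eq {B : Type*} [Ring B] [Algebra R B] (F : OLam R k →ₐ[R] B) (f : An R n →ₐ[R] B)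
    (m : ℕ) : ∑ r ∈ Finset.range (m + 1), (-1) ^ r * (F (h R k (m - r)) * f (An.c R n r)) =
      coeff m ((.mk fun r => F (h R k r)) * .mk fun r => (-1) ^ r * f (An.c R n r)) := by
  rw [PowerSeries.coeff_mul, ← Finset.Nat.sum_antidiagonal_swap,
    Finset.Nat.sum_antidiagonal_eq_sum_range_succ_mk]
  refine Finset.sum_congr rfl fun r _ => ?_
  simp only [Prod.swap, PowerSeries.coeff_mk]
  rcases Nat.even_or_odd r with hr | hr <;> simp [hr.neg_one_pow]

theorem map_eps_mul_map_h {B : Type*} [Ring B] [Algebra R B] (F : OLam R k →ₐ[R] B) :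
    (PowerSeries.mk fun r => sgn r • F (eps R k r)) * .mk (fun r => F (h R k r)) = 1 := by
  have h1 := congrArg (PowerSeries.map F.toRingHom) (eps_mul_h R k)
  rw [map_mul, map_one] at h1
  rw [← h1]
  congr 1
  ext r; simp

/-- The universal property of `M_k^n`. -/
theorem M.exists_lift {B : Type*} [Ring B] [Algebra R B] (f : An R n →ₐ[R] B) (w p : ℕ → B)
    (hw : OddSeq (zext w)) (h0 : w 0 = 1) (hwk : ∀ r, k < r → w r = 0)
    (hd : ∀ r, f (An.gen R .d) * w r = (-1) ^ r * (w r * f (An.gen R .d)))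
    (hchi : ∀ j r, Commute (f (An.gen R (.chi j))) (w r))
    (hp : (PowerSeries.mk fun r => sgn r • w r) * .mk p = .mk fun r => (-1) ^ r * f (An.c R n r))
    (hpn : ∀ r, n - k < r → p r = 0) :
    ∃ F : M R n k →ₐ[R] B, (∀ y, F (M.ofAn R n k y) = f y) ∧
      (∀ r, F (M.ofOLam R n k (eps R k r)) = w r) ∧
      ∀ r, F (M.mk R n k (hPrime R n k r)) = p r := by
  let G : OLam R k →ₐ[R] B := OLam.lift w hw h0 hwk
  have hG : ∀ r, G (eps R k r) = w r := OLam.lift_eps w hw h0 hwk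
  have hcomm : ∀ r g, G (eps R k r) * f (An.gen R g) =
      (-1 : ℤˣ) ^ (AnGen.par g * (r : ZMod 2)) • (f (An.gen R g) * G (eps R k r)) := by
    rintro r (_ | j)
    · rw [hG, hd, AnGen.par, one_mul, uzpow_natCast]
      rcases Nat.even_or_odd r with hr | hr <;> simp [hr.neg_one_pow]
    · rw [hG, (hchi j r).eq, AnGen.par, zero_mul, uzpow_zero, one_smul]
  let T : OLamAn R n k →ₐ[R] B := GradedTensorProduct.lift _ _ G f fun i j a b =>
    wordPart_supercomm G f hcomm (by rw [← OLam.parity_eq]; exact a.2) b.2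
  have hT : ∀ x y, T (GradedTensorProduct.tmul R x y) = G x * f y := fun x y => rfl
  have hTp : ∀ m, T (hPrime R n k m) = p m := by
    intro m
    have e : T (hPrime R n k m) =
        ∑ r ∈ Finset.range (m + 1), (-1) ^ r * (G (h R k (m - r)) * f (An.c R n r)) := by
      rw [hPrime, map_sum]
      refine Finset.sum_congr rfl fun r _ => ?_
      rw [map_mul, map_pow, map_neg, map_one, hT]
    rw [e, map_h_mul_eq, ← PowerSeries.coeff_mk m p]
    congr 1
    -- The image of `H S` and the prescribed series `p` both become the image of `S` after
    -- multiplication by the unit `∑ sgn r w_r t^r` from the left, so they agree.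
    have hu : IsUnit (PowerSeries.mk fun r => sgn r • w r) := isUnit_of_coeff_zero (by simp [h0])
    have h1 := map_eps_mul_map_h G
    simp only [hG] at h1
    rw [← hu.mul_right_inj, hp, ← mul_assoc, h1, one_mul]
  refine ⟨RingQuot.liftAlgHom R ⟨T, ?_⟩, fun y => ?_, fun r => ?_, fun r => ?_⟩
  · rintro _ _ ⟨m, h1, h2⟩
    rw [hTp, hpn m (by omega), map_zero]
  · refine (RingQuot.liftAlgHom_mkAlgHom_apply R _ _ _).trans ?_
    exact (hT 1 y).trans (by rw [map_one, one_mul])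
  · refine (RingQuot.liftAlgHom_mkAlgHom_apply R _ _ _).trans ?_
    exact (hT _ 1).trans (by rw [map_one, mul_one, hG])
  · exact (RingQuot.liftAlgHom_mkAlgHom_apply R _ _ _).trans (hTp r)

theorem M.ofAn_d_mul {r : ℕ} {f : OLam R k} (hf : f ∈ OLam.parity R k r) :
    M.ofAn R n k (An.gen R .d) * M.ofOLam R n k f =
      (-1) ^ r * (M.ofOLam R n k f * M.ofAn R n k (An.gen R .d)) := by
  rw [M.ofAn_mul_ofOLam hf An.d_parity, one_mul, uzpow_natCast]
  rcases Nat.even_or_odd r with hr | hr <;> simp [hr.neg_one_pow]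

theorem M.ofAn_chi_commute {r : ℕ} {f : OLam R k} (hf : f ∈ OLam.parity R k r) (j : ℕ) :
    Commute (M.ofAn R n k (An.chi R n j)) (M.ofOLam R n k f) := by
  rw [Commute, SemiconjBy, M.ofAn_mul_ofOLam hf (An.chi_parity j), zero_mul, uzpow_zero, one_smul]

variable (R n k) in
/-- The generating series attached to `M_k^n`. -/
def M.seriesData : SeriesData (M R n k) where
  D := M.ofAn R n k (An.gen R .d)
  -- This field counts the terms of the even series: `χ_j` vanishes for `j > n / 2`.
  n := n / 2 + 1
  c j := M.ofAn R n k (An.chi R n j)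
  E := .mk fun r => sgn r • M.ofOLam R n k (eps R k r)
  H := .mk fun r => M.ofOLam R n k (h R k r)
  sq := by rw [← map_mul, An.d_sq, map_zero]
  EH := map_eps_mul_map_h _
  HE := by
    have hu : IsUnit (PowerSeries.mk fun r => sgn r • M.ofOLam R n k (eps R k r)) :=
      isUnit_of_coeff_zero (by simp [eps_zero])
    rw [← hu.mul_right_inj, ← mul_assoc, map_eps_mul_map_h, one_mul, mul_one]
  commD j := (An.chi_commute_gen j .d).map (M.ofAn R n k)
  commc i j := (An.chi_commute_chi i j).map (M.ofAn R n k)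
  commH j := commute_C_iff.2 fun r => by
    rw [PowerSeries.coeff_mk]; exact M.ofAn_chi_commute (h_parity r) j
  superE := superComm_iff.2 fun r => by
    rw [PowerSeries.coeff_mk, mul_smul_comm, M.ofAn_d_mul (eps_parity r), smul_mul_assoc,
      mul_smul_comm]
  superH := superComm_iff.2 fun r => by
    rw [PowerSeries.coeff_mk, M.ofAn_d_mul (h_parity r)]
  oddH := by
    have := (oddSeq_h R k).map (M.ofOLam R n k).toRingHom
    rw [← zext_map] at this
    simp only [PowerSeries.coeff_mk]
    exact this

theorem M.seriesData_S : (M.seriesData R n k).S = M.cSeries R n k := by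
  have hV : ∀ m, coeff m (M.seriesData R n k).V =
      if Even m then M.ofAn R n k (An.chi R n (m / 2)) else 0 :=
    coeff_evenSeries (n := n / 2 + 1) (c := fun j => M.ofAn R n k (An.chi R n j)) fun j hj => by
      rw [An.chi_eq_zero (by omega), map_zero]
  ext m
  rw [M.cSeries, PowerSeries.coeff_mk, SeriesData.S]
  rcases m with _ | r
  · rw [SeriesData.coeff_L_mul_zero, hV]; simp [An.c]
  · rw [SeriesData.coeff_L_mul_succ, hV, hV, An.c, Nat.add_sub_cancel]
    rcases Nat.even_or_odd r with hr | hr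
    · have hr' : ¬ Even (r + 1) := by simpa [Nat.even_add_one] using hr
      rw [if_neg hr', if_neg hr', if_pos hr, zero_sub, hr.add_one.neg_one_pow, neg_one_mul, map_mul]
      rfl
    · have hr' : Even (r + 1) := hr.add_one
      rw [if_pos hr', if_pos hr', if_neg (Nat.not_even_iff_odd.2 hr), mul_zero, sub_zero,
        hr'.neg_one_pow, one_mul]

theorem M.H_mul_S : (M.seriesData R n k).H * (M.seriesData R n k).S = M.hSeries R n k := by
  ext m
  rw [M.seriesData_S, M.coeff_hSeries, M.mk_hPrime, map_h_mul_eq]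
  rfl

theorem M.E_mul_hSeries :
    (M.seriesData R n k).E * M.hSeries R n k = M.cSeries R n k := by
  rw [← M.H_mul_S, ← mul_assoc, (M.seriesData R n k).EH, one_mul, M.seriesData_S]

theorem M.coeff_E (r : ℕ) :
    coeff r (M.seriesData R n k).E = sgn r • M.ofOLam R n k (eps R k r) :=
  PowerSeries.coeff_mk r fun r => sgn r • M.ofOLam R n k (eps R k r)

theorem M.coeff_E_zero : coeff 0 (M.seriesData R n k).E = 1 := by
  rw [M.coeff_E, eps_zero, map_one, sgn_zero, one_smul]

theorem M.coeff_E_top {r : ℕ} (hr : k < r) : coeff r (M.seriesData R n k).E = 0 := by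
  rw [M.coeff_E, eps_top R k hr, map_zero, smul_zero]

/-- In `E H' = S` the right side has degree at most `n`, where for even `n` the relation `d χ_{n/2}
= 0` enters. As `E` has degree at most `k` and constant term one, the `k` imposed zeros of `H'`
propagate to all higher degrees. -/
theorem M.mk_hPrime_top (hk : k ≤ n) {m : ℕ} (hm : n - k < m) :
    M.mk R n k (hPrime R n k m) = 0 := by
  rw [← M.coeff_hSeries]
  refine coeff_eq_zero_of_mul hk M.coeff_E_zero (fun r hr => M.coeff_E_top hr) (fun m hm => ?_)
    (fun m h1 h2 => ?_) m hm
  · rw [M.E_mul_hSeries, M.cSeries, PowerSeries.coeff_mk, An.c_eq_zero hm, map_zero, mul_zero]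
  · rw [M.coeff_hSeries, M.mk_hPrime_eq_zero h1 h2]

/-- The series `H'` has constant term one, so `E H' = S` determines `E`, hence the images of all
`ε_r`, from the images of the `h'_r` and of `A_n`. -/
theorem M.hom_ext_hPrime {B : Type*} [Ring B] [Algebra R B] {F G : M R n k →ₐ[R] B}
    (hA : ∀ y, F (M.ofAn R n k y) = G (M.ofAn R n k y))
    (hH : ∀ r, F (M.mk R n k (hPrime R n k r)) = G (M.mk R n k (hPrime R n k r))) : F = G := by
  refine M.hom_ext hA fun r => ?_
  have h1 := congrArg (PowerSeries.map F.toRingHom) (M.E_mul_hSeries (R := R) (n := n) (k := k))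
  have h2 := congrArg (PowerSeries.map G.toRingHom) (M.E_mul_hSeries (R := R) (n := n) (k := k))
  have e1 : PowerSeries.map F.toRingHom (M.hSeries R n k) =
      PowerSeries.map G.toRingHom (M.hSeries R n k) := by
    ext r; simpa [M.coeff_hSeries] using hH r
  have e2 : PowerSeries.map F.toRingHom (M.cSeries R n k) =
      PowerSeries.map G.toRingHom (M.cSeries R n k) := by
    ext r; simp [M.cSeries, hA]
  rw [map_mul] at h1 h2
  have hu : IsUnit (PowerSeries.map G.toRingHom (M.hSeries R n k)) := by
    refine isUnit_of_coeff_zero ?_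
    have : M.mk R n k (hPrime R n k 0) = 1 := by
      rw [M.mk_hPrime]; simp [h_zero, An.c, An.chi_zero]
    rw [PowerSeries.coeff_map, M.coeff_hSeries, this, map_one]
  rw [e1, e2, ← h2, hu.mul_left_inj] at h1
  have h3 := congrArg (coeff r) h1
  rw [PowerSeries.coeff_map, PowerSeries.coeff_map, M.coeff_E, map_zsmul, map_zsmul] at h3
  have h4 := congrArg (fun x => sgn r • x) h3
  simp only [smul_smul, sgn_mul_self, one_smul] at h4
  exact h4

end Structure

/-! ### Parities in `M_k^n` -/

section Parity

variable {R : Type*} [CommRing R] {n k : ℕ}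

theorem M.mk_tmul_mem {a b : ZMod 2} {f : OLam R k} {y : An R n} (hf : f ∈ OLam.parity R k a)
    (hy : y ∈ An.parity R n b) :
    M.ofOLam R n k f * M.ofAn R n k y ∈ M.parity R n k (a + b) :=
  ⟨GradedTensorProduct.tmul R f y, Submodule.subset_span ⟨a, b, f, y, rfl, hf, hy, rfl⟩,
    M.mk_tmul f y⟩

theorem M.parity_eq_span (i : ZMod 2) : M.parity R n k i =
    Submodule.span R {x | ∃ (a b : ZMod 2) (f : OLam R k) (y : An R n), a + b = i ∧
      f ∈ OLam.parity R k a ∧ y ∈ An.parity R n b ∧ x = M.ofOLam R n k f * M.ofAn R n k y} := by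
  rw [M.parity, OLamAn.parity, Submodule.map_span]
  congr 1
  ext x
  constructor
  · rintro ⟨_, ⟨a, b, f, y, hab, hf, hy, rfl⟩, rfl⟩
    exact ⟨a, b, f, y, hab, hf, hy, M.mk_tmul f y⟩
  · rintro ⟨a, b, f, y, hab, hf, hy, rfl⟩
    exact ⟨_, ⟨a, b, f, y, hab, hf, hy, rfl⟩, M.mk_tmul f y⟩

theorem M.ofOLam_mem {a : ZMod 2} {f : OLam R k} (hf : f ∈ OLam.parity R k a) :
    M.ofOLam R n k f ∈ M.parity R n k a := by
  have := M.mk_tmul_mem (n := n) hf (SetLike.GradedOne.one_mem (A := An.parity R n))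
  rwa [map_one, mul_one, add_zero] at this

theorem M.ofAn_mem {a : ZMod 2} {y : An R n} (hy : y ∈ An.parity R n a) :
    M.ofAn R n k y ∈ M.parity R n k a := by
  have := M.mk_tmul_mem (k := k) (SetLike.GradedOne.one_mem (A := OLam.parity R k)) hy
  rwa [map_one, one_mul, zero_add] at this

theorem units_smul_mem {N : Type*} [AddCommGroup N] [Module R N] (S : Submodule R N) (u : ℤˣ)
    {x : N} (hx : x ∈ S) : u • x ∈ S := by
  rw [Units.smul_def]
  exact S.toAddSubgroup.zsmul_mem hx _

instance M.gradedMonoid : SetLike.GradedMonoid (M.parity R n k) where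
  one_mem := by
    have := M.ofOLam_mem (n := n) (SetLike.GradedOne.one_mem (A := OLam.parity R k))
    rwa [map_one] at this
  mul_mem i j u v hu hv := by
    rw [M.parity_eq_span] at hu hv
    have h := Submodule.mul_mem_mul hu hv
    rw [Submodule.span_mul_span] at h
    refine Submodule.span_le.2 ?_ h
    rintro _ ⟨_, ⟨a, b, f, y, rfl, hf, hy, rfl⟩, _, ⟨a', b', f', y', rfl, hf', hy', rfl⟩, rfl⟩
    have e : M.ofOLam R n k f * M.ofAn R n k y * (M.ofOLam R n k f' * M.ofAn R n k y') =
        (-1 : ℤˣ) ^ (b * a') • (M.ofOLam R n k (f * f') * M.ofAn R n k (y * y')) := by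
      rw [mul_assoc, ← mul_assoc (M.ofAn R n k y), M.ofAn_mul_ofOLam hf' hy, smul_mul_assoc,
        mul_smul_comm, map_mul, map_mul]
      simp only [mul_assoc]
    have h := M.mk_tmul_mem (SetLike.GradedMul.mul_mem hf hf') (SetLike.GradedMul.mul_mem hy hy')
    rw [add_add_add_comm] at h
    simp only [e]
    exact units_smul_mem _ _ h

/-- A map of `A_n`-algebras is even if it is so on the elementary symmetric polynomials. -/
theorem M.map_parity {k' : ℕ} (F : M R n k →ₐ[R] M R n k')
    (hA : ∀ y, F (M.ofAn R n k y) = M.ofAn R n k' y)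
    (hE : ∀ r : ℕ, F (M.ofOLam R n k (eps R k r)) ∈ M.parity R n k' r) {i : ZMod 2} {x : M R n k}
    (hx : x ∈ M.parity R n k i) : F x ∈ M.parity R n k' i := by
  have h1 : ∀ (a : ZMod 2) (f : OLam R k), f ∈ OLam.parity R k a →
      F (M.ofOLam R n k f) ∈ M.parity R n k' a := by
    intro a f hf
    rw [OLam.parity_eq] at hf
    have := Submodule.mem_map_of_mem (f := (F.comp (M.ofOLam R n k)).toLinearMap) hf
    refine (Submodule.map_span_le _ _ _).2 ?_ this
    rintro _ ⟨l, rfl, rfl⟩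
    clear hf this
    simp only [AlgHom.toLinearMap_apply, map_list_prod, List.map_map]
    induction l with
    | nil => exact SetLike.GradedOne.one_mem (A := M.parity R n k')
    | cons r l ih =>
      simp only [List.map_cons, List.prod_cons, List.sum_cons]
      exact SetLike.GradedMul.mul_mem (hE r) ih
  rw [M.parity_eq_span] at hx
  have := Submodule.mem_map_of_mem (f := F.toLinearMap) hx
  refine (Submodule.map_span_le _ _ _).2 ?_ this
  rintro _ ⟨a, b, f, y, rfl, hf, hy, rfl⟩
  rw [AlgHom.toLinearMap_apply, map_mul, hA]
  exact SetLike.GradedMul.mul_mem (h1 a f hf) (M.ofAn_mem hy)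

open PowerSeries (coeff)

variable (R n k) in
/-- The power series whose coefficients have the parity of their degree. -/
def M.ParitySeries (φ : PowerSeries (M R n k)) : Prop := ∀ r : ℕ, coeff r φ ∈ M.parity R n k r

theorem M.ParitySeries.mul {φ ψ : PowerSeries (M R n k)} (hφ : M.ParitySeries R n k φ)
    (hψ : M.ParitySeries R n k ψ) : M.ParitySeries R n k (φ * ψ) := by
  intro r
  rw [PowerSeries.coeff_mul]
  refine Submodule.sum_mem _ fun x hx => ?_
  rw [← Finset.HasAntidiagonal.mem_antidiagonal.1 hx, Nat.cast_add]
  exact SetLike.GradedMul.mul_mem (hφ _) (hψ _)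

theorem zsmul_mem_submodule {N : Type*} [AddCommGroup N] [Module R N] (S : Submodule R N) (c : ℤ)
    {x : N} (hx : x ∈ S) : c • x ∈ S :=
  S.toAddSubgroup.zsmul_mem hx c

theorem M.ParitySeries.alt {φ : PowerSeries (M R n k)} (hφ : M.ParitySeries R n k φ) (s : ℤ) :
    M.ParitySeries R n k (alt s φ) := fun r => by
  rw [coeff_alt]; exact zsmul_mem_submodule _ _ (hφ r)

theorem M.paritySeries_H : M.ParitySeries R n k (M.seriesData R n k).H := fun r => by
  rw [M.seriesData, PowerSeries.coeff_mk]
  exact M.ofOLam_mem (h_parity r)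

theorem M.paritySeries_S : M.ParitySeries R n k (M.seriesData R n k).S := fun r => by
  rw [M.seriesData_S, M.cSeries, PowerSeries.coeff_mk, ← SeriesData.neg_one_pow_smul_eq]
  exact zsmul_mem_submodule _ _ (M.ofAn_mem (An.c_parity r))

end Parity

/-! ### The isomorphism -/

section Iso

open PowerSeries (coeff)

variable (R : Type*) [CommRing R] (n k : ℕ)

theorem sgn_smul_sgn_smul {N : Type*} [AddCommGroup N] (r : ℕ) (x : N) :
    sgn r • sgn r • x = x := by
  rw [smul_smul, sgn_mul_self, one_smul]

theorem neg_one_pow_mul_self (k : ℕ) : ((-1 : ℤ) ^ k) * (-1) ^ k = 1 := by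
  rw [← mul_pow]; simp

theorem coeff_zero_mul_eq {N : Type*} [Ring N] (φ ψ : PowerSeries N) :
    coeff 0 (φ * ψ) = coeff 0 φ * coeff 0 ψ := by
  simp

theorem mk_coeff {N : Type*} [Ring N] (φ : PowerSeries N) :
    (PowerSeries.mk fun r => coeff r φ) = φ := by
  ext r; simp

theorem mk_sgn_smul_coeff {N : Type*} [Ring N] (φ : PowerSeries N) :
    (PowerSeries.mk fun r => sgn r • sgn r • coeff r φ) = φ := by
  ext r; rw [PowerSeries.coeff_mk, sgn_smul_sgn_smul]

theorem M.coeff_S_zero : coeff 0 (M.seriesData R n k).S = 1 := by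
  rw [M.seriesData_S, M.cSeries, PowerSeries.coeff_mk]; simp [An.c, An.chi_zero]

theorem M.coeff_H_zero : coeff 0 (M.seriesData R n k).H = 1 := by
  rw [M.seriesData, PowerSeries.coeff_mk, h_zero, map_one]

theorem SeriesData.superComm_S {N : Type*} [Ring N] (d : SeriesData N) : SuperComm d.D d.S :=
  d.superComm_L.mul d.superComm_V

theorem SeriesData.commute_S {N : Type*} [Ring N] (d : SeriesData N) (j : ℕ) :
    Commute (PowerSeries.C (d.c j)) d.S := by
  have hD : Commute (PowerSeries.C (d.c j)) (PowerSeries.C d.D) := (d.commD j).map PowerSeries.C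
  refine Commute.mul_right ((Commute.one_right _).sub_right
    (hD.mul_right (PowerSeries.commute_X _))) ?_
  exact (commute_evenSeries fun i => (d.commc i j).map PowerSeries.C).symm

theorem commute_alt {N : Type*} [Ring N] {a : N} {φ : PowerSeries N}
    (h : Commute (PowerSeries.C a) φ) (s : ℤ) : Commute (PowerSeries.C a) (alt s φ) := by
  have := h.map (alt s)
  rwa [alt_C] at this

theorem M.ofAn_gen_chi (j : Fin (n / 2)) :
    M.ofAn R n k (An.gen R (.chi j)) = (M.seriesData R n k).c (j + 1) := by
  change _ = M.ofAn R n k (An.chi R n (j + 1))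
  rw [An.chi, chiFree.eq_2, dif_pos j.2]
  rfl

/-- A map out of `M_k^n` prescribed by power series over `M_{k'}^n`. -/
theorem M.exists_lift_series {k' : ℕ} (W P : PowerSeries (M R n k'))
    (hW : OddSeq (zext fun r => coeff r W)) (h0 : coeff 0 W = 1)
    (hWk : ∀ r, k < r → coeff r W = 0) (hd : SuperComm (M.seriesData R n k').D W)
    (hc : ∀ j, Commute (PowerSeries.C ((M.seriesData R n k').c j)) W)
    (hP : W * P = (M.seriesData R n k').S) (hPn : ∀ r, n - k < r → coeff r P = 0) :
    ∃ F : M R n k →ₐ[R] M R n k', (∀ y, F (M.ofAn R n k y) = M.ofAn R n k' y) ∧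
      (∀ r, F (M.ofOLam R n k (eps R k r)) = sgn r • coeff r W) ∧
      ∀ r, F (M.mk R n k (hPrime R n k r)) = coeff r P := by
  -- `W` is to be the image of the signed series `E`, so `ε_r` has to go to `sgn r` times the
  -- coefficient of `W`.
  refine M.exists_lift (M.ofAn R n k') _ _ hW.zext_sgn_smul (by simp [h0])
    (fun r hr => by rw [hWk r hr, smul_zero]) (fun r => ?_) (fun j r => ?_) ?_ hPn
  · have := superComm_iff.1 hd r
    change _ * coeff r W = _ at this
    rw [mul_smul_comm, smul_mul_assoc, mul_smul_comm]
    exact congrArg _ this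
  · rw [M.ofAn_gen_chi]
    exact (commute_C_iff.1 (hc _) r).smul_right _
  · rw [mk_sgn_smul_coeff, mk_coeff, hP, M.seriesData_S, M.cSeries]

theorem M.coeff_H_mul_S (r : ℕ) :
    coeff r ((M.seriesData R n k).H * (M.seriesData R n k).S) = M.mk R n k (hPrime R n k r) := by
  rw [M.H_mul_S, M.coeff_hSeries]

/-- The map `M_k^n → M_{n-k}^n`. -/
theorem M.exists_gamma (hk : k ≤ n) :
    ∃ F : M R n k →ₐ[R] M R n (n - k), (∀ y, F (M.ofAn R n k y) = M.ofAn R n (n - k) y) ∧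
      (∀ r : ℕ, F (M.ofOLam R n k (eps R k r)) ∈ M.parity R n (n - k) r) ∧
      ∀ r, F (M.mk R n k (hPrime R n k r)) =
        ((-1 : ℤ) ^ k) ^ r • sgn r • M.ofOLam R n (n - k) (eps R (n - k) r) := by
  set d := M.seriesData R n (n - k) with hdef
  have hs := neg_one_pow_mul_self k
  -- The prescribed images of the `h'_r` are the coefficients of `P = E(s t)`. Then `W P = S` forces
  -- `W = S(t) H(s t)`.
  have h0 : coeff 0 (d.S * alt ((-1) ^ k) d.H) = 1 := by
    rw [coeff_zero_mul_eq, hdef, M.coeff_S_zero, coeff_alt, M.coeff_H_zero]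
    simp
  have htop : ∀ r, k < r → coeff r (d.S * alt ((-1) ^ k) d.H) = 0 := by
    refine d.coeff_S_mul_alt_H fun m hm => ?_
    rw [hdef, M.coeff_H_mul_S]
    exact M.mk_hPrime_top (Nat.sub_le n k) (by omega)
  have hmul : d.S * alt ((-1) ^ k) d.H * alt ((-1) ^ k) d.E = d.S := by
    rw [mul_assoc, ← map_mul, d.HE, map_one, mul_one]
  have hE0 : ∀ r, n - k < r → coeff r (alt ((-1) ^ k) d.E) = 0 := fun r hr => by
    rw [coeff_alt, M.coeff_E_top hr, smul_zero]
  obtain ⟨F, hA, hE, hH⟩ := M.exists_lift_series R n k _ _ (d.oddSeq_S_mul_alt_H hs) h0 htop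
    (d.superComm_S.mul (d.superH.alt _))
    (fun j => (d.commute_S j).mul_right (commute_alt (d.commH j) _)) hmul hE0
  refine ⟨F, hA, fun r => ?_, fun r => ?_⟩
  · rw [hE]
    exact zsmul_mem_submodule _ _ ((M.paritySeries_S.mul (M.paritySeries_H.alt _)) r)
  · rw [hH, coeff_alt, M.coeff_E]

/-- The inverse map `M_{n-k}^n → M_k^n`. -/
theorem M.exists_delta (hk : k ≤ n) :
    ∃ F : M R n (n - k) →ₐ[R] M R n k, (∀ y, F (M.ofAn R n (n - k) y) = M.ofAn R n k y) ∧
      (∀ r : ℕ, F (M.ofOLam R n (n - k) (eps R (n - k) r)) ∈ M.parity R n k r) ∧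
      ∀ r, F (M.ofOLam R n (n - k) (eps R (n - k) r)) =
        sgn r • ((-1 : ℤ) ^ k) ^ r • M.mk R n k (hPrime R n k r) := by
  set d := M.seriesData R n k with hdef
  have hs := neg_one_pow_mul_self k
  have hkk : n - (n - k) = k := by omega
  -- Inverting `γ` forces `W = H'(s t)`. The matching second factor is the conjugated series of
  -- `alt_H_mul`, whose degree is bounded by `coeff_conj`.
  have hodd : OddSeq (zext fun r => coeff r (alt ((-1) ^ k) (d.H * d.S))) := by
    simpa only [coeff_alt] using d.oddSeq_H_mul_S.zext_pow_smul ((-1) ^ k)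
  have h0 : coeff 0 (alt ((-1) ^ k) (d.H * d.S)) = 1 := by
    rw [coeff_alt, coeff_zero_mul_eq, hdef, M.coeff_S_zero, M.coeff_H_zero]
    simp
  have htop : ∀ r, n - k < r → coeff r (alt ((-1) ^ k) (d.H * d.S)) = 0 := fun r hr => by
    rw [coeff_alt, M.coeff_H_mul_S, M.mk_hPrime_top hk hr, smul_zero]
  obtain ⟨F, hA, hE, -⟩ := M.exists_lift_series R n (n - k) _ _ hodd h0 htop
    ((d.superH.mul d.superComm_S).alt _)
    (fun j => commute_alt ((d.commH j).mul_right (d.commute_S j)) _) (d.alt_H_mul hs)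
    fun r hr => d.coeff_conj (fun r hr => M.coeff_E_top hr) r (hkk ▸ hr)
  refine ⟨F, hA, fun r => ?_, fun r => ?_⟩
  · rw [hE]
    exact zsmul_mem_submodule _ _ (((M.paritySeries_H.mul M.paritySeries_S).alt _) r)
  · rw [hE, coeff_alt, M.coeff_H_mul_S]

/-- By `(r + 1).choose 2 = r + r.choose 2`, the factor `sgn r` supplies the extra `r` in the
exponent. -/
theorem sign_smul_eq {N : Type*} [Ring N] (k r : ℕ) (x : N) :
    ((-1 : ℤ) ^ k) ^ r • sgn r • x = (-1) ^ ((k + 1) * r + r.choose 2) * x := by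
  rw [← SeriesData.neg_one_pow_smul_eq, smul_smul, sgn, ← pow_mul, ← pow_add,
    Nat.choose_succ_succ' r 1, Nat.choose_one_right, add_mul, one_mul, add_assoc]

end Iso

end OddGr

end

theorem mainTheorem7 (R : Type*) [CommRing R] (n k : ℕ) (hk : k ≤ n) :
    ∃! γ : OddGr.M R n k ≃ₐ[R] OddGr.M R n (n - k),
      (∀ a : OddGr.An R n, γ (OddGr.M.ofAn R n k a) = OddGr.M.ofAn R n (n - k) a) ∧
      (∀ (i : ZMod 2) (x : OddGr.M R n k),
        x ∈ OddGr.M.parity R n k i ↔ γ x ∈ OddGr.M.parity R n (n - k) i) ∧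
      ∀ r : ℕ, γ (OddGr.M.mk R n k (OddGr.hPrime R n k r)) =
        (-1) ^ ((k + 1) * r + r.choose 2) *
          OddGr.M.mk R n (n - k)
            (GradedTensorProduct.tmul R (OddGr.eps R (n - k) r) (1 : OddGr.An R n)) := by
  obtain ⟨F, hFA, hFP, hFH⟩ := OddGr.M.exists_gamma R n k hk
  obtain ⟨G, hGA, hGP, hGE⟩ := OddGr.M.exists_delta R n k hk
  have hs : ∀ r : ℕ, ((-1 : ℤ) ^ k) ^ r * ((-1) ^ k) ^ r = 1 := fun r => by
    rw [← mul_pow, OddGr.neg_one_pow_mul_self, one_pow]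
  -- `G` is known on the `ε_r` and `F` on the `h'_r`, so this composite is tested on the `ε_r` and
  -- the other one on the `h'_r`.
  have hFG : F.comp G = AlgHom.id R _ := by
    refine OddGr.M.hom_ext (fun y => ?_) fun r => ?_
    · rw [AlgHom.comp_apply, hGA, hFA, AlgHom.id_apply]
    · rw [AlgHom.comp_apply, hGE, map_zsmul, map_zsmul, hFH, smul_smul (_ ^ r) (_ ^ r), hs,
        one_smul,
        OddGr.sgn_smul_sgn_smul, AlgHom.id_apply]
  have hGF : G.comp F = AlgHom.id R _ := by
    refine OddGr.M.hom_ext_hPrime (fun y => ?_) fun r => ?_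
    · rw [AlgHom.comp_apply, hFA, hGA, AlgHom.id_apply]
    · rw [AlgHom.comp_apply, hFH, map_zsmul, map_zsmul, hGE, OddGr.sgn_smul_sgn_smul, smul_smul, hs,
        one_smul, AlgHom.id_apply]
  refine ⟨AlgEquiv.ofAlgHom F G hFG hGF, ⟨hFA, fun i x => ⟨fun hx => ?_, fun hx => ?_⟩, fun r => ?_⟩,
    ?_⟩
  · exact OddGr.M.map_parity F hFA hFP hx
  · have h1 := OddGr.M.map_parity G hGA hGP hx
    have h2 : G (F x) = x := AlgHom.congr_fun hGF x
    rw [← h2]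
    exact h1
  · exact (hFH r).trans (OddGr.sign_smul_eq k r _)
  · rintro γ ⟨hA, -, hH⟩
    have : γ.toAlgHom = F := OddGr.M.hom_ext_hPrime (fun y => (hA y).trans (hFA y).symm) fun r =>
      (hH r).trans ((hFH r).trans (OddGr.sign_smul_eq k r _)).symm
    ext x
    exact AlgHom.congr_fun this x
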